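/- Let $\Bbbk$ be a field and let $\mathcal{C}$ be a $\Bbbk$-linear abelian category in which all objects have finite length. Let $(\Lambda,\leq)$ be a poset such that $\{\mu \mid \mu\leq\lambda\}$ is finite for all $\lambda\in\Lambda$, and let $(L_\lambda)_{\lambda\in\Lambda}$ be representatives of the isomorphism classes of simple objects of $\mathcal{C}$. For an order ideal $\Gamma\subseteq\Lambda$, let $\mathcal{C}_\Gamma$ be the Serre subcategory generated by the $L_\mu$ with $\mu\in\Gamma$, and write $\mathcal{C}_{\leq\lambda}=\mathcal{C}_{\{\mu\mid\mu\leq\lambda\}}$. Suppose that $\mathcal{C}$ is a highest weight category with weight poset $\Lambda$, i.e. for all $\lambda,\mu\in\Lambda$, the simple object $L_\lambda$ has a projective cover $\Delta_\lambda\to L_\lambda$ and an injective hull $L_\lambda\to\nabla_\lambda$ in $\mathcal{C}_{\leq\lambda}$, $\mathrm{Hom}_\mathcal{C}(\Delta_\lambda,\nabla_\lambda)\cong\Bbbk$, and $\mathrm{Ext}^1_\mathcal{C}(\Delta_\lambda,\nabla_\mu)=\mathrm{Ext}^2_\mathcal{C}(\Delta_\lambda,\nabla_\mu)=0$. A tilting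 object is an object that has both a finite filtration with subquotients of the form $\Delta_\mu$ and a finite filtration with subquotients of the form $\nabla_\mu$; let $\mathrm{Tilt}(\mathcal{C})$ be the full subcategory of tilting objects. For each $\lambda\in\Lambda$ there is an indecomposable tilting object $T_\lambda$, unique up to isomorphism, that belongs to $\mathcal{C}_{\leq\lambda}$ and has composition multiplicity $[T_\lambda:L_\lambda]=1$. Let $[M:T_\mu]_\oplus$ denote the multiplicity of $T_\mu$ in a decomposition of $M$ as a finite direct sum of indecomposable objects. The minimal tilting complex $C_{\min}(M)$ of an object $M$ is the bounded complex of tilting objects, unique up to isomorphism, that is isomorphic to $M$ in $D^b(\mathcal{C})$ and whose differentials lie in the radical of the category $\mathrm{Tilt}(\mathcal{C})$. For a finite order ideal $\Gamma\subseteq\Lambda$, set $T_\Gamma=\bigoplus_{\gamma\in\Gamma}T_\gamma$; the Ringel dual $\mathcal{C}'_\Gamma$ of $\mathcal{C}_\Gamma$ is the category of finite-dimensional left modules over $\mathrm{End}_\mathcal{C}(T_\Gamma)^{\mathrm{op}}$, and for $\nu\in\Gamma$ we set $\nabla'_\nu=\mathrm{Hom}_\mathcal{C}(\Delta_\nu,T_\Gamma)^*$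 and $L'_\nu=\mathrm{soc}\,\nabla'_\nu$. Let $\lambda\in\Lambda$. Then $C_{\min}(L_\lambda)$ exists, and there is a bounded complex $C_\lambda=(T_\bullet,d_\bullet)$ of tilting objects in $\mathcal{C}$ (in cohomological grading, $d_i\colon T_i\to T_{i+1}$) with the following properties: (1) $C_\lambda\cong L_\lambda$ in $D^b(\mathcal{C})$. (2) $[T_i:T_\mu]_\oplus=0$ for all $i\in\mathbb{Z}$ and all $\mu\in\Lambda$ with $\mu\nleq\lambda$. (3) For all $i\in\mathbb{Z}$, all $\mu\in\Lambda$ with $\mu\leq\lambda$ and every finite order ideal $\Gamma\subseteq\Lambda$ with $\lambda\in\Gamma$, \[ [T_i:T_\mu]_\oplus=\sum_{\nu\leq\lambda}\ \sum_{\substack{j,k\geq 0\\ k-j=i}}\dim\mathrm{Ext}^j_{\mathcal{C}}(L_\lambda,\nabla_\nu)\cdot\dim\mathrm{Ext}^k_{\mathcal{C}'_\Gamma}(L'_\mu,\nabla'_\nu), \] where all the dimensions are finite and $\mathrm{Ext}^j_{\mathcal{C}}(L_\lambda,\nabla_\nu)=0$ for all sufficiently large $j$, so that the sum is finite. (4)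 $C_{\min}(L_\lambda)$ is a direct summand of $C_\lambda$ in the category of complexes in $\mathrm{Tilt}(\mathcal{C})$. -/

import Mathlib

open CategoryTheory CategoryTheory.Limits CategoryTheory.Abelian

universe w w' s t v u

namespace MinTilt

attribute [local instance] CategoryTheory.Abelian.hasFiniteBiproducts

section General

variable {C : Type u} [Category.{v} C] [Abelian C]

/-- The Serre subcategory of `C` generated by a family of objects: the intersection of all Serre
subcategories that contain the objects `L i` for `i ∈ I`. -/
def serreClosure {Λ : Type s} (L : Λ → C) (I : Set Λ) : ObjectProperty C := fun X =>
  ∀ P : ObjectProperty C, P.IsSerreClass → (∀ i ∈ I, P (L i)) → P X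

/-- `p : X ⟶ Y` is a projective cover in the Serre subcategory `P` of `C`. -/
structure IsProjectiveCover (P : ObjectProperty C) {X Y : C} (p : X ⟶ Y) : Prop where
  mem : P X
  epi : Epi p
  lift : ∀ ⦃A B : C⦄, P A → P B → ∀ (e : A ⟶ B) (f : X ⟶ B), Epi e → ∃ g : X ⟶ A, g ≫ e = f
  essential : ∀ ⦃A : C⦄, P A → ∀ g : A ⟶ X, Epi (g ≫ p) → Epi g

/-- `i : Y ⟶ X` is an injective hull in the Serre subcategory `P` of `C`. -/
structure IsInjectiveHull (P : ObjectProperty C) {X Y : C} (i : Y ⟶ X) : Prop where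
  mem : P X
  mono : Mono i
  extend : ∀ ⦃A B : C⦄, P A → P B → ∀ (m : A ⟶ B) (f : A ⟶ X), Mono m → ∃ g : B ⟶ X, m ≫ g = f
  essential : ∀ ⦃A : C⦄, P A → ∀ g : X ⟶ A, Mono (i ≫ g) → Mono g

/-- `HasFiltration F M`: there is a filtration `0 = M_0 ⊆ M_1 ⊆ ⋯ ⊆ M_r = M` such that every
subquotient `M_i / M_{i-1}` is isomorphic to a member of the family `F`. -/
inductive HasFiltration {Λ : Type s} (F : Λ → C) : C → Prop
  | zero {M : C} (h : IsZero M) : HasFiltration F M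
  | step {E : ShortComplex C} (hE : E.ShortExact) (h : HasFiltration F E.X₁) (l : Λ)
      (e : Nonempty (E.X₃ ≅ F l)) : HasFiltration F E.X₂

/-- `CompositionMultiplicity S M n`: the object `M` has a (finite) composition series in which
precisely `n` subquotients are isomorphic to the simple object `S`, that is `[M : S] = n`. -/
inductive CompositionMultiplicity (S : C) : C → ℕ → Prop
  | zero {M : C} (h : IsZero M) : CompositionMultiplicity S M 0
  | same {E : ShortComplex C} {n : ℕ} (hE : E.ShortExact) (hs : Simple E.X₃)
      (h : CompositionMultiplicity S E.X₁ n) (e : Nonempty (E.X₃ ≅ S)) :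
      CompositionMultiplicity S E.X₂ (n + 1)
  | other {E : ShortComplex C} {n : ℕ} (hE : E.ShortExact) (hs : Simple E.X₃)
      (h : CompositionMultiplicity S E.X₁ n) (e : IsEmpty (E.X₃ ≅ S)) :
      CompositionMultiplicity S E.X₂ n

/-- `SummandMultiplicity M N m`: the object `M` has a decomposition as a finite direct sum of
indecomposable objects in which precisely `m` summands are isomorphic to `N`, that is
`[M : N]_⊕ = m`. -/
def SummandMultiplicity (M N : C) (m : ℕ) : Prop :=
  ∃ (n : ℕ) (X : Fin n → C), (∀ i, Indecomposable (X i)) ∧ Nonempty (M ≅ ⨁ X) ∧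
    Nat.card {i : Fin n // Nonempty (X i ≅ N)} = m

/-- The radical of the full subcategory of `C` on the objects that satisfy `P`. -/
def InRadical (P : ObjectProperty C) {A B : C} (f : A ⟶ B) : Prop :=
  ∀ Z : C, P Z → ∀ (a : Z ⟶ A) (b : B ⟶ Z),
    (End.of (a ≫ f ≫ b) : End Z) ∈ Ring.jacobson (End Z)

/-- The complex `K` is isomorphic to the object `M`, viewed as a complex in degree zero, in the
derived category. (For bounded `K`, this takes place in the full subcategory `D^b(C)`.) -/
def IsoInDerived [HasDerivedCategory.{w'} C] (K : CochainComplex C ℤ) (M : C) : Prop :=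
  Nonempty (DerivedCategory.Q.obj K ≅ (DerivedCategory.singleFunctor C 0).obj M)

/-- In a finite length category, a property of objects that holds for zero and simple objects
and is closed under extensions holds for all objects. -/
theorem devissage (hlen : ∀ X : C, IsNoetherianObject X ∧ IsArtinianObject X)
    (P : ObjectProperty C) [P.IsClosedUnderIsomorphisms] [P.IsClosedUnderExtensions]
    (h0 : ∀ X : C, IsZero X → P X) (hs : ∀ X : C, Simple X → P X) (X : C) : P X := by
  have := (hlen X).1
  obtain ⟨U, hU, hmax⟩ := (wellFounded_gt (α := Subobject X)).has_min
    {U : Subobject X | P (U : C)} ⟨⊥, h0 _ ((isZero_zero C).of_iso Subobject.botCoeIsoZero)⟩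
  by_cases hz : IsZero (cokernel U.arrow)
  · have : Epi U.arrow := Preadditive.epi_of_isZero_cokernel _ hz
    have : IsIso U.arrow := isIso_of_mono_of_epi _
    exact P.prop_of_iso (asIso U.arrow) hU
  · exfalso
    have := (hlen (cokernel U.arrow)).2
    obtain ⟨S, hS⟩ := exists_simple_subobject hz
    let π := cokernel.π U.arrow
    let j : (U : C) ⟶ pullback π S.arrow := pullback.lift U.arrow 0 (by simp [π])
    have hj : j ≫ pullback.fst π S.arrow = U.arrow := pullback.lift_fst _ _ _
    have hj' : j ≫ pullback.snd π S.arrow = 0 := pullback.lift_snd _ _ _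
    have hjm : Mono j := by
      have : Mono (j ≫ pullback.fst π S.arrow) := by rw [hj]; infer_instance
      exact mono_of_mono j (pullback.fst π S.arrow)
    let E : ShortComplex C := ShortComplex.mk j (pullback.snd π S.arrow) hj'
    have hE : E.ShortExact := by
      have hex : E.Exact := by
        apply ShortComplex.exact_of_f_is_kernel
        refine KernelFork.IsLimit.ofι' _ _ (fun {W} r hr => ?_)
        have h1 : (r ≫ pullback.fst π S.arrow) ≫ cokernel.π U.arrow = 0 := by
          have : r ≫ pullback.snd π S.arrow = 0 := hr
          rw [Category.assoc]
          erw [pullback.condition]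
          rw [← Category.assoc, this, zero_comp]
        refine ⟨Abelian.monoLift U.arrow _ h1, ?_⟩
        have hm : Mono (pullback.fst π S.arrow) := inferInstance
        rw [← cancel_mono (pullback.fst π S.arrow), Category.assoc]
        erw [hj]
        simp
      exact { exact := hex, mono_f := hjm, epi_g := by dsimp [E]; infer_instance }
    have hV : P (pullback π S.arrow) := P.prop_X₂_of_shortExact hE hU (hs _ hS)
    let V : Subobject X := Subobject.mk (pullback.fst π S.arrow)
    have hV' : P (V : C) :=
      P.prop_of_iso (Subobject.underlyingIso (pullback.fst π S.arrow)).symm hV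
    have hle : U ≤ V := Subobject.le_mk_of_comm j hj
    have hne : ¬ V ≤ U := by
      intro hVU
      have hUV : U = V := le_antisymm hle hVU
      let r : pullback π S.arrow ⟶ (U : C) := Subobject.ofMkLE (pullback.fst π S.arrow) U hVU
      have hr : r ≫ U.arrow = pullback.fst π S.arrow := Subobject.ofMkLE_arrow hVU
      have h2 : pullback.snd π S.arrow ≫ S.arrow = 0 := by
        rw [← pullback.condition, ← hr, Category.assoc]
        simp [π]
      have h3 : pullback.snd π S.arrow = 0 := by
        rw [← cancel_mono S.arrow, h2, zero_comp]
      have h4 : Epi (pullback.snd π S.arrow) := inferInstance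
      have h5 : IsZero (S : C) := by
        rw [h3] at h4
        exact IsZero.of_epi_eq_zero (0 : pullback π S.arrow ⟶ (S : C)) rfl
      exact Simple.not_isZero _ h5
    exact hmax V hV' (lt_of_le_not_ge hle hne)

end General

section FiniteDimensionalModules

open scoped ModuleCat

variable (k : Type t) [Field k] (A : Type v) [Ring A] [Algebra k A]

/-- The property of left modules over a `k`-algebra `A` of being finite-dimensional over `k`. -/
def isFinDim : ObjectProperty (ModuleCat.{w} A) := fun M => Module.Finite k M

instance : (isFinDim.{w} k A).IsSerreClass where
  exists_zero := by
    refine ⟨ModuleCat.of A PUnit.{w + 1}, ModuleCat.isZero_of_subsingleton _, ?_⟩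
    exact Module.Finite.of_finite (R := k) (M := ModuleCat.of A PUnit.{w + 1})
  prop_of_mono {M N} f _ hN := by
    have : Module.Finite k N := hN
    exact Module.Finite.of_injective (f.hom.restrictScalars k)
      ((ModuleCat.mono_iff_injective f).1 inferInstance)
  prop_of_epi {M N} f _ hM := by
    have : Module.Finite k M := hM
    exact Module.Finite.of_surjective (f.hom.restrictScalars k)
      ((ModuleCat.epi_iff_surjective f).1 inferInstance)
  prop_X₂_of_shortExact {S} hS h₁ h₃ := by
    have : Module.Finite k S.X₁ := h₁
    have : Module.Finite k S.X₃ := h₃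
    have hsurj := (ModuleCat.epi_iff_surjective S.g).1 hS.epi_g
    have hex := (ShortComplex.ShortExact.moduleCat_exact_iff_function_exact S).1 hS.exact
    exact Module.Finite.of_exact (f := S.f.hom.restrictScalars k) (g := S.g.hom.restrictScalars k)
      hex hsurj

instance : (isFinDim.{w} k A).IsClosedUnderFiniteProducts where
  isClosedUnderLimitsOfShape J _ :=
    { limitsOfShape_le := by
        rintro X ⟨p⟩
        have hfin : ∀ j, Module.Finite k (p.diag.obj j) := p.prop_diag_obj
        have : Finite (Discrete J) := Finite.of_equiv J discreteEquiv.symm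
        refine Module.Finite.of_injective
          (LinearMap.pi fun j => (p.π.app j).hom.restrictScalars k) ?_
        intro x y hxy
        exact Concrete.isLimit_ext p.diag p.isLimit x y fun j => congrFun hxy j }

/-- The category of finite-dimensional left `A`-modules. -/
abbrev FinDimMod : Type (max v (w + 1)) := (isFinDim.{w} k A).FullSubcategory

noncomputable instance : Abelian (FinDimMod.{w} k A) := inferInstance

noncomputable instance : Linear k (FinDimMod.{w} k A) := inferInstance

instance : HasExt.{max v (w + 1)} (FinDimMod.{w} k A) := HasExt.standard _

end FiniteDimensionalModules

/-- A highest weight category: a finite length `k`-linear abelian category `C` with a lower finite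
weight poset `Λ`, representatives `L l` for the isomorphism classes of simple objects, standard
objects `Δ l` and costandard objects `N l` (written `∇_l` in comments). -/
structure HighestWeightCategory (k : Type t) [Field k] (C : Type u) [Category.{v} C] [Abelian C]
    [Linear k C] [HasExt.{w} C] (Λ : Type s) [PartialOrder Λ] where
  finiteLength : ∀ X : C, IsNoetherianObject X ∧ IsArtinianObject X
  lowerFinite : ∀ l : Λ, (Set.Iic l).Finite
  /-- the simple objects -/
  L : Λ → C
  simple : ∀ l, Simple (L l)
  exists_iso : ∀ S : C, Simple S → ∃ l, Nonempty (S ≅ L l)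
  eq_of_iso : ∀ l m, Nonempty (L l ≅ L m) → l = m
  /-- the standard objects -/
  Δ : Λ → C
  /-- the costandard objects -/
  N : Λ → C
  /-- the projective cover of `L l` in `C_{≤ l}` -/
  p : ∀ l, Δ l ⟶ L l
  /-- the injective hull of `L l` in `C_{≤ l}` -/
  i : ∀ l, L l ⟶ N l
  projectiveCover : ∀ l, IsProjectiveCover (serreClosure L (Set.Iic l)) (p l)
  injectiveHull : ∀ l, IsInjectiveHull (serreClosure L (Set.Iic l)) (i l)
  hom_standard_costandard : ∀ l, Nonempty ((Δ l ⟶ N l) ≃ₗ[k] k)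
  ext_one : ∀ l m, Subsingleton (Ext (Δ l) (N m) 1)
  ext_two : ∀ l m, Subsingleton (Ext (Δ l) (N m) 2)

namespace HighestWeightCategory

variable {k : Type t} [Field k] {C : Type u} [Category.{v} C] [Abelian C] [Linear k C]
  [HasExt.{w} C] {Λ : Type s} [PartialOrder Λ] (H : HighestWeightCategory k C Λ)

/-- Tilting objects: objects with a `Δ`-filtration and a `∇`-filtration. -/
def IsTilting : ObjectProperty C := fun M => HasFiltration H.Δ M ∧ HasFiltration H.N M

/-- `M` is the (unique up to isomorphism) indecomposable tilting object `T_l` of highest weight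
`l`: it is indecomposable and tilting, it belongs to `C_{≤ l}`, and `[M : L_l] = 1`. -/
structure IsIndecomposableTilting (l : Λ) (M : C) : Prop where
  indecomposable : Indecomposable M
  tilting : H.IsTilting M
  mem : serreClosure H.L (Set.Iic l) M
  multiplicity : CompositionMultiplicity (H.L l) M 1

/-- Bounded complexes of tilting objects, as complexes in `C` with terms in `Tilt(C)`. -/
structure IsTiltingComplex (K : CochainComplex C ℤ) : Prop where
  tilting : ∀ n, H.IsTilting (K.X n)
  bounded : ∃ a b : ℤ, K.IsStrictlyGE a ∧ K.IsStrictlyLE b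

/-- `K` is the (unique up to isomorphism) minimal tilting complex `C_min(M)` of `M`: a bounded
complex of tilting objects, isomorphic to `M` in `D^b(C)`, whose differentials belong to the
radical of `Tilt(C)`. -/
structure IsMinimalTiltingComplex [HasDerivedCategory.{w'} C] (M : C) (K : CochainComplex C ℤ) :
    Prop where
  tilting : H.IsTiltingComplex K
  minimal : ∀ n : ℤ, InRadical H.IsTilting (K.d n (n + 1))
  iso : IsoInDerived K M

/-- `K` is a direct summand of `K'` in the category of bounded complexes in `Tilt(C)`. -/
def IsSummand (K K' : CochainComplex C ℤ) : Prop :=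
  ∃ K'' : CochainComplex C ℤ, H.IsTiltingComplex K'' ∧ Nonempty (K' ≅ K ⊞ K'')

/-- All `Hom`-spaces in a highest weight category are finite-dimensional. -/
theorem finite_hom (H : HighestWeightCategory k C Λ) (X Y : C) : Module.Finite k (X ⟶ Y) := by
  have h1 : ∀ l, Module.Finite k (H.L l ⟶ H.L l) := fun l => by
    have := (H.projectiveCover l).epi
    have := (H.injectiveHull l).mono
    obtain ⟨e⟩ := H.hom_standard_costandard l
    have : Module.Finite k (H.Δ l ⟶ H.N l) := Module.Finite.equiv e.symm
    refine Module.Finite.of_injective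
      ((Linear.leftComp k (H.N l) (H.p l)) ∘ₗ (Linear.rightComp k (H.L l) (H.i l))) ?_
    intro f g hfg
    have h : H.p l ≫ f ≫ H.i l = H.p l ≫ g ≫ H.i l := hfg
    rwa [cancel_epi, cancel_mono] at h
  have h2 : ∀ S S' : C, Simple S → Simple S' → Module.Finite k (S ⟶ S') := by
    intro S S' hS hS'
    obtain ⟨l, ⟨a⟩⟩ := H.exists_iso S hS
    obtain ⟨m, ⟨b⟩⟩ := H.exists_iso S' hS'
    by_cases hlm : l = m
    · subst hlm
      have := h1 l
      exact Module.Finite.equiv (Linear.homCongr k a b).symm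
    · have : Subsingleton (S ⟶ S') := by
        refine subsingleton_of_forall_eq 0 fun f => ?_
        by_contra hf
        have := isIso_of_hom_simple hf
        exact hlm (H.eq_of_iso l m ⟨a.symm ≪≫ asIso f ≪≫ b⟩)
      infer_instance
  have h3 : ∀ S : C, Simple S → ∀ Y : C, Module.Finite k (S ⟶ Y) := by
    intro S hS
    let P : ObjectProperty C := fun Y => Module.Finite k (S ⟶ Y)
    have : P.IsClosedUnderIsomorphisms := ⟨fun e h => by
      have : Module.Finite k (S ⟶ _) := h
      exact Module.Finite.equiv (Linear.homCongr k (Iso.refl S) e)⟩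
    have : P.IsClosedUnderExtensions := ⟨fun {E} hE h₁ h₃ => by
      have : Module.Finite k (S ⟶ E.X₁) := h₁
      have : Module.Finite k (S ⟶ E.X₃) := h₃
      have := hE.mono_f
      let φ := Linear.rightComp k S E.g
      have : Module.Finite k (LinearMap.ker φ) := by
        refine Module.Finite.of_surjective
          (LinearMap.codRestrict (LinearMap.ker φ) (Linear.rightComp k S E.f)
            (fun a => by simp [φ])) ?_
        rintro ⟨a, ha⟩
        have ha' : a ≫ E.g = 0 := ha
        exact ⟨hE.exact.lift a ha', Subtype.ext (hE.exact.lift_f a ha')⟩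
      have : Module.Finite k (LinearMap.range φ) := FiniteDimensional.finiteDimensional_submodule _
      have : Module.Finite k ((S ⟶ E.X₂) ⧸ LinearMap.ker φ) :=
        Module.Finite.equiv φ.quotKerEquivRange.symm
      exact Module.Finite.of_submodule_quotient (LinearMap.ker φ)⟩
    refine devissage H.finiteLength P (fun Y hY => ?_) (fun Y hY => h2 S Y hS hY)
    have : Subsingleton (S ⟶ Y) := ⟨fun f g => hY.eq_of_tgt f g⟩
    exact (inferInstance : Module.Finite k (S ⟶ Y))
  let P : ObjectProperty C := fun X => Module.Finite k (X ⟶ Y)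
  have : P.IsClosedUnderIsomorphisms := ⟨fun e h => by
    have : Module.Finite k (_ ⟶ Y) := h
    exact Module.Finite.equiv (Linear.homCongr k e (Iso.refl Y))⟩
  have : P.IsClosedUnderExtensions := ⟨fun {E} hE h₁ h₃ => by
    have : Module.Finite k (E.X₁ ⟶ Y) := h₁
    have : Module.Finite k (E.X₃ ⟶ Y) := h₃
    have := hE.epi_g
    let φ := Linear.leftComp k Y E.f
    have : Module.Finite k (LinearMap.ker φ) := by
      refine Module.Finite.of_surjective
        (LinearMap.codRestrict (LinearMap.ker φ) (Linear.leftComp k Y E.g)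
          (fun a => by simp [φ])) ?_
      rintro ⟨a, ha⟩
      have ha' : E.f ≫ a = 0 := ha
      exact ⟨hE.exact.desc a ha', Subtype.ext (hE.exact.g_desc a ha')⟩
    have : Module.Finite k (LinearMap.range φ) := FiniteDimensional.finiteDimensional_submodule _
    have : Module.Finite k ((E.X₂ ⟶ Y) ⧸ LinearMap.ker φ) :=
      Module.Finite.equiv φ.quotKerEquivRange.symm
    exact Module.Finite.of_submodule_quotient (LinearMap.ker φ)⟩
  refine devissage H.finiteLength P (fun X hX => ?_) (fun X hX => h3 X hX Y) X
  have : Subsingleton (X ⟶ Y) := ⟨fun f g => hX.eq_of_src f g⟩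
  exact (inferInstance : Module.Finite k (X ⟶ Y))

end HighestWeightCategory

section RingelDual

variable {C : Type u} [Category.{v} C] [Abelian C]

/-- The characteristic tilting object `⨁_{g ∈ Γ} T_g` of the truncated category `C_Γ`. -/
noncomputable def charTilting {Λ : Type s} [PartialOrder Λ] (T : Λ → C) (Γ : LowerSet Λ)
    [Finite Γ] : C :=
  ⨁ fun g : Γ => T g

/-- The algebra `A = End(⨁_{g ∈ Γ} T_g)^op`, the endomorphisms being the same in `C` and in its full
subcategory `C_Γ`. The Ringel dual of `C_Γ` is the category `FinDimMod k A`. -/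
abbrev RingelAlgebra {Λ : Type s} [PartialOrder Λ] (T : Λ → C) (Γ : LowerSet Λ) [Finite Γ] :
    Type v :=
  (End (charTilting T Γ))ᵐᵒᵖ

/-- The `k`-dual `Hom(Y, X)^*`, with the left action of `End(X)^op` below. -/
def DualHom (k : Type t) [Field k] [Linear k C] (X Y : C) : Type (max t v) :=
  Module.Dual k (Y ⟶ X)

variable (k : Type t) [Field k] [Linear k C]

noncomputable instance (X Y : C) : AddCommGroup (DualHom k X Y) :=
  inferInstanceAs (AddCommGroup (Module.Dual k (Y ⟶ X)))

/-- `(a • φ)(f) = φ(a ∘ f)` for `f : Y ⟶ X`. -/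
noncomputable instance (X Y : C) : Module (End X)ᵐᵒᵖ (DualHom k X Y) where
  smul a φ := LinearMap.comp (show Module.Dual k (Y ⟶ X) from φ)
    (Linear.rightComp k Y (End.asHom a.unop))
  one_smul φ := LinearMap.ext fun f =>
    congrArg (show Module.Dual k (Y ⟶ X) from φ) (Category.comp_id f)
  mul_smul _ _ φ := LinearMap.ext fun _ =>
    congrArg (show Module.Dual k (Y ⟶ X) from φ) (Category.assoc _ _ _).symm
  smul_zero _ := rfl
  smul_add _ _ _ := rfl
  add_smul _ _ φ := LinearMap.ext fun _ =>
    (congrArg (show Module.Dual k (Y ⟶ X) from φ) (Preadditive.comp_add _ _ _ _ _ _)).trans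
      (map_add (show Module.Dual k (Y ⟶ X) from φ) _ _)
  zero_smul φ := LinearMap.ext fun _ =>
    (congrArg (show Module.Dual k (Y ⟶ X) from φ) comp_zero).trans
      (map_zero (show Module.Dual k (Y ⟶ X) from φ))

theorem isFinDim_dualHom (X Y : C) [Module.Finite k (Y ⟶ X)] :
    isFinDim k (End X)ᵐᵒᵖ (ModuleCat.of (End X)ᵐᵒᵖ (DualHom k X Y)) := by
  let _ : Module k (ModuleCat.of (End X)ᵐᵒᵖ (DualHom k X Y)) :=
    ModuleCat.moduleOfAlgebraModule _
  let e : Module.Dual k (Y ⟶ X) →ₗ[k] (ModuleCat.of (End X)ᵐᵒᵖ (DualHom k X Y)) :=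
    { toFun := fun φ => φ
      map_add' := fun _ _ => rfl
      map_smul' := fun c φ => by
        refine LinearMap.ext fun f => ?_
        change c • φ f = φ (f ≫ (c • 𝟙 X))
        simp }
  exact Module.Finite.of_surjective e fun φ => ⟨φ, rfl⟩

/-- The socle of a module: the sum of its simple submodules. -/
def socle (A : Type*) [Ring A] (M : Type*) [AddCommGroup M] [Module A M] : Submodule A M :=
  sSup {S : Submodule A M | IsSimpleModule A S}

variable {k} [HasExt.{w} C] {Λ : Type s} [PartialOrder Λ]

/-- The costandard object `∇'_m = Hom(Δ_m, ⨁_{g ∈ Γ} T_g)^*` of the Ringel dual of `C_Γ`. -/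
noncomputable def HighestWeightCategory.dualCostandard (H : HighestWeightCategory k C Λ)
    (T : Λ → C) (Γ : LowerSet Λ) [Finite Γ] (m : Λ) :
    FinDimMod.{max t v} k (RingelAlgebra T Γ) :=
  ⟨ModuleCat.of (RingelAlgebra T Γ) (DualHom k (charTilting T Γ) (H.Δ m)),
    have := H.finite_hom (H.Δ m) (charTilting T Γ)
    isFinDim_dualHom k _ _⟩

/-- The simple object `L'_m = soc ∇'_m` of the Ringel dual of `C_Γ`. -/
noncomputable def HighestWeightCategory.dualSimple (H : HighestWeightCategory k C Λ)
    (T : Λ → C) (Γ : LowerSet Λ) [Finite Γ] (m : Λ) :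
    FinDimMod.{max t v} k (RingelAlgebra T Γ) :=
  ⟨ModuleCat.of (RingelAlgebra T Γ)
      (socle (RingelAlgebra T Γ) (DualHom k (charTilting T Γ) (H.Δ m))),
    have : Mono (ModuleCat.ofHom
        (socle (RingelAlgebra T Γ) (DualHom k (charTilting T Γ) (H.Δ m))).subtype) :=
      (ModuleCat.mono_iff_injective _).2 (Submodule.subtype_injective _)
    (isFinDim k (RingelAlgebra T Γ)).prop_of_mono
      (ModuleCat.ofHom (socle (RingelAlgebra T Γ)
        (DualHom k (charTilting T Γ) (H.Δ m))).subtype)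
      (H.dualCostandard T Γ m).property⟩

end RingelDual

end MinTilt

/-! The multiplicity formula splits into two independent counts, glued in the derived category.

First count: since Ext¹ and Ext² from standard to costandard objects vanish, the usual criteria hold
(`hasFiltration_N_of_ext`, `hasFiltration_Δ_of_ext`), universal extensions embed any object into a
costandardly filtered one with standardly filtered cokernel (`exists_costandard_envelope`), and Ext
from Δ to ∇ vanishes in all positive degrees (`ext_succ_of_filtrations`). Hence every Δ_ν has a
finite minimal coresolution by tilting objects with weights ≤ ν (`exists_minimalCoresolution`). The
functor Hom(-, T_Γ)^* turns it into a minimal injective resolution of ∇'_ν over the Ringel algebra,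
in which Hom(T_μ, T_Γ)^* receives nonzero maps from L'_μ and from no other L'. So T_μ occurs in
degree k exactly dim Ext^k(L'_μ, ∇'_ν) times (`MinimalCoresolution.finrank_ext`).

Second count: in the derived category the shifts of Δ and ∇ are dual families. If X has a nonzero
map to ∇_ν[j] with ν minimal, the map lifts to Δ_ν[j], and passing to the fibre lowers by one the
dimension of Hom(X, ∇_ν[j]) and no other such dimension. Thus L_λ is an iterated extension of the
Δ_ν[j], each used dim Ext^j(L_λ, ∇_ν) times (`hasTilt_of_finsupp`).

Gluing: vanishing of Ext makes the passage from the homotopy category to the derived category fully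
faithful on bounded tilting complexes (`IsTiltingComplex.mapBijective`). Every extension above is
therefore realised by the mapping cone of a chain map, and multiplicities add. The degree k term of
the coresolution of Δ_ν, shifted by j, lands in degree i = k - j, which is the formula.

Minimal complexes: a differential outside the radical splits off a contractible summand, and
repeating this terminates (`IsTiltingComplex.exists_minimal`). An endomorphism of a minimal complex
homotopic to the identity is invertible, so a minimal complex is a summand of every tilting complex
isomorphic to it in the derived category (`IsMinimalTiltingComplex.isSummand`). -/

namespace MinTilt

attribute [local instance] CategoryTheory.Abelian.hasFiniteBiproducts

/-! ### Finite-dimensionality in exact sequences. -/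

section LinearAlgebra

variable {k : Type*} [Field k] {A B D : Type*} [AddCommGroup A] [AddCommGroup B] [AddCommGroup D]
  [Module k A] [Module k B] [Module k D]

theorem finite_of_exact (f : A →ₗ[k] B) (g : B →ₗ[k] D) (h : ∀ b, g b = 0 → ∃ a, f a = b)
    [Module.Finite k A] [Module.Finite k D] : Module.Finite k B := by
  have : Module.Finite k (LinearMap.ker g) :=
    Submodule.finiteDimensional_of_le (S₂ := LinearMap.range f) fun b hb => h b hb
  have : Module.Finite k (B ⧸ LinearMap.ker g) :=
    Module.Finite.equiv g.quotKerEquivRange.symm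
  exact Module.Finite.of_submodule_quotient (LinearMap.ker g)

end LinearAlgebra

/-! ### Effaceability of extension classes and consequences of the long exact sequences. -/

section ExtGeneral

variable {C : Type u} [Category.{v} C] [Abelian C]

open HomologicalComplex in
/-- A quasi-isomorphism from a single complex in degree `i` to a complex supported in degrees
`≥ i` is a monomorphism in degree `i`. -/
theorem mono_of_quasiIsoAt_single {Y : C} {L : CochainComplex C ℤ} {i : ℤ}
    (ι : (single C (ComplexShape.up ℤ) i).obj Y ⟶ L) [L.IsStrictlyGE i] [QuasiIsoAt ι i] :
    Mono (ι.f i) := by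
  let e := L.pOpcyclesIso (i - 1) i (by simp)
    ((L.isZero_of_isStrictlyGE i (i - 1) (by simp)).eq_of_src _ _)
  let α := (singleObjHomologySelfIso _ _ _).inv ≫ homologyMap ι i ≫ L.homologyι i ≫ e.inv
  have : ι.f i = (singleObjXSelf (ComplexShape.up ℤ) i Y).hom ≫ α := by
    rw [← cancel_mono e.hom]
    dsimp [α, e]
    simp only [Category.assoc]
    rw [Iso.inv_hom_id, Category.comp_id, homologyι_naturality,
      singleObjHomologySelfIso_inv_homologyι_assoc,
      ← pOpcycles_singleObjOpcyclesSelfIso_inv_assoc, Iso.inv_hom_id_assoc, p_opcyclesMap]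
    rfl
  rw [this]
  have : IsIso (homologyMap ι i) := inferInstance
  have : Mono α := mono_comp _ _
  exact mono_comp _ _

open HomologicalComplex DerivedCategory in
-- Write φ as a fraction with numerator g : K ⟶ L and denominator a quasi-isomorphism ι from the
-- single complex, L living in degrees ≥ i. In degree i the map ι is mono, so Y embeds into the
-- object L.X i. Projecting L to this lowest term kills g, because K vanishes in degree i.
theorem exists_mono_comp_single_eq_zero [HasDerivedCategory.{w} C] {Y : C}
    {K : CochainComplex C ℤ} {i : ℤ}
    (φ : Q.obj K ⟶ Q.obj ((single C (ComplexShape.up ℤ) i).obj Y))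
    (n : ℤ) (hn : i < n) [K.IsStrictlyGE n] :
    ∃ (E : C) (j : Y ⟶ E), Mono j ∧
      φ ≫ Q.map ((single C (ComplexShape.up ℤ) i).map j) = 0 := by
  have : CochainComplex.IsStrictlyGE ((single C (ComplexShape.up ℤ) i).obj Y) i :=
    inferInstanceAs (((CochainComplex.singleFunctor C i).obj Y).IsStrictlyGE i)
  obtain ⟨L, _, g, ι, h, rfl⟩ := left_fac_of_isStrictlyGE φ i
  rw [isIso_Q_map_iff_quasiIso] at h
  have hm := mono_of_quasiIsoAt_single ι
  -- The projection to the lowest term is a chain map since L vanishes in degree i - 1.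
  let r : L ⟶ (single C (ComplexShape.up ℤ) i).obj (L.X i) := mkHomToSingle (𝟙 _) (by
      rintro j rfl
      apply (L.isZero_of_isStrictlyGE (j + 1) j (by simp)).eq_of_src)
  refine ⟨L.X i, (singleObjXSelf (ComplexShape.up ℤ) i Y).inv ≫ ι.f i, mono_comp _ _, ?_⟩
  have h1 : ι ≫ r = (single C (ComplexShape.up ℤ) i).map
      ((singleObjXSelf (ComplexShape.up ℤ) i Y).inv ≫ ι.f i) := by
    apply HomologicalComplex.to_single_hom_ext
    rw [comp_f, mkHomToSingle_f, single_map_f_self]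
    simp
  have h2 : g ≫ r = 0 := by
    apply HomologicalComplex.to_single_hom_ext
    apply (K.isZero_of_isStrictlyGE n i hn).eq_of_src
  rw [← h1, Q.map_comp, Category.assoc, IsIso.inv_hom_id_assoc, ← Q.map_comp, h2, Q.map_zero]

open DerivedCategory in
/-- Classes of positive degree are effaceable. -/
theorem exists_mono_comp_eq_zero [HasExt.{w} C] {X Y : C} {n : ℕ} (α : Ext X Y (n + 1)) :
    ∃ (E : C) (j : Y ⟶ E), Mono j ∧ α.comp (Ext.mk₀ j) (add_zero _) = 0 := by
  let K := (CochainComplex.singleFunctor C 0).obj X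
  have := K.isStrictlyGE_of_ge (-n) 0 (by lia)
  let := HasDerivedCategory.standard C
  let e := (singleFunctors C).shiftIso (n + 1) (-(n + 1)) 0 (by lia)
  obtain ⟨E, j, hj, h⟩ := exists_mono_comp_single_eq_zero (K := K) (i := -(n + 1))
    (α.hom ≫ e.hom.app Y) (-n) (by lia)
  refine ⟨E, j, hj, Ext.ext ?_⟩
  rw [← Ext.hom_comp_singleFunctor_map_shift, Ext.zero_hom]
  rw [← cancel_mono (e.hom.app E), Category.assoc]
  erw [e.hom.naturality j]
  rw [zero_comp, ← Category.assoc]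
  exact h

variable [HasExt.{w} C]

/-- Efface α by a mono j : X ⟶ E. Then α is the class of 0 → X → E → coker j → 0 pulled back along
some b : Z ⟶ coker j, and the pullback of E along b is the extension sought. -/
theorem exists_shortExact_of_ext_one {X Z : C} (α : Ext Z X 1) :
    ∃ (E : C) (f : X ⟶ E) (g : E ⟶ Z) (w : f ≫ g = 0)
      (hS : (ShortComplex.mk f g w).ShortExact), hS.extClass = α := by
  obtain ⟨E, j, hj, h⟩ := exists_mono_comp_eq_zero α
  let S : ShortComplex C := ShortComplex.mk j (cokernel.π j) (cokernel.condition j)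
  have hS : S.ShortExact := { exact := ShortComplex.exact_cokernel j }
  obtain ⟨β, hβ⟩ := Ext.covariant_sequence_exact₁ Z hS α h (zero_add 1)
  obtain ⟨b, rfl⟩ := Ext.mk₀_bijective _ _ |>.surjective β
  let P := pullback (cokernel.π j) b
  let f : X ⟶ P := pullback.lift j 0 (by simp)
  have hfg : f ≫ pullback.snd (cokernel.π j) b = 0 := pullback.lift_snd _ _ _
  have hff : f ≫ pullback.fst (cokernel.π j) b = j := pullback.lift_fst _ _ _
  let S' : ShortComplex C := ShortComplex.mk f (pullback.snd _ _) hfg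
  have hfm : Mono f := mono_of_mono_fac hff
  have hS' : S'.ShortExact := by
    refine { exact := ?_, mono_f := hfm, epi_g := by dsimp [S']; infer_instance }
    apply ShortComplex.exact_of_f_is_kernel
    refine KernelFork.IsLimit.ofι' _ _ (fun {W} r hr => ?_)
    have hr' : r ≫ pullback.snd (cokernel.π j) b = 0 := hr
    have h1 : (r ≫ pullback.fst (cokernel.π j) b) ≫ cokernel.π j = 0 := by
      rw [Category.assoc, pullback.condition, reassoc_of% hr', zero_comp]
    refine ⟨Abelian.monoLift j _ h1, ?_⟩
    apply pullback.hom_ext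
    · rw [Category.assoc]
      erw [hff]
      simp
    · rw [Category.assoc]
      erw [hfg]
      rw [comp_zero, hr']
  refine ⟨P, f, pullback.snd _ _, hfg, hS', ?_⟩
  let φ : S' ⟶ S := { τ₁ := 𝟙 X, τ₂ := pullback.fst _ _, τ₃ := b,
                      comm₁₂ := by simp [S, S', hff], comm₂₃ := pullback.condition }
  have h2 := ShortComplex.ShortExact.extClass_naturality hS' hS φ
  simp only [φ] at h2
  rw [← hβ, ← h2]
  exact (Ext.comp_mk₀_id _).symm

theorem ext_eq_of_iso_left {X X' Y : C} {n : ℕ} (e : X ≅ X') [Subsingleton (Ext X Y n)] :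
    Subsingleton (Ext X' Y n) := by
  refine subsingleton_of_forall_eq 0 fun α => ?_
  have h : (Ext.mk₀ e.hom).comp α (zero_add n) = 0 := Subsingleton.elim _ _
  have h2 : (Ext.mk₀ e.inv).comp ((Ext.mk₀ e.hom).comp α (zero_add n)) (zero_add n) = α := by
    rw [Ext.mk₀_comp_mk₀_assoc, e.inv_hom_id, Ext.mk₀_id_comp]
  rw [← h2, h, Ext.comp_zero]

theorem ext_eq_of_iso_right {X Y Y' : C} {n : ℕ} (e : Y ≅ Y') [Subsingleton (Ext X Y n)] :
    Subsingleton (Ext X Y' n) := by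
  refine subsingleton_of_forall_eq 0 fun α => ?_
  have h : α.comp (Ext.mk₀ e.inv) (add_zero n) = 0 := Subsingleton.elim _ _
  have h2 : (α.comp (Ext.mk₀ e.inv) (add_zero n)).comp (Ext.mk₀ e.hom) (add_zero n) = α := by
    rw [Ext.comp_assoc_of_third_deg_zero, Ext.mk₀_comp_mk₀, e.inv_hom_id, Ext.comp_mk₀_id]
  rw [← h2, h, Ext.zero_comp]

theorem ext_subsingleton_of_isZero_left {X Y : C} {n : ℕ} (h : IsZero X) :
    Subsingleton (Ext X Y n) := by
  refine subsingleton_of_forall_eq 0 fun α => ?_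
  rw [← Ext.mk₀_id_comp α, h.eq_of_src (𝟙 X) 0, Ext.mk₀_zero, Ext.zero_comp]

theorem ext_subsingleton_of_isZero_right {X Y : C} {n : ℕ} (h : IsZero Y) :
    Subsingleton (Ext X Y n) := by
  refine subsingleton_of_forall_eq 0 fun α => ?_
  rw [← Ext.comp_mk₀_id α, h.eq_of_src (𝟙 Y) 0, Ext.mk₀_zero, Ext.comp_zero]

theorem ext_of_retract_left {X M Y : C} {n : ℕ} (i : X ⟶ M) (r : M ⟶ X) (h : i ≫ r = 𝟙 X)
    (hM : Subsingleton (Ext M Y n)) : Subsingleton (Ext X Y n) := by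
  refine subsingleton_of_forall_eq 0 fun α => ?_
  have h1 : (Ext.mk₀ r).comp α (zero_add n) = 0 := Subsingleton.elim _ _
  rw [← Ext.mk₀_id_comp α, ← h, ← Ext.mk₀_comp_mk₀_assoc, h1, Ext.comp_zero]

theorem ext_of_retract_right {X M Y : C} {n : ℕ} (i : Y ⟶ M) (r : M ⟶ Y) (h : i ≫ r = 𝟙 Y)
    (hM : Subsingleton (Ext X M n)) : Subsingleton (Ext X Y n) := by
  refine subsingleton_of_forall_eq 0 fun α => ?_
  have h1 : α.comp (Ext.mk₀ i) (add_zero n) = 0 := Subsingleton.elim _ _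
  rw [← Ext.comp_mk₀_id α, ← h, ← Ext.mk₀_comp_mk₀, ← Ext.comp_assoc_of_third_deg_zero, h1,
    Ext.zero_comp]

theorem ext_middle_right {S : ShortComplex C} (hS : S.ShortExact) (X : C) (n : ℕ)
    (h₁ : Subsingleton (Ext X S.X₁ n)) (h₃ : Subsingleton (Ext X S.X₃ n)) :
    Subsingleton (Ext X S.X₂ n) := by
  refine subsingleton_of_forall_eq 0 fun α => ?_
  obtain ⟨β, rfl⟩ := Ext.covariant_sequence_exact₂ X hS α (Subsingleton.elim _ _)
  rw [Subsingleton.elim β 0, Ext.zero_comp]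

theorem ext_middle_left {S : ShortComplex C} (hS : S.ShortExact) (Y : C) (n : ℕ)
    (h₁ : Subsingleton (Ext S.X₁ Y n)) (h₃ : Subsingleton (Ext S.X₃ Y n)) :
    Subsingleton (Ext S.X₂ Y n) := by
  refine subsingleton_of_forall_eq 0 fun α => ?_
  obtain ⟨β, rfl⟩ := Ext.contravariant_sequence_exact₂ hS Y α (Subsingleton.elim _ _)
  rw [Subsingleton.elim β 0, Ext.comp_zero]

theorem ext_quotient_right {S : ShortComplex C} (hS : S.ShortExact) (X : C) (n : ℕ)
    (h₂ : Subsingleton (Ext X S.X₂ n)) (h₁ : Subsingleton (Ext X S.X₁ (n + 1))) :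
    Subsingleton (Ext X S.X₃ n) := by
  refine subsingleton_of_forall_eq 0 fun α => ?_
  obtain ⟨β, rfl⟩ := Ext.covariant_sequence_exact₃ X hS α rfl (Subsingleton.elim _ _)
  rw [Subsingleton.elim β 0, Ext.zero_comp]

theorem ext_sub_left {S : ShortComplex C} (hS : S.ShortExact) (Y : C) (n : ℕ)
    (h₂ : Subsingleton (Ext S.X₂ Y n)) (h₃ : Subsingleton (Ext S.X₃ Y (n + 1))) :
    Subsingleton (Ext S.X₁ Y n) := by
  refine subsingleton_of_forall_eq 0 fun α => ?_
  obtain ⟨β, rfl⟩ := Ext.contravariant_sequence_exact₁ hS Y α (add_comm 1 n)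
    (Subsingleton.elim _ _)
  rw [Subsingleton.elim β 0, Ext.comp_zero]

theorem ext_quotient_left {S : ShortComplex C} (hS : S.ShortExact) (Y : C) (n : ℕ)
    (h₂ : Subsingleton (Ext S.X₂ Y (n + 1))) (h₁ : Subsingleton (Ext S.X₁ Y n)) :
    Subsingleton (Ext S.X₃ Y (n + 1)) := by
  refine subsingleton_of_forall_eq 0 fun α => ?_
  obtain ⟨β, rfl⟩ := Ext.contravariant_sequence_exact₃ hS Y α
    (Subsingleton.elim _ _) (add_comm 1 n)
  rw [Subsingleton.elim β 0, Ext.comp_zero]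

theorem ext_sub_right {S : ShortComplex C} (hS : S.ShortExact) (X : C) (n : ℕ)
    (h₂ : Subsingleton (Ext X S.X₂ (n + 1))) (h₃ : Subsingleton (Ext X S.X₃ n)) :
    Subsingleton (Ext X S.X₁ (n + 1)) := by
  refine subsingleton_of_forall_eq 0 fun α => ?_
  obtain ⟨β, rfl⟩ := Ext.covariant_sequence_exact₁ X hS α (Subsingleton.elim _ _) rfl
  rw [Subsingleton.elim β 0, Ext.zero_comp]

theorem ext_zero_subsingleton_iff {X Y : C} :
    Subsingleton (Ext X Y 0) ↔ ∀ f : X ⟶ Y, f = 0 := by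
  constructor
  · intro h f
    exact (Ext.mk₀_eq_zero_iff f).1 (Subsingleton.elim _ _)
  · intro h
    refine subsingleton_of_forall_eq 0 fun α => ?_
    obtain ⟨f, rfl⟩ := (Ext.mk₀_bijective _ _).surjective α
    rw [h f, Ext.mk₀_zero]

theorem exists_lift_of_ext {S : ShortComplex C} (hS : S.ShortExact) {X : C}
    (h : Subsingleton (Ext X S.X₁ 1)) (f : X ⟶ S.X₃) : ∃ g : X ⟶ S.X₂, g ≫ S.g = f := by
  obtain ⟨β, hβ⟩ := Ext.covariant_sequence_exact₃ X hS (Ext.mk₀ f) (zero_add 1)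
    (Subsingleton.elim _ _)
  obtain ⟨b, rfl⟩ := (Ext.mk₀_bijective _ _).surjective β
  rw [Ext.mk₀_comp_mk₀] at hβ
  exact ⟨b, (Ext.mk₀_bijective _ _).injective hβ⟩

theorem exists_desc_of_ext {S : ShortComplex C} (hS : S.ShortExact) {Y : C}
    (h : Subsingleton (Ext S.X₃ Y 1)) (f : S.X₁ ⟶ Y) : ∃ g : S.X₂ ⟶ Y, S.f ≫ g = f := by
  obtain ⟨β, hβ⟩ := Ext.contravariant_sequence_exact₁ hS Y (Ext.mk₀ f) (add_zero 1)
    (Subsingleton.elim _ _)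
  obtain ⟨b, rfl⟩ := (Ext.mk₀_bijective _ _).surjective β
  rw [Ext.mk₀_comp_mk₀] at hβ
  exact ⟨b, (Ext.mk₀_bijective _ _).injective hβ⟩

end ExtGeneral

/-! ### Kernels and cokernels of composites; induction over quotients and subobjects. -/

section ShortExactSequences

variable {C : Type u} [Category.{v} C] [Abelian C]

theorem shortExact_cokernel {X Y : C} (f : X ⟶ Y) [Mono f] :
    (ShortComplex.mk f (cokernel.π f) (cokernel.condition f)).ShortExact :=
  { exact := ShortComplex.exact_cokernel f }

theorem shortExact_kernel {X Y : C} (f : X ⟶ Y) [Epi f] :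
    (ShortComplex.mk (kernel.ι f) f (kernel.condition f)).ShortExact :=
  { exact := ShortComplex.exact_kernel f }

theorem shortExact_biprod (X Y : C) :
    (ShortComplex.mk (biprod.inl : X ⟶ X ⊞ Y) biprod.snd (by simp)).ShortExact :=
  (ShortComplex.Splitting.mk (S := ShortComplex.mk (biprod.inl : X ⟶ X ⊞ Y) biprod.snd (by simp))
    biprod.fst biprod.inr (by simp) (by simp) (by simp [biprod.total])).shortExact

theorem kernel_exact {S : ShortComplex C} (hS : S.ShortExact) {B : C} (g : S.X₂ ⟶ B)
    (w : S.f ≫ g = 0) : ∃ h : S.X₃ ⟶ B, S.g ≫ h = g := by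
  have := hS.epi_g
  exact ⟨hS.exact.desc g w, hS.exact.g_desc g w⟩

/-- The preimage in S.X₂ of the subobject ker q of S.X₃ is an extension of ker q by S.X₁. This lets
a filtration of a quotient be pulled back one step at a time. -/
theorem exists_shortExact_kernel_comp {S : ShortComplex C} (hS : S.ShortExact) {B : C}
    (q : S.X₃ ⟶ B) [Epi q] :
    ∃ (w : S.f ≫ S.g ≫ q = 0) (g : kernel (S.g ≫ q) ⟶ kernel q)
      (w' : kernel.lift (S.g ≫ q) S.f w ≫ g = 0),
      (ShortComplex.mk (kernel.lift (S.g ≫ q) S.f w) g w').ShortExact ∧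
        g ≫ kernel.ι q = kernel.ι (S.g ≫ q) ≫ S.g := by
  have hm := hS.mono_f
  have he := hS.epi_g
  have w : S.f ≫ S.g ≫ q = 0 := by simp
  let g : kernel (S.g ≫ q) ⟶ kernel q := kernel.lift q (kernel.ι _ ≫ S.g) (by simp)
  have hg : g ≫ kernel.ι q = kernel.ι (S.g ≫ q) ≫ S.g := kernel.lift_ι _ _ _
  have w' : kernel.lift (S.g ≫ q) S.f w ≫ g = 0 := by
    rw [← cancel_mono (kernel.ι q), Category.assoc, hg]; simp
  refine ⟨w, g, w', ?_, hg⟩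
  have hmono : Mono (kernel.lift (S.g ≫ q) S.f w) := by
    apply mono_of_mono_fac (kernel.lift_ι _ _ _ : _ = S.f)
  have hepi : Epi g := by
    rw [Preadditive.epi_iff_cancel_zero]
    intro Z z hz
    have : Epi (pullback.snd S.g (kernel.ι q)) := inferInstance
    let a : pullback S.g (kernel.ι q) ⟶ kernel (S.g ≫ q) :=
      kernel.lift _ (pullback.fst _ _) (by rw [pullback.condition_assoc]; simp)
    have ha : a ≫ g = pullback.snd S.g (kernel.ι q) := by
      rw [← cancel_mono (kernel.ι q), Category.assoc, hg]
      simp [a, pullback.condition]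
    rw [← cancel_epi (pullback.snd S.g (kernel.ι q)), ← ha, Category.assoc, hz]; simp
  refine { exact := ?_, mono_f := hmono, epi_g := hepi }
  apply ShortComplex.exact_of_f_is_kernel
  refine KernelFork.IsLimit.ofι' _ _ (fun {W} r hr => ?_)
  have h1 : (r ≫ kernel.ι (S.g ≫ q)) ≫ S.g = 0 := by
    have : r ≫ g = 0 := hr
    rw [Category.assoc, ← hg, reassoc_of% this, zero_comp]
  refine ⟨hS.exact.lift _ h1, ?_⟩
  rw [← cancel_mono (kernel.ι (S.g ≫ q))]
  simp

/-- Third isomorphism theorem for S.X₁ ⊆ S.X₂ ⊆ D. -/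
theorem exists_shortExact_cokernel_comp {S : ShortComplex C} (hS : S.ShortExact) {D : C}
    (j : S.X₂ ⟶ D) [Mono j] :
    ∃ (w : (S.f ≫ j) ≫ cokernel.π j = 0) (u : S.X₃ ⟶ cokernel (S.f ≫ j))
      (w' : u ≫ cokernel.desc (S.f ≫ j) (cokernel.π j) w = 0),
      (ShortComplex.mk u (cokernel.desc (S.f ≫ j) (cokernel.π j) w) w').ShortExact := by
  have hm := hS.mono_f
  have he := hS.epi_g
  have w : (S.f ≫ j) ≫ cokernel.π j = 0 := by simp
  obtain ⟨u, hu⟩ := kernel_exact hS (j ≫ cokernel.π (S.f ≫ j))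
    (by rw [← Category.assoc, cokernel.condition])
  have w' : u ≫ cokernel.desc (S.f ≫ j) (cokernel.π j) w = 0 := by
    rw [← cancel_epi S.g, reassoc_of% hu]; simp
  refine ⟨w, u, w', ?_⟩
  have hmono : Mono u := by
    rw [Preadditive.mono_iff_cancel_zero]
    intro W z hz
    have h1 : (pullback.fst S.g z ≫ j) ≫ cokernel.π (S.f ≫ j) = 0 := by
      rw [Category.assoc, ← hu, pullback.condition_assoc, hz, comp_zero]
    have h2 : Abelian.monoLift (S.f ≫ j) _ h1 ≫ S.f = pullback.fst S.g z := by
      rw [← cancel_mono j, Category.assoc]; simp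
    have : Epi (pullback.snd S.g z) := inferInstance
    rw [← cancel_epi (pullback.snd S.g z), ← pullback.condition, ← h2]
    simp
  have hepi : Epi (cokernel.desc (S.f ≫ j) (cokernel.π j) w) :=
    epi_of_epi_fac (cokernel.π_desc _ _ _)
  refine { exact := ?_, mono_f := hmono, epi_g := hepi }
  apply ShortComplex.exact_of_g_is_cokernel
  refine CokernelCofork.IsColimit.ofπ' _ _ (fun {W} r hr => ?_)
  have hr' : u ≫ r = 0 := hr
  have h1 : j ≫ cokernel.π (S.f ≫ j) ≫ r = 0 := by
    rw [← Category.assoc, ← hu, Category.assoc, hr', comp_zero]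
  refine ⟨cokernel.desc j _ h1, ?_⟩
  rw [← cancel_epi (cokernel.π (S.f ≫ j))]
  simp

/-- Induction over proper quotients of noetherian objects. -/
theorem quotient_induction (hN : ∀ X : C, IsNoetherianObject X) (P : C → Prop)
    (h : ∀ X, (∀ (Y : C) (q : X ⟶ Y), Epi q → ¬ Mono q → P Y) → P X) (X : C) : P X := by
  by_contra hX
  have := hN X
  -- Among the quotients violating P, one with maximal kernel; each of its proper quotients has a
  -- strictly larger kernel in X.
  obtain ⟨U, ⟨Y, q, hq, rfl, hY⟩, hmax⟩ := (wellFounded_gt (α := Subobject X)).has_min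
    {U : Subobject X | ∃ (Y : C) (q : X ⟶ Y), Epi q ∧ kernelSubobject q = U ∧ ¬ P Y}
    ⟨_, X, 𝟙 X, inferInstance, rfl, hX⟩
  refine hY (h Y fun Z q' hq' hmono => ?_)
  by_contra hZ
  refine hmax (kernelSubobject (q ≫ q')) ⟨Z, q ≫ q', epi_comp _ _, rfl, hZ⟩ ?_
  refine lt_of_le_not_ge (le_kernelSubobject _ _ (by rw [kernelSubobject_arrow_comp_assoc,
    zero_comp])) fun hle => hmono ?_
  rw [Preadditive.mono_iff_cancel_zero]
  intro W z hz
  have h1 : pullback.fst q z ≫ q ≫ q' = 0 := by rw [pullback.condition_assoc, hz, comp_zero]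
  have h2 : pullback.fst q z ≫ q = 0 := by
    have h3 : (kernelSubobject (q ≫ q')).arrow ≫ q = 0 := by
      rw [← Subobject.ofLE_arrow hle, Category.assoc, kernelSubobject_arrow_comp, comp_zero]
    rw [← factorThruKernelSubobject_comp_arrow (q ≫ q') _ h1, Category.assoc, h3, comp_zero]
  have : Epi (pullback.snd q z) := inferInstance
  rw [← cancel_epi (pullback.snd q z), ← pullback.condition, h2, comp_zero]

end ShortExactSequences

/-- Induction over proper subobjects of artinian objects. -/
theorem subobject_induction {C : Type u} [Category.{v} C] (hA : ∀ X : C, IsArtinianObject X) (P : C → Prop)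
    (h : ∀ X, (∀ (Y : C) (i : Y ⟶ X), Mono i → ¬ Epi i → P Y) → P X) (X : C) : P X := by
  by_contra hX
  have := hA X
  obtain ⟨U, ⟨Y, i, hi, rfl, hY⟩, hmin⟩ := (wellFounded_lt (α := Subobject X)).has_min
    {U : Subobject X | ∃ (Y : C) (i : Y ⟶ X) (_ : Mono i), Subobject.mk i = U ∧ ¬ P Y}
    ⟨_, X, 𝟙 X, inferInstance, rfl, hX⟩
  refine hY (h Y fun Z i' hi' hepi => ?_)
  by_contra hZ
  refine hmin (Subobject.mk (i' ≫ i)) ⟨Z, i' ≫ i, mono_comp _ _, rfl, hZ⟩ ?_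
  refine lt_of_le_not_ge (Subobject.mk_le_mk_of_comm i' rfl) fun hle => hepi ?_
  have h1 : Subobject.ofMkLEMk _ _ hle ≫ i' = 𝟙 Y := by
    rw [← cancel_mono i, Category.assoc, Subobject.ofMkLEMk_comp, Category.id_comp]
  exact epi_of_epi_fac h1

/-! ### Closure properties of filtrations. -/

section Filtrations

variable {C : Type u} [Category.{v} C] [Abelian C] {Λ : Type s} {F : Λ → C}

theorem HasFiltration.of_iso {X Y : C} (hX : HasFiltration F X) (e : X ≅ Y) :
    HasFiltration F Y := by
  cases hX with
  | zero h => exact .zero (h.of_iso e.symm)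
  | @step E hE h l el =>
    let E' : ShortComplex C := ShortComplex.mk (E.f ≫ e.hom) (e.inv ≫ E.g) (by simp)
    have : E'.ShortExact := ShortComplex.shortExact_of_iso
      (ShortComplex.isoMk (S₁ := E) (S₂ := E') (Iso.refl _) e (Iso.refl _) (by simp [E']) (by simp [E'])) hE
    exact HasFiltration.step (E := E') this h l el

/-- Induction on the filtration of the quotient Z: the preimage in Y of the next-to-last step of Z
is an extension of that step by X, and has the same top subquotient above it. -/
theorem HasFiltration.extension {Z : C} (h₃ : HasFiltration F Z) {X Y : C} {f : X ⟶ Y}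
    {g : Y ⟶ Z} (w : f ≫ g = 0) (hS : (ShortComplex.mk f g w).ShortExact)
    (h₁ : HasFiltration F X) : HasFiltration F Y := by
  induction h₃ generalizing Y with
  | zero h =>
    have : IsIso f := (hS.isIso_f_iff).2 h
    exact h₁.of_iso (asIso f)
  | @step E hE h l el ih =>
    have := hE.epi_g
    have := hS.epi_g
    dsimp at this
    obtain ⟨w₁, g', w', hex, -⟩ := exists_shortExact_kernel_comp hS E.g
    have hk : Nonempty (kernel E.g ≅ E.X₁) :=
      ⟨IsLimit.conePointUniqueUpToIso (kernelIsKernel _) hE.fIsKernel⟩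
    obtain ⟨e⟩ := hk
    have hex2 : (ShortComplex.mk (kernel.lift (g ≫ E.g) f w₁) (g' ≫ e.hom)
        (by rw [← Category.assoc, w', zero_comp])).ShortExact :=
      ShortComplex.shortExact_of_iso
        (ShortComplex.isoMk (S₁ := ShortComplex.mk _ g' w') (Iso.refl _) (Iso.refl _) e
          (by simp) (by simp)) hex
    have h2 := ih _ hex2
    exact HasFiltration.step (shortExact_kernel (g ≫ E.g)) h2 l el

theorem HasFiltration.of_shortExact {S : ShortComplex C} (hS : S.ShortExact)
    (h₁ : HasFiltration F S.X₁) (h₃ : HasFiltration F S.X₃) : HasFiltration F S.X₂ :=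
  h₃.extension S.zero hS h₁

open ZeroObject in
theorem HasFiltration.of_mem (l : Λ) : HasFiltration F (F l) := by
  have : (ShortComplex.mk (0 : (0 : C) ⟶ F l) (𝟙 (F l)) (by simp)).ShortExact :=
    (ShortComplex.Splitting.ofIsZeroOfIsIso _ (isZero_zero C) inferInstance).shortExact
  exact HasFiltration.step this (.zero (isZero_zero C)) l ⟨Iso.refl _⟩

end Filtrations

/-! ### Composition factors, and Hom and Ext¹ between standard, simple and costandard objects. -/

namespace HighestWeightCategory

variable {k : Type t} [Field k] {C : Type u} [Category.{v} C] [Abelian C] [Linear k C]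
  [HasExt.{w} C] {Λ : Type s} [PartialOrder Λ] (H : HighestWeightCategory k C Λ)

/-- The set of weights `l` such that `L l` is a subquotient of `X`. -/
def factors (X : C) : Set Λ :=
  {l | ∃ (Y : C) (i : Y ⟶ X) (p : Y ⟶ H.L l), Mono i ∧ Epi p}

theorem factors_of_mono {X Y : C} (f : X ⟶ Y) [Mono f] : H.factors X ⊆ H.factors Y := by
  rintro l ⟨Z, i, p, hi, hp⟩
  exact ⟨Z, i ≫ f, p, mono_comp _ _, hp⟩

theorem factors_of_epi {X Y : C} (f : X ⟶ Y) [Epi f] : H.factors Y ⊆ H.factors X := by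
  rintro l ⟨Z, i, p, hi, hp⟩
  exact ⟨pullback f i, pullback.fst f i, pullback.snd f i ≫ p, inferInstance, epi_comp _ _⟩

theorem factors_of_iso {X Y : C} (e : X ≅ Y) : H.factors X = H.factors Y :=
  Set.Subset.antisymm (H.factors_of_mono e.hom) (H.factors_of_mono e.inv)

/-- For a subobject Y of S.X₂ with an epi p to L_l, restrict p to the kernel of Y → S.X₃. By
simplicity the restriction is epi, so that l is a factor of S.X₁, or it is zero, and then p descends
to the image of Y in S.X₃. -/
theorem factors_middle {S : ShortComplex C} (hS : S.ShortExact) :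
    H.factors S.X₂ = H.factors S.X₁ ∪ H.factors S.X₃ := by
  have hm := hS.mono_f
  have he := hS.epi_g
  refine Set.Subset.antisymm ?_ (Set.union_subset (H.factors_of_mono S.f) (H.factors_of_epi S.g))
  rintro l ⟨Y, i, p, hi, hp⟩
  have hs := H.simple l
  by_cases hz : kernel.ι (i ≫ S.g) ≫ p = 0
  · right
    refine ⟨Abelian.coimage (i ≫ S.g), Abelian.factorThruCoimage _, cokernel.desc _ p hz,
      inferInstance, ?_⟩
    exact epi_of_epi_fac (cokernel.π_desc _ p hz)
  · left
    have hw : (kernel.ι (i ≫ S.g) ≫ i) ≫ S.g = 0 := by simp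
    refine ⟨kernel (i ≫ S.g), hS.exact.lift _ hw, kernel.ι (i ≫ S.g) ≫ p, ?_,
      epi_of_nonzero_to_simple hz⟩
    exact mono_of_mono_fac (hS.exact.lift_f _ hw)

theorem factors_zero {X : C} (h : IsZero X) : H.factors X = ∅ := by
  rw [Set.eq_empty_iff_forall_notMem]
  rintro l ⟨Y, i, p, hi, hp⟩
  have hs := H.simple l
  have hY : IsZero Y := h.of_mono i
  exact Simple.not_isZero (H.L l) (hY.of_epi p)

theorem factors_L (l : Λ) : H.factors (H.L l) = {l} := by
  have hs := H.simple l
  apply Set.Subset.antisymm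
  · rintro m ⟨Y, i, p, hi, hp⟩
    have hs' := H.simple m
    have hne : i ≠ 0 := by
      rintro rfl
      have hY : IsZero Y := IsZero.of_mono_eq_zero (0 : Y ⟶ H.L l) rfl
      exact Simple.not_isZero (H.L m) (hY.of_epi p)
    have := isIso_of_mono_of_nonzero hne
    have hne' : inv i ≫ p ≠ 0 := fun h => by
      have : p = 0 := by rw [← IsIso.hom_inv_id_assoc i p, h, comp_zero]
      exact Simple.not_isZero (H.L m) (IsZero.of_epi_eq_zero p this)
    have := isIso_of_hom_simple hne'
    exact (H.eq_of_iso _ _ ⟨asIso (inv i ≫ p)⟩).symm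
  · rintro _ rfl
    exact ⟨H.L _, 𝟙 _, 𝟙 _, inferInstance, inferInstance⟩

theorem isSerreClass_factors (I : Set Λ) :
    ObjectProperty.IsSerreClass (fun X : C => H.factors X ⊆ I) where
  exists_zero := ⟨_, isZero_zero C, by rw [H.factors_zero (isZero_zero C)]; exact Set.empty_subset _⟩
  prop_of_mono f _ h := (H.factors_of_mono f).trans h
  prop_of_epi f _ h := (H.factors_of_epi f).trans h
  prop_X₂_of_shortExact hS h₁ h₃ := by
    rw [H.factors_middle hS]; exact Set.union_subset h₁ h₃

/-- Dévissage along composition factors. -/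
theorem induction_factors (P : C → Prop) (h0 : ∀ X, IsZero X → P X)
    (hiso : ∀ X Y, (X ≅ Y) → P X → P Y)
    (hext : ∀ S : ShortComplex C, S.ShortExact → P S.X₁ → P S.X₃ → P S.X₂) (X : C)
    (hL : ∀ l ∈ H.factors X, P (H.L l)) : P X := by
  let P' : ObjectProperty C := fun Y => (∀ l ∈ H.factors Y, P (H.L l)) → P Y
  have : P'.IsClosedUnderIsomorphisms := ⟨fun {Y Z} e h h' =>
    hiso _ _ e (h (by rwa [H.factors_of_iso e]))⟩
  have : P'.IsClosedUnderExtensions := ⟨fun {S} hS h₁ h₃ h => by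
    rw [H.factors_middle hS] at h
    exact hext S hS (h₁ fun l hl => h l (Or.inl hl)) (h₃ fun l hl => h l (Or.inr hl))⟩
  refine devissage H.finiteLength P' (fun Y hY _ => h0 Y hY) (fun Y hY h => ?_) X hL
  obtain ⟨l, ⟨e⟩⟩ := H.exists_iso Y hY
  refine hiso _ _ e.symm (h l ?_)
  rw [H.factors_of_iso e, H.factors_L]; rfl

/-- The objects with all factors in I form a Serre class containing the generators; conversely
dévissage places such an object in every Serre class that contains them. -/
theorem mem_serreClosure_iff (I : Set Λ) (X : C) :
    serreClosure H.L I X ↔ H.factors X ⊆ I := by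
  constructor
  · intro h
    exact h _ (H.isSerreClass_factors I) (fun i hi => by
      rw [H.factors_L]; exact Set.singleton_subset_iff.2 hi)
  · intro h P hP hL
    exact H.induction_factors P (fun Y hY => P.prop_of_isZero hY)
      (fun Y Z e h => P.prop_of_iso e h) (fun S hS h₁ h₃ => P.prop_X₂_of_shortExact hS h₁ h₃)
      X (fun l hl => hL l (h hl))

theorem factors_finite (X : C) : (H.factors X).Finite := by
  refine H.induction_factors (fun X => (H.factors X).Finite) ?_ ?_ ?_ X ?_
  · intro Y hY; rw [H.factors_zero hY]; exact Set.finite_empty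
  · intro Y Z e h; rwa [← H.factors_of_iso e]
  · intro S hS h₁ h₃; rw [H.factors_middle hS]; exact h₁.union h₃
  · intro l _; rw [H.factors_L]; exact Set.finite_singleton l

theorem isZero_of_factors_eq_empty {X : C} (h : H.factors X = ∅) : IsZero X := by
  refine H.induction_factors (fun X => IsZero X) (fun _ h => h) (fun _ _ e h => h.of_iso e.symm)
    (fun S hS h₁ h₃ => ?_) X (by simp [h])
  have := (hS.isIso_f_iff).2 h₃
  exact h₁.of_iso (asIso S.f).symm

theorem factors_standard (l : Λ) : H.factors (H.Δ l) ⊆ Set.Iic l :=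
  (H.mem_serreClosure_iff _ _).1 (H.projectiveCover l).mem

theorem factors_costandard (l : Λ) : H.factors (H.N l) ⊆ Set.Iic l :=
  (H.mem_serreClosure_iff _ _).1 (H.injectiveHull l).mem

theorem p_ne_zero (l : Λ) : H.p l ≠ 0 := fun h => by
  have := (H.projectiveCover l).epi
  have := H.simple l
  exact Simple.not_isZero (H.L l) (IsZero.of_epi_eq_zero _ h)

theorem p_comp_i_ne_zero (l : Λ) : H.p l ≫ H.i l ≠ 0 := fun h => by
  have := (H.injectiveHull l).mono
  exact H.p_ne_zero l ((cancel_mono (H.i l)).1 (h.trans zero_comp.symm))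

theorem exists_smul_of_standard_costandard (l : Λ) (f : H.Δ l ⟶ H.N l) :
    ∃ c : k, f = c • (H.p l ≫ H.i l) := by
  obtain ⟨e⟩ := H.hom_standard_costandard l
  have h : e (H.p l ≫ H.i l) ≠ 0 := fun h => H.p_comp_i_ne_zero l (by simpa using h)
  refine ⟨e f / e (H.p l ≫ H.i l), e.injective ?_⟩
  rw [map_smul, smul_eq_mul, div_mul_cancel₀ _ h]

/-- This is [Δ_l : L_l] = 1. If L_l were a quotient of some Y inside ker p, injectivity of ∇_l would
extend Y → L_l → ∇_l to Δ_l. But every map Δ_l → ∇_l is a multiple of the one through L_l, hence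
vanishes on ker p. -/
theorem factors_kernel_p (l : Λ) : H.factors (kernel (H.p l)) ⊆ Set.Iio l := by
  intro m hm
  refine lt_of_le_of_ne (H.factors_standard l (H.factors_of_mono (kernel.ι _) hm)) ?_
  rintro rfl
  obtain ⟨Y, i, p, hi, hp⟩ := hm
  have hY : H.factors Y ⊆ Set.Iic m :=
    (H.factors_of_mono (i ≫ kernel.ι _)).trans (H.factors_standard m)
  obtain ⟨g, hg⟩ := (H.injectiveHull m).extend ((H.mem_serreClosure_iff _ _).2 hY)
    (H.projectiveCover m).mem (i ≫ kernel.ι (H.p m)) (p ≫ H.i m) (mono_comp _ _)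
  obtain ⟨c, rfl⟩ := H.exists_smul_of_standard_costandard m g
  have h0 : p ≫ H.i m = 0 := by rw [← hg]; simp
  have := (H.injectiveHull m).mono
  have hs := H.simple m
  exact Simple.not_isZero (H.L m) (IsZero.of_epi_eq_zero p
    ((cancel_mono (H.i m)).1 (h0.trans zero_comp.symm)))

/-- Dual argument: projectivity of Δ_l replaces injectivity of ∇_l, applied to the preimage in ∇_l
of the subobject with quotient L_l. -/
theorem factors_cokernel_i (l : Λ) : H.factors (cokernel (H.i l)) ⊆ Set.Iio l := by
  intro m hm
  refine lt_of_le_of_ne (H.factors_costandard l (H.factors_of_epi (cokernel.π _) hm)) ?_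
  rintro rfl
  obtain ⟨Y, i, p, hi, hp⟩ := hm
  let Y' := pullback (cokernel.π (H.i m)) i
  have hY' : H.factors Y' ⊆ Set.Iic m :=
    (H.factors_of_mono (pullback.fst _ _)).trans (H.factors_costandard m)
  have hL : H.factors (H.L m) ⊆ Set.Iic m := by simp [H.factors_L]
  have := H.projectiveCover m
  obtain ⟨h, hh⟩ := (H.projectiveCover m).lift ((H.mem_serreClosure_iff _ _).2 hY')
    ((H.mem_serreClosure_iff _ _).2 hL) (pullback.snd (cokernel.π (H.i m)) i ≫ p) (H.p m)
    (epi_comp _ _)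
  obtain ⟨c, hc⟩ := H.exists_smul_of_standard_costandard m (h ≫ pullback.fst _ _)
  have h1 : h ≫ pullback.snd (cokernel.π (H.i m)) i = 0 := by
    rw [← cancel_mono i, Category.assoc, ← pullback.condition, ← Category.assoc, hc]
    simp
  exact H.p_ne_zero m (by rw [← hh, reassoc_of% h1, zero_comp])

/-- The kernel of f lies in ker p, since otherwise it would surject onto L_l and, p being essential,
be all of Δ_l. So p descends to the image of f. -/
theorem mem_factors_of_standard_hom {l : Λ} {Z : C} {f : H.Δ l ⟶ Z} (hf : f ≠ 0) :
    l ∈ H.factors Z := by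
  have hs := H.simple l
  have hepi := (H.projectiveCover l).epi
  have h0 : kernel.ι f ≫ H.p l = 0 := by
    by_contra h
    have h1 : Epi (kernel.ι f) := (H.projectiveCover l).essential
      ((H.mem_serreClosure_iff _ _).2
        ((H.factors_of_mono (kernel.ι f)).trans (H.factors_standard l))) _
      (epi_of_nonzero_to_simple h)
    exact hf ((cancel_epi (kernel.ι f)).1 (by simp))
  refine ⟨Abelian.coimage f, Abelian.factorThruCoimage _, cokernel.desc _ (H.p l) h0,
    inferInstance, epi_of_epi_fac (cokernel.π_desc _ (H.p l) h0)⟩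

theorem mem_factors_of_hom_costandard {l : Λ} {Z : C} {f : Z ⟶ H.N l} (hf : f ≠ 0) :
    l ∈ H.factors Z := by
  have hs := H.simple l
  have hmono := (H.injectiveHull l).mono
  have h0 : H.i l ≫ cokernel.π f = 0 := by
    by_contra h
    have h1 : Mono (cokernel.π f) := (H.injectiveHull l).essential
      ((H.mem_serreClosure_iff _ _).2
        ((H.factors_of_epi (cokernel.π f)).trans (H.factors_costandard l))) _
      (mono_of_nonzero_from_simple h)
    exact hf ((cancel_mono (cokernel.π f)).1 (by simp))
  let j : H.L l ⟶ Abelian.image f := kernel.lift _ (H.i l) h0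
  have hj : Mono j := mono_of_mono_fac (kernel.lift_ι _ (H.i l) h0)
  exact ⟨pullback (Abelian.factorThruImage f) j, pullback.fst _ _, pullback.snd _ _,
    inferInstance, inferInstance⟩

theorem standard_costandard_eq_zero {l m : Λ} (h : l ≠ m) (f : H.Δ l ⟶ H.N m) : f = 0 := by
  by_contra hf
  exact h (le_antisymm (H.factors_costandard m (H.mem_factors_of_standard_hom hf))
    (H.factors_standard l (H.mem_factors_of_hom_costandard hf)))

/-- Since Ext¹(Δ_l, ∇_m) = 0, this Ext¹ is a quotient of Hom(Δ_l, ∇_m/L_m), and ∇_m/L_m only has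
factors below m. -/
theorem ext_one_standard_L {l m : Λ} (h : ¬ l < m) : Subsingleton (Ext (H.Δ l) (H.L m) 1) := by
  have := (H.injectiveHull m).mono
  refine ext_sub_right (shortExact_cokernel (H.i m)) _ 0 (H.ext_one l m) ?_
  rw [ext_zero_subsingleton_iff]
  intro f
  by_contra hf
  exact h (H.factors_cokernel_i m (H.mem_factors_of_standard_hom hf))

theorem ext_one_L_costandard {l m : Λ} (h : ¬ m < l) : Subsingleton (Ext (H.L l) (H.N m) 1) := by
  have := (H.projectiveCover l).epi
  refine ext_quotient_left (shortExact_kernel (H.p l)) _ 0 (H.ext_one l m) ?_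
  rw [ext_zero_subsingleton_iff]
  intro f
  by_contra hf
  exact h (H.factors_kernel_p l (H.mem_factors_of_hom_costandard hf))

theorem ext_one_standard {l : Λ} {X : C} (h : ∀ m ∈ H.factors X, ¬ l < m) :
    Subsingleton (Ext (H.Δ l) X 1) := by
  refine H.induction_factors (fun X => Subsingleton (Ext (H.Δ l) X 1))
    (fun _ hY => ext_subsingleton_of_isZero_right hY)
    (fun _ _ e _ => ext_eq_of_iso_right e) (fun _ hS h₁ h₃ => ext_middle_right hS _ _ h₁ h₃) X
    (fun m hm => H.ext_one_standard_L (h m hm))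

theorem ext_one_costandard {l : Λ} {X : C} (h : ∀ m ∈ H.factors X, ¬ l < m) :
    Subsingleton (Ext X (H.N l) 1) := by
  refine H.induction_factors (fun X => Subsingleton (Ext X (H.N l) 1))
    (fun _ hY => ext_subsingleton_of_isZero_left hY)
    (fun _ _ e _ => ext_eq_of_iso_left e) (fun _ hS h₁ h₃ => ext_middle_left hS _ _ h₁ h₃) X
    (fun m hm => H.ext_one_L_costandard (h m hm))

/-- For simple objects the connecting map from the finite-dimensional Hom(Δ_l, ∇_m/L_m) is onto;
dévissage does the rest. -/
theorem ext_one_standard_finite (l : Λ) (X : C) : Module.Finite k (Ext (H.Δ l) X 1) := by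
  refine H.induction_factors (fun X => Module.Finite k (Ext (H.Δ l) X 1)) ?_ ?_ ?_ X ?_
  · intro Y hY
    have : Subsingleton (Ext (H.Δ l) Y 1) := ext_subsingleton_of_isZero_right hY
    infer_instance
  · intro Y Z e hY
    refine Module.Finite.of_surjective
      ((Ext.mk₀ e.hom).postcompOfLinear k (H.Δ l) (add_zero 1)) fun α => ?_
    refine ⟨α.comp (Ext.mk₀ e.inv) (add_zero 1), ?_⟩
    simp [Ext.bilinearCompOfLinear]
  · intro S hS h₁ h₃
    exact finite_of_exact ((Ext.mk₀ S.f).postcompOfLinear k (H.Δ l) (add_zero 1))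
      ((Ext.mk₀ S.g).postcompOfLinear k (H.Δ l) (add_zero 1))
      fun α hα => Ext.covariant_sequence_exact₂ _ hS α hα
  · intro m _
    have := (H.injectiveHull m).mono
    have hS := shortExact_cokernel (H.i m)
    have := H.finite_hom (H.Δ l) (cokernel (H.i m))
    have : Module.Finite k (Ext (H.Δ l) (cokernel (H.i m)) 0) :=
      Module.Finite.equiv (Ext.linearEquiv₀ (R := k)).symm
    have := H.ext_one l m
    refine Module.Finite.of_surjective (hS.extClass.postcompOfLinear k (H.Δ l) (zero_add 1))
      fun α => ?_
    exact Ext.covariant_sequence_exact₁ _ hS α (Subsingleton.elim _ _) (zero_add 1)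

end HighestWeightCategory

/-! ### Criteria for filtrations, universal extensions and vanishing of higher Ext. -/

namespace HighestWeightCategory

variable {k : Type t} [Field k] {C : Type u} [Category.{v} C] [Abelian C] [Linear k C]
  [HasExt.{w} C] {Λ : Type s} [PartialOrder Λ] (H : HighestWeightCategory k C Λ)

theorem ext_of_filtrations (n : ℕ) (h : ∀ l m, Subsingleton (Ext (H.Δ l) (H.N m) n)) {X Y : C}
    (hX : HasFiltration H.Δ X) (hY : HasFiltration H.N Y) : Subsingleton (Ext X Y n) := by
  have h1 : ∀ l, Subsingleton (Ext (H.Δ l) Y n) := fun l => by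
    induction hY with
    | zero h0 => exact ext_subsingleton_of_isZero_right h0
    | step hE _ m e ih =>
      obtain ⟨e⟩ := e
      have := h l m
      exact ext_middle_right hE _ _ ih (ext_eq_of_iso_right e.symm)
  induction hX with
  | zero h0 => exact ext_subsingleton_of_isZero_left h0
  | step hE _ m e ih =>
    obtain ⟨e⟩ := e
    have := h1 m
    exact ext_middle_left hE _ _ ih (ext_eq_of_iso_left e.symm)

theorem ext_subsingleton_left_of_L {n : ℕ} {X M : C}
    (h : ∀ l ∈ H.factors X, Subsingleton (Ext (H.L l) M n)) : Subsingleton (Ext X M n) :=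
  H.induction_factors (fun X => Subsingleton (Ext X M n))
    (fun _ hY => ext_subsingleton_of_isZero_left hY)
    (fun _ _ e _ => ext_eq_of_iso_left e) (fun _ hS h₁ h₃ => ext_middle_left hS _ _ h₁ h₃) X h

theorem ext_subsingleton_right_of_L {n : ℕ} {X M : C}
    (h : ∀ l ∈ H.factors X, Subsingleton (Ext M (H.L l) n)) : Subsingleton (Ext M X n) :=
  H.induction_factors (fun X => Subsingleton (Ext M X n))
    (fun _ hY => ext_subsingleton_of_isZero_right hY)
    (fun _ _ e _ => ext_eq_of_iso_right e) (fun _ hS h₁ h₃ => ext_middle_right hS _ _ h₁ h₃) X h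

theorem factors_nonempty {M : C} (hM : ¬ IsZero M) : (H.factors M).Nonempty := by
  by_contra h
  exact hM (H.isZero_of_factors_eq_empty (Set.not_nonempty_iff_eq_empty.1 h))

/-- For a maximal factor m of M, realised as the quotient L_m of a subobject Y, no factor of the
kernel of Y → L_m exceeds m. Hence p lifts to Y. -/
theorem exists_standard_hom {M : C} (hM : ¬ IsZero M) : ∃ l, ∃ f : H.Δ l ⟶ M, f ≠ 0 := by
  obtain ⟨m, hmax⟩ := (H.factors_finite M).exists_maximal (H.factors_nonempty hM)
  obtain ⟨⟨Y, i, q, hi, hq⟩, hmax⟩ := hmax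
  have hext : Subsingleton (Ext (H.Δ m) (kernel q) 1) := H.ext_one_standard fun l hl hlt =>
    hlt.not_ge (hmax (H.factors_of_mono (kernel.ι q ≫ i) hl) hlt.le)
  obtain ⟨g, hg⟩ := exists_lift_of_ext (shortExact_kernel q) hext (H.p m)
  refine ⟨m, g ≫ i, fun h0 => H.p_ne_zero m ?_⟩
  rw [← hg, (cancel_mono i).1 (h0.trans zero_comp.symm), zero_comp]

theorem exists_hom_costandard {M : C} (hM : ¬ IsZero M) : ∃ l, ∃ f : M ⟶ H.N l, f ≠ 0 := by
  obtain ⟨m, hmax⟩ := (H.factors_finite M).exists_maximal (H.factors_nonempty hM)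
  obtain ⟨⟨Y, i, q, hi, hq⟩, hmax⟩ := hmax
  have hext : Subsingleton (Ext (cokernel i) (H.N m) 1) := H.ext_one_costandard fun l hl hlt =>
    hlt.not_ge (hmax (H.factors_of_epi (cokernel.π i) hl) hlt.le)
  obtain ⟨g, hg⟩ := exists_desc_of_ext (shortExact_cokernel i) hext (q ≫ H.i m)
  refine ⟨m, g, fun h0 => ?_⟩
  have := (H.injectiveHull m).mono
  have := H.simple m
  have h1 : q ≫ H.i m = 0 := by rw [← hg, h0, comp_zero]
  exact Simple.not_isZero (H.L m) (IsZero.of_epi_eq_zero q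
    ((cancel_mono (H.i m)).1 (h1.trans zero_comp.symm)))

/-- The cohomological criterion for costandard filtrations. -/
theorem hasFiltration_N_of_ext (M : C) (hM : ∀ m, Subsingleton (Ext (H.Δ m) M 1)) :
    HasFiltration H.N M := by
  revert hM
  refine quotient_induction (fun X => (H.finiteLength X).1)
    (fun M => (∀ m, Subsingleton (Ext (H.Δ m) M 1)) → HasFiltration H.N M) (fun M ih hM => ?_) M
  by_cases h0 : IsZero M
  · exact .zero h0
  -- With m minimal, no L_l with l < m maps nontrivially to M. So f kills the kernel of Δ_m → L_m,
  -- and L_m embeds into M. The same minimality yields Ext¹(L_l, M) = 0 for l < m.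
  obtain ⟨m, ⟨f, hf⟩, hmin⟩ := Set.Finite.exists_minimal
    (s := {l | ∃ f : H.Δ l ⟶ M, f ≠ 0})
    ((H.factors_finite M).subset fun l ⟨f, hf⟩ => H.mem_factors_of_standard_hom hf)
    (H.exists_standard_hom h0)
  have hL : ∀ l < m, Subsingleton (Ext (H.L l) M 0) := fun l hl => by
    rw [ext_zero_subsingleton_iff]
    intro g
    by_contra hg
    have := (H.projectiveCover l).epi
    exact hl.not_ge (hmin ⟨H.p l ≫ g, fun h => hg ((cancel_epi (H.p l)).1 (by simpa using h))⟩ hl.le)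
  have hR : ∀ l ≤ m, Subsingleton (Ext (kernel (H.p l)) M 0) := fun l hl =>
    H.ext_subsingleton_left_of_L fun n hn => hL n ((H.factors_kernel_p l hn).trans_le hl)
  have hL1 : ∀ l < m, Subsingleton (Ext (H.L l) M 1) := fun l hl => by
    have := (H.projectiveCover l).epi
    exact ext_quotient_left (shortExact_kernel (H.p l)) M 0 (hM l) (hR l hl.le)
  have hepi := (H.projectiveCover m).epi
  obtain ⟨j, hj⟩ := kernel_exact (shortExact_kernel (H.p m)) f
    (ext_zero_subsingleton_iff.1 (hR m le_rfl) _)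
  have hs := H.simple m
  have hjne : j ≠ 0 := by rintro rfl; exact hf (by rw [← hj, comp_zero])
  have hjm := mono_of_nonzero_from_simple hjne
  have him := (H.injectiveHull m).mono
  -- The embedding of L_m extends to ∇_m because all factors of ∇_m/L_m lie below m; it stays mono
  -- because the hull L_m ⟶ ∇_m is essential.
  obtain ⟨J, hJ⟩ := exists_desc_of_ext (shortExact_cokernel (H.i m))
    (H.ext_subsingleton_left_of_L fun n hn => hL1 n (H.factors_cokernel_i m hn)) j
  dsimp at hJ
  have hJm : Mono J := by
    have h1 : Mono (Abelian.factorThruImage J) := (H.injectiveHull m).essential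
      ((H.mem_serreClosure_iff _ _).2
        ((H.factors_of_epi (Abelian.factorThruImage J)).trans (H.factors_costandard m))) _
      (by
        have : Mono ((H.i m ≫ Abelian.factorThruImage J) ≫ Abelian.image.ι J) := by
          rw [Category.assoc, Abelian.image.fac, hJ]; exact hjm
        exact mono_of_mono _ (Abelian.image.ι J))
    rw [← Abelian.image.fac J]
    exact mono_comp _ _
  have hS := shortExact_cokernel J
  -- The quotient M/∇_m inherits the hypothesis; here Ext²(Δ, ∇) = 0 is needed.
  refine HasFiltration.of_shortExact hS (HasFiltration.of_mem m)
    (ih _ (cokernel.π J) inferInstance (fun hmono => ?_) fun l =>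
      ext_quotient_right hS _ 1 (hM l) (H.ext_two l m))
  have h2 : J = 0 := (cancel_mono (cokernel.π J)).1 (by simp)
  exact hjne (by rw [← hJ, h2, comp_zero])

/-- The cohomological criterion for standard filtrations. -/
theorem hasFiltration_Δ_of_ext (M : C) (hM : ∀ m, Subsingleton (Ext M (H.N m) 1)) :
    HasFiltration H.Δ M := by
  revert hM
  refine subobject_induction (fun X => (H.finiteLength X).2)
    (fun M => (∀ m, Subsingleton (Ext M (H.N m) 1)) → HasFiltration H.Δ M) (fun M ih hM => ?_) M
  by_cases h0 : IsZero M
  · exact .zero h0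
  -- Dually, M maps onto L_m, the map lifts to an epi M ⟶ Δ_m, and its kernel inherits the
  -- hypothesis.
  obtain ⟨m, ⟨f, hf⟩, hmin⟩ := Set.Finite.exists_minimal
    (s := {l | ∃ f : M ⟶ H.N l, f ≠ 0})
    ((H.factors_finite M).subset fun l ⟨f, hf⟩ => H.mem_factors_of_hom_costandard hf)
    (H.exists_hom_costandard h0)
  have hL : ∀ l < m, Subsingleton (Ext M (H.L l) 0) := fun l hl => by
    rw [ext_zero_subsingleton_iff]
    intro g
    by_contra hg
    have := (H.injectiveHull l).mono
    exact hl.not_ge (hmin ⟨g ≫ H.i l, fun h => hg ((cancel_mono (H.i l)).1 (by simpa using h))⟩ hl.le)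
  have hR : ∀ l ≤ m, Subsingleton (Ext M (cokernel (H.i l)) 0) := fun l hl =>
    H.ext_subsingleton_right_of_L fun n hn => hL n ((H.factors_cokernel_i l hn).trans_le hl)
  have hL1 : ∀ l < m, Subsingleton (Ext M (H.L l) 1) := fun l hl => by
    have := (H.injectiveHull l).mono
    exact ext_sub_right (shortExact_cokernel (H.i l)) M 0 (hM l) (hR l hl.le)
  have him := (H.injectiveHull m).mono
  have hfz : f ≫ cokernel.π (H.i m) = 0 := ext_zero_subsingleton_iff.1 (hR m le_rfl) _
  obtain ⟨j, hj⟩ : ∃ j : M ⟶ H.L m, j ≫ H.i m = f :=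
    ⟨Abelian.monoLift _ f hfz, Abelian.monoLift_comp _ _ _⟩
  have hs := H.simple m
  have hjne : j ≠ 0 := by rintro rfl; exact hf (by rw [← hj, zero_comp])
  have hje := epi_of_nonzero_to_simple hjne
  have hpe := (H.projectiveCover m).epi
  obtain ⟨J, hJ⟩ := exists_lift_of_ext (shortExact_kernel (H.p m))
    (H.ext_subsingleton_right_of_L fun n hn => hL1 n (H.factors_kernel_p m hn)) j
  dsimp at hJ
  have hJe : Epi J := by
    have h1 : Epi (Abelian.image.ι J) := (H.projectiveCover m).essential
      ((H.mem_serreClosure_iff _ _).2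
        ((H.factors_of_mono (Abelian.image.ι J)).trans (H.factors_standard m))) _
      (by
        have : Epi (Abelian.factorThruImage J ≫ Abelian.image.ι J ≫ H.p m) := by
          rw [← Category.assoc, Abelian.image.fac, hJ]; exact hje
        exact epi_of_epi (Abelian.factorThruImage J) _)
    rw [← Abelian.image.fac J]
    exact epi_comp _ _
  have hS := shortExact_kernel J
  refine HasFiltration.of_shortExact hS
    (ih _ (kernel.ι J) inferInstance (fun hepi => ?_) fun l =>
      ext_sub_left hS _ 1 (hM l) (H.ext_two m l)) (HasFiltration.of_mem m)
  have h2 : J = 0 := (cancel_epi (kernel.ι J)).1 (by simp)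
  exact hjne (by rw [← hJ, h2, zero_comp])

variable {H}

theorem hasFiltration_Δ_of_retract {X M : C} (hM : HasFiltration H.Δ M) (i : X ⟶ M) (r : M ⟶ X)
    (h : i ≫ r = 𝟙 X) : HasFiltration H.Δ X :=
  H.hasFiltration_Δ_of_ext X fun m => ext_of_retract_left i r h
    (H.ext_of_filtrations 1 H.ext_one hM (.of_mem m))

theorem hasFiltration_N_of_retract {X M : C} (hM : HasFiltration H.N M) (i : X ⟶ M) (r : M ⟶ X)
    (h : i ≫ r = 𝟙 X) : HasFiltration H.N X :=
  H.hasFiltration_N_of_ext X fun m => ext_of_retract_right i r h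
    (H.ext_of_filtrations 1 H.ext_one (.of_mem m) hM)

theorem hasFiltration_N_quotient {S : ShortComplex C} (hS : S.ShortExact)
    (h₁ : HasFiltration H.N S.X₁) (h₂ : HasFiltration H.N S.X₂) : HasFiltration H.N S.X₃ :=
  H.hasFiltration_N_of_ext _ fun m => ext_quotient_right hS _ 1
    (H.ext_of_filtrations 1 H.ext_one (.of_mem m) h₂)
    (H.ext_of_filtrations 2 H.ext_two (.of_mem m) h₁)

variable (H)

/-- The support of `X`: weights `m` with a nonzero map to `∇_m`. -/
def supp (X : C) : Set Λ := {m | ∃ f : X ⟶ H.N m, f ≠ 0}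

theorem supp_subset_factors (X : C) : H.supp X ⊆ H.factors X :=
  fun _ ⟨_, hf⟩ => H.mem_factors_of_hom_costandard hf

theorem supp_standard (l : Λ) : H.supp (H.Δ l) ⊆ {l} := by
  rintro m ⟨f, hf⟩
  by_contra h
  exact hf (H.standard_costandard_eq_zero (Ne.symm h) f)

theorem supp_middle_subset {S : ShortComplex C} (hS : S.ShortExact) :
    H.supp S.X₂ ⊆ H.supp S.X₁ ∪ H.supp S.X₃ := by
  rintro m ⟨f, hf⟩
  by_cases h : S.f ≫ f = 0
  · obtain ⟨g, hg⟩ := kernel_exact hS f h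
    exact Or.inr ⟨g, fun h0 => hf (by rw [← hg, h0, comp_zero])⟩
  · exact Or.inl ⟨_, h⟩

theorem supp_of_epi {X Y : C} (q : X ⟶ Y) [Epi q] : H.supp Y ⊆ H.supp X := by
  rintro m ⟨f, hf⟩
  exact ⟨q ≫ f, fun h => hf ((cancel_epi q).1 (by simpa using h))⟩

/-- Maps to ∇_m extend from S.X₁ to S.X₂, because Ext¹ from the standardly filtered S.X₃ to ∇_m
vanishes. -/
theorem supp_of_mono {S : ShortComplex C} (hS : S.ShortExact) (h₃ : HasFiltration H.Δ S.X₃) :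
    H.supp S.X₁ ⊆ H.supp S.X₂ := by
  rintro m ⟨f, hf⟩
  obtain ⟨g, hg⟩ := exists_desc_of_ext hS (H.ext_of_filtrations 1 H.ext_one h₃ (.of_mem m)) f
  exact ⟨g, fun h => hf (by rw [← hg, h, comp_zero])⟩

/-- The standard subquotients Δ_m of X have m in the support, and all factors of Δ_m are ≤ m.
Testing on the support alone is what makes the weights drop strictly along a tilting coresolution.
-/
theorem ext_one_standard_of_supp {l : Λ} {X : C} (hX : HasFiltration H.Δ X)
    (h : ∀ m ∈ H.supp X, ¬ l < m) : Subsingleton (Ext (H.Δ l) X 1) := by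
  induction hX with
  | zero h0 => exact ext_subsingleton_of_isZero_right h0
  | @step E hE hX m e ih =>
    obtain ⟨e⟩ := e
    have := hE.epi_g
    have hm : m ∈ H.supp E.X₂ := H.supp_of_epi (E.g ≫ e.hom) ⟨_, H.p_comp_i_ne_zero m⟩
    have : Subsingleton (Ext (H.Δ l) (H.Δ m) 1) := H.ext_one_standard fun n hn hlt =>
      h m hm (hlt.trans_le (H.factors_standard m hn))
    exact ext_middle_right hE _ _
      (ih fun n hn => h n (H.supp_of_mono hE ((HasFiltration.of_mem m).of_iso e.symm) hn))
      (ext_eq_of_iso_right e.symm)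

/-- Universal extensions: an object embeds into an object with a costandard filtration, with
a cokernel that has a standard filtration. -/
theorem exists_costandard_envelope (Γ : Finset Λ) (hΓ : ∀ l ∈ Γ, ∀ m < l, m ∈ Γ) (E : C)
    (hE : ∀ l ∉ Γ, Subsingleton (Ext (H.Δ l) E 1)) :
    ∃ (Y : C) (j : E ⟶ Y), Mono j ∧ HasFiltration H.N Y ∧ HasFiltration H.Δ (cokernel j) ∧
      H.supp (cokernel j) ⊆ Γ := by
  classical
  induction hn : Γ.card generalizing Γ E with
  | zero =>
    rw [Finset.card_eq_zero] at hn
    subst hn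
    have hz : IsZero (cokernel (𝟙 E)) := isZero_cokernel_of_epi (𝟙 E)
    refine ⟨E, 𝟙 E, inferInstance, H.hasFiltration_N_of_ext E fun m => hE m (by simp), .zero hz, ?_⟩
    rintro m ⟨f, hf⟩
    exact absurd (hz.eq_of_src _ _) hf
  | succ n ih =>
    -- Extending by Δ_m creates Ext¹ from Δ_l only for l < m. So a maximal m is treated first, by
    -- induction on dim Ext¹(Δ_m, E), and can then be erased from Γ, which remains closed downwards.
    obtain ⟨m, hm, hmax⟩ := Γ.exists_maximal (Finset.card_pos.1 (by omega))
    induction hd : Module.finrank k (Ext (H.Δ m) E 1) using Nat.strong_induction_on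
      generalizing E with
    | _ d ihd =>
      by_cases hsub : Subsingleton (Ext (H.Δ m) E 1)
      · obtain ⟨Y, j, h1, h2, h3, h4⟩ := ih (Γ.erase m) (fun l hl l' hl' => by
            rw [Finset.mem_erase] at hl ⊢
            refine ⟨?_, hΓ l hl.2 l' hl'⟩
            rintro rfl
            exact hl'.not_ge (hmax hl.2 hl'.le)) E (fun l hl => by
            rw [Finset.mem_erase, not_and_or, not_not] at hl
            rcases hl with rfl | hl
            · exact hsub
            · exact hE l hl) (by rw [Finset.card_erase_of_mem hm]; omega)
        exact ⟨Y, j, h1, h2, h3, h4.trans (by simp)⟩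
      · have hΔ : ∀ l, ¬ l < m → Subsingleton (Ext (H.Δ l) (H.Δ m) 1) := fun l hl =>
          H.ext_one_standard fun n hn hlt => hl (hlt.trans_le (H.factors_standard m hn))
        rw [not_subsingleton_iff_nontrivial] at hsub
        obtain ⟨α, hα⟩ := exists_ne (0 : Ext (H.Δ m) E 1)
        obtain ⟨E', f, g, w, hS, rfl⟩ := exists_shortExact_of_ext_one α
        have := H.ext_one_standard_finite m E
        have := hΔ m (lt_irrefl m)
        have := hS.mono_f
        let φ := (Ext.mk₀ f).postcompOfLinear k (H.Δ m) (add_zero 1)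
        have hφ : Function.Surjective φ := fun β =>
          Ext.covariant_sequence_exact₂ _ hS β (Subsingleton.elim _ _)
        have hker : hS.extClass ∈ LinearMap.ker φ := hS.extClass_comp
        -- Ext¹(Δ_m, E) surjects onto Ext¹(Δ_m, E') since Δ_m has no self-extensions, and the class
        -- of the extension E' itself dies.
        have hlt : Module.finrank k (Ext (H.Δ m) E' 1) < d := by
          have h1 := LinearMap.finrank_range_add_finrank_ker φ
          rw [LinearMap.range_eq_top.2 hφ, finrank_top] at h1
          have : Nontrivial (LinearMap.ker φ) :=
            ⟨⟨⟨_, hker⟩, 0, fun h => hα (congrArg Subtype.val h)⟩⟩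
          have h2 : 0 < Module.finrank k (LinearMap.ker φ) := Module.finrank_pos
          omega
        obtain ⟨Y, j, hj, hY, hc, hsupp⟩ := ihd _ hlt E' (fun l hl =>
          ext_middle_right hS _ _ (hE l hl) (hΔ l fun h => hl (hΓ m hm l h))) rfl
        obtain ⟨w₁, u, w', hex⟩ := exists_shortExact_cokernel_comp hS j
        refine ⟨Y, f ≫ j, mono_comp _ _, hY, HasFiltration.of_shortExact hex (.of_mem m) hc, ?_⟩
        refine (H.supp_middle_subset hex).trans (Set.union_subset ?_ hsupp)
        exact (H.supp_standard m).trans (by simpa using hm)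

theorem finite_strictly_below (H : HighestWeightCategory k C Λ) {I : Set Λ} (hI : I.Finite) : {l | ∃ m ∈ I, l < m}.Finite := by
  refine (hI.biUnion fun m _ => H.lowerFinite m).subset ?_
  rintro l ⟨m, hm, hlt⟩
  exact Set.mem_biUnion hm hlt.le

theorem exists_costandard_envelope' (E : C) :
    ∃ (Y : C) (j : E ⟶ Y), Mono j ∧ HasFiltration H.N Y ∧ HasFiltration H.Δ (cokernel j) := by
  have hfin := H.finite_strictly_below (H.factors_finite E)
  obtain ⟨Y, j, h1, h2, h3, -⟩ := H.exists_costandard_envelope hfin.toFinset (by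
    simp only [Set.Finite.mem_toFinset]
    rintro l ⟨m, hm, hlt⟩ n hn
    exact ⟨m, hm, hn.trans hlt⟩) E (fun l hl => H.ext_one_standard fun m hm hlt =>
      hl (by simpa using ⟨m, hm, hlt⟩))
  exact ⟨Y, j, h1, h2, h3⟩

variable {H} in
-- Dimension shift. A class is killed by some mono Y ⟶ E, and E embeds into a costandardly filtered
-- Y'. The cokernel Y'/Y is again costandardly filtered, and the class comes from Ext one degree
-- lower with values in it, which vanishes by induction.
theorem ext_succ_of_filtrations {X Y : C} (hX : HasFiltration H.Δ X) (hY : HasFiltration H.N Y)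
    (n : ℕ) : Subsingleton (Ext X Y (n + 1)) := by
  induction n generalizing Y with
  | zero => exact H.ext_of_filtrations 1 H.ext_one hX hY
  | succ n ih =>
    refine subsingleton_of_forall_eq 0 fun α => ?_
    obtain ⟨E, j, hj, h⟩ := exists_mono_comp_eq_zero α
    obtain ⟨Y', j', hj', hY', -⟩ := H.exists_costandard_envelope' E
    have hS := shortExact_cokernel (j ≫ j')
    have h0 : α.comp (Ext.mk₀ (j ≫ j')) (add_zero _) = 0 := by
      rw [← Ext.mk₀_comp_mk₀, ← Ext.comp_assoc_of_third_deg_zero, h, Ext.zero_comp]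
    obtain ⟨β, rfl⟩ := Ext.covariant_sequence_exact₁ _ hS α h0 rfl
    have := ih (hasFiltration_N_quotient hS hY hY')
    rw [Subsingleton.elim β 0, Ext.zero_comp]

end HighestWeightCategory

/-! ### Fitting's lemma in finite-dimensional algebras. -/

section Fitting

/-- For large exponents R is the direct sum of the kernel and the range of left multiplication by
the power of x. Writing 1 = a + b accordingly, ab = b - b² lies in both parts, so b is idempotent.
The exponent is taken positive so that a factor x can be peeled off. -/
theorem exists_fitting_idempotent (k : Type*) [Field k] {R : Type*} [Ring R] [Algebra k R]
    [Module.Finite k R] (x : R) :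
    ∃ (n : ℕ) (y : R), (x ^ (n + 1) * y) * (x ^ (n + 1) * y) = x ^ (n + 1) * y ∧
      x ^ (n + 1) = x ^ (n + 1) * (x ^ (n + 1) * y) := by
  obtain ⟨n, hn⟩ := Filter.eventually_atTop.1
    (LinearMap.eventually_isCompl_ker_pow_range_pow (LinearMap.mulLeft k x))
  have h := hn (n + 1) (by omega)
  rw [LinearMap.pow_mulLeft] at h
  obtain ⟨a, ha, b, ⟨y, hy⟩, hab⟩ := Submodule.mem_sup.1
    (h.codisjoint.eq_top ▸ Submodule.mem_top : (1 : R) ∈ _)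
  rw [LinearMap.mem_ker, LinearMap.mulLeft_apply] at ha
  rw [LinearMap.mulLeft_apply] at hy
  refine ⟨n, y, ?_, ?_⟩
  · rw [hy]
    have h1 : a * b = b - b * b := by
      rw [eq_sub_iff_add_eq, ← add_mul, hab, one_mul]
    have h2 : a * b = 0 := by
      refine (Submodule.disjoint_def.1 h.disjoint) _ ?_ ?_
      · rw [LinearMap.mem_ker, LinearMap.mulLeft_apply, ← mul_assoc, ha, zero_mul]
      · rw [h1]
        exact Submodule.sub_mem _ ⟨y, hy⟩ ⟨y * b, by
          rw [LinearMap.mulLeft_apply, ← mul_assoc, hy]⟩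
    rw [h2] at h1
    exact (sub_eq_zero.1 h1.symm).symm
  · rw [hy]
    calc x ^ (n + 1) = x ^ (n + 1) * (a + b) := by rw [hab, mul_one]
      _ = x ^ (n + 1) * b := by rw [mul_add, ha, zero_add]

/-- If all y f were nilpotent, all 1 + y f would be units, which characterises the radical. -/
theorem exists_not_isNilpotent_of_notMem_jacobson {R : Type*} [Ring R] {f : R}
    (hf : f ∉ Ring.jacobson R) : ∃ y, ¬ IsNilpotent (y * f) := by
  by_contra! h
  rw [← Ideal.jacobson_bot] at hf
  refine hf (Ideal.mem_jacobson_iff.2 fun y => ?_)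
  have hu : IsUnit (1 + y * f) := (h y).isUnit_one_add
  obtain ⟨z, hz⟩ := hu.exists_left_inv
  refine ⟨z, ?_⟩
  rw [Ideal.mem_bot, mul_assoc, sub_eq_zero, ← hz, mul_add, mul_one, add_comm]

end Fitting

/-! ### Idempotents and direct summands. -/

section Retracts

variable {k : Type t} [Field k] {C : Type u} [Category.{v} C] [Abelian C] [Linear k C]

/-- The map End(A) → End(M), f ↦ r f i, is injective, and it can hit the identity only if r ≫ i is
the identity. This dimension is the termination measure whenever summands are split off. -/
theorem finrank_end_lt_of_retract {A M : C} (i : A ⟶ M) (r : M ⟶ A) (h : i ≫ r = 𝟙 A)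
    (hne : r ≫ i ≠ 𝟙 M) [Module.Finite k (M ⟶ M)] :
    Module.finrank k (A ⟶ A) < Module.finrank k (M ⟶ M) := by
  let φ : (A ⟶ A) →ₗ[k] (M ⟶ M) := (Linear.leftComp k M r) ∘ₗ (Linear.rightComp k A i)
  have hφ : ∀ f, φ f = r ≫ f ≫ i := fun f => rfl
  have hinj : Function.Injective φ := fun f g hfg => by
    have h1 : i ≫ φ f ≫ r = i ≫ φ g ≫ r := by rw [hfg]
    simpa [hφ, h, reassoc_of% h] using h1
  rw [← LinearMap.finrank_range_of_inj hinj]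
  refine Submodule.finrank_lt fun htop => hne ?_
  obtain ⟨f, hf⟩ := LinearMap.range_eq_top.1 htop (𝟙 M)
  rw [hφ] at hf
  calc r ≫ i = r ≫ i ≫ (r ≫ f ≫ i) := by rw [hf, Category.comp_id]
    _ = 𝟙 M := by rw [reassoc_of% h, hf]

theorem exists_complement {A M : C} (i : A ⟶ M) (r : M ⟶ A) (h : i ≫ r = 𝟙 A) :
    ∃ (B : C) (j : B ⟶ M) (q : M ⟶ B), j ≫ q = 𝟙 B ∧ i ≫ q = 0 ∧ j ≫ r = 0 ∧
      r ≫ i + q ≫ j = 𝟙 M := by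
  obtain ⟨B, j, q, hjq, hqj⟩ := IsIdempotentComplete.idempotents_split M (𝟙 M - r ≫ i)
    (by simp [reassoc_of% h])
  refine ⟨B, j, q, hjq, ?_, ?_, by rw [hqj]; abel⟩
  · rw [← Category.comp_id q, ← hjq, ← Category.assoc q j, hqj]
    simp [reassoc_of% h]
  · have h1 : j = j ≫ q ≫ j := by rw [reassoc_of% hjq]
    rw [h1, hqj]
    simp [h]

theorem eq_zero_or_eq_id_of_indecomposable {X : C} (hX : Indecomposable X) {e : X ⟶ X}
    (he : e ≫ e = e) : e = 0 ∨ e = 𝟙 X := by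
  obtain ⟨A, i, r, hir, hri⟩ := IsIdempotentComplete.idempotents_split X e he
  obtain ⟨B, j, q, hjq, hiq, hjr, hsum⟩ := exists_complement i r hir
  let φ : X ≅ A ⊞ B :=
    { hom := biprod.lift r q
      inv := biprod.desc i j
      hom_inv_id := by simp [hsum]
      inv_hom_id := by ext <;> simp [hir, hjq, hiq, hjr] }
  rcases hX.2 A B φ with h | h
  · left; rw [← hri, h.eq_of_src i 0, comp_zero]
  · right; rw [← hri, ← hsum, h.eq_of_src j 0, comp_zero, add_zero]

theorem isIso_of_not_isNilpotent {X : C} (hX : Indecomposable X) [Module.Finite k (X ⟶ X)]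
    {u : End X} (hu : ¬ IsNilpotent u) : IsIso u := by
  have : Module.Finite k (End X) := ‹Module.Finite k (X ⟶ X)›
  obtain ⟨n, y, h1, h2⟩ := exists_fitting_idempotent k u
  rcases eq_zero_or_eq_id_of_indecomposable hX h1 with h | h
  · exact absurd ⟨n + 1, by rw [h2, h]; exact mul_zero _⟩ hu
  · have h3 : u * (u ^ n * y) = 1 := by rw [← mul_assoc, ← pow_succ']; exact h
    have := IsArtinianRing.of_finite k (End X)
    exact (isUnit_iff_isIso u).1 (IsUnit.of_mul_eq_one _ h3)

/-- An endomorphism outside the radical induces an isomorphism on a nonzero summand. -/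
theorem exists_retract_of_notMem_jacobson (k : Type t) [Field k] [Linear k C] {Z : C} {f : End Z}
    [Module.Finite k (Z ⟶ Z)]
    (hf : f ∉ Ring.jacobson (End Z)) :
    ∃ (S : C) (s : S ⟶ Z) (r : Z ⟶ S), ¬ IsZero S ∧ s ≫ f ≫ r = 𝟙 S := by
  have : Module.Finite k (End Z) := ‹Module.Finite k (Z ⟶ Z)›
  obtain ⟨y, hy⟩ := exists_not_isNilpotent_of_notMem_jacobson hf
  obtain ⟨n, z, h1, h2⟩ := exists_fitting_idempotent k (y * f)
  set e : End Z := (y * f) ^ (n + 1) * z with he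
  -- Multiplication in `End` is composition in reverse order, so e is z, then f, then a power of y f
  -- times y. The nonzero idempotent e thus factors through f, and S is its image.
  have he' : (End.asHom e) = End.asHom z ≫ f ≫ End.asHom ((y * f) ^ n * y) := by
    have h3 : e = (y * f) ^ n * y * (f * z) := by rw [he, pow_succ]; simp only [mul_assoc]
    rw [h3]
    exact Category.assoc _ _ _
  obtain ⟨S, i, q, hiq, hqi⟩ := IsIdempotentComplete.idempotents_split Z (End.asHom e) h1
  refine ⟨S, i ≫ End.asHom z, End.asHom ((y * f) ^ n * y) ≫ q, fun hz => hy ?_, ?_⟩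
  · have h0 : e = 0 := by
      have : End.asHom e = 0 := by rw [← hqi, hz.eq_of_src i 0, comp_zero]
      exact this
    exact ⟨n + 1, by rw [h2, h0, mul_zero]⟩
  · have h3 : i ≫ End.asHom e ≫ q = 𝟙 S := by rw [← hqi]; simp [hiq]
    rw [he'] at h3
    simpa using h3

end Retracts

/-! ### Tilting objects and the multiplicity of the highest weight. -/

namespace HighestWeightCategory

variable {k : Type t} [Field k] {C : Type u} [Category.{v} C] [Abelian C] [Linear k C]
  [HasExt.{w} C] {Λ : Type s} [PartialOrder Λ] {H : HighestWeightCategory k C Λ}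

theorem IsTilting.of_retract {X M : C} (hM : H.IsTilting M) (i : X ⟶ M) (r : M ⟶ X)
    (h : i ≫ r = 𝟙 X) : H.IsTilting X :=
  ⟨hasFiltration_Δ_of_retract hM.1 i r h, hasFiltration_N_of_retract hM.2 i r h⟩

theorem IsTilting.of_iso {X Y : C} (hX : H.IsTilting X) (e : X ≅ Y) : H.IsTilting Y :=
  hX.of_retract e.inv e.hom e.inv_hom_id

theorem IsTilting.of_isZero {X : C} (hX : IsZero X) : H.IsTilting X :=
  ⟨.zero hX, .zero hX⟩

theorem IsTilting.biprod {X Y : C} (hX : H.IsTilting X) (hY : H.IsTilting Y) :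
    H.IsTilting (X ⊞ Y) :=
  ⟨.of_shortExact (shortExact_biprod X Y) hX.1 hY.1,
    .of_shortExact (shortExact_biprod X Y) hX.2 hY.2⟩

variable (H)

/-- Choose c so that u and c agree after Δ_l → L_l → ∇_l. Then u - c lands in the kernel of p, which
does not have L_l as a factor, so it vanishes. -/
theorem exists_smul_of_end_standard (l : Λ) (u : H.Δ l ⟶ H.Δ l) : ∃ c : k, u = c • 𝟙 _ := by
  obtain ⟨c, hc⟩ := H.exists_smul_of_standard_costandard l (u ≫ H.p l ≫ H.i l)
  have := (H.injectiveHull l).mono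
  have h1 : (u - c • 𝟙 _) ≫ H.p l = 0 := by
    rw [← cancel_mono (H.i l)]
    simp [hc]
  refine ⟨c, sub_eq_zero.1 ?_⟩
  rw [← kernel.lift_ι (H.p l) _ h1]
  have h2 : kernel.lift (H.p l) _ h1 = 0 := by
    by_contra h
    exact lt_irrefl l (H.factors_kernel_p l (H.mem_factors_of_standard_hom h))
  rw [h2, zero_comp]

theorem mem_factors_standard (l : Λ) : l ∈ H.factors (H.Δ l) :=
  ⟨H.Δ l, 𝟙 _, H.p l, inferInstance, (H.projectiveCover l).epi⟩

theorem standard_not_isZero (l : Λ) : ¬ IsZero (H.Δ l) := fun h =>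
  H.p_ne_zero l (h.eq_of_src _ _)

theorem factors_of_hasFiltration_Δ {X : C} (hX : HasFiltration H.Δ X) :
    H.factors X ⊆ {l | ∃ m ∈ H.supp X, l ≤ m} := by
  induction hX with
  | zero h0 => rw [H.factors_zero h0]; exact Set.empty_subset _
  | @step E hE hX m e ih =>
    obtain ⟨e⟩ := e
    have := hE.epi_g
    rw [H.factors_middle hE]
    refine Set.union_subset (fun l hl => ?_) (fun l hl => ?_)
    · obtain ⟨n, hn, hle⟩ := ih hl
      exact ⟨n, H.supp_of_mono hE ((HasFiltration.of_mem m).of_iso e.symm) hn, hle⟩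
    · rw [H.factors_of_iso e] at hl
      exact ⟨m, H.supp_of_epi (E.g ≫ e.hom) ⟨_, H.p_comp_i_ne_zero m⟩, H.factors_standard m hl⟩

theorem finrank_hom_middle (H : HighestWeightCategory k C Λ) {S : ShortComplex C} (hS : S.ShortExact) {X : C}
    (h : Subsingleton (Ext X S.X₁ 1)) :
    Module.finrank k (X ⟶ S.X₂) = Module.finrank k (X ⟶ S.X₁) + Module.finrank k (X ⟶ S.X₃) := by
  have := hS.mono_f
  have := H.finite_hom X S.X₂
  let φ := Linear.rightComp k X S.g
  have h1 := LinearMap.finrank_range_add_finrank_ker φ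
  have hsurj : Function.Surjective φ := fun f => exists_lift_of_ext hS h f
  rw [LinearMap.range_eq_top.2 hsurj, finrank_top] at h1
  let ψ := Linear.rightComp k X S.f
  have hker : LinearMap.ker φ = LinearMap.range ψ := by
    ext f
    rw [LinearMap.mem_ker, LinearMap.mem_range]
    constructor
    · intro hf
      exact ⟨hS.exact.lift f hf, hS.exact.lift_f f hf⟩
    · rintro ⟨g, rfl⟩
      simp [φ, ψ]
  have hinj : Function.Injective ψ := fun f g hfg => (cancel_mono S.f).1 hfg
  rw [hker, LinearMap.finrank_range_of_inj hinj] at h1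
  omega

theorem finrank_standard_L (l : Λ) : Module.finrank k (H.Δ l ⟶ H.L l) = 1 := by
  rw [finrank_eq_one_iff']
  refine ⟨H.p l, H.p_ne_zero l, fun f => ?_⟩
  obtain ⟨c, hc⟩ := H.exists_smul_of_standard_costandard l (f ≫ H.i l)
  have := (H.injectiveHull l).mono
  refine ⟨c, ?_⟩
  rw [← cancel_mono (H.i l), hc, Linear.smul_comp]

/-- On objects with all factors ≤ l, Hom(Δ_l, -) is exact; it is one-dimensional on L_l and zero on
the other simple objects. -/
theorem finrank_eq_of_compositionMultiplicity {l : Λ} {M : C} {n : ℕ}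
    (h : CompositionMultiplicity (H.L l) M n) (hM : H.factors M ⊆ Set.Iic l) :
    Module.finrank k (H.Δ l ⟶ M) = n := by
  induction h with
  | zero h0 =>
    have : Subsingleton (H.Δ l ⟶ _) := ⟨fun f g => h0.eq_of_tgt f g⟩
    exact Module.finrank_zero_of_subsingleton
  | @same E n hE hs h e ih =>
    obtain ⟨e⟩ := e
    rw [H.factors_middle hE] at hM
    have h1 := Set.subset_union_left.trans hM
    rw [H.finrank_hom_middle hE (H.ext_one_standard fun m hm hlt => hlt.not_ge (h1 hm)), ih h1,
      LinearEquiv.finrank_eq (Linear.homCongr k (Iso.refl _) e), H.finrank_standard_L]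
  | @other E n hE hs h e ih =>
    rw [H.factors_middle hE] at hM
    have h1 := Set.subset_union_left.trans hM
    rw [H.finrank_hom_middle hE (H.ext_one_standard fun m hm hlt => hlt.not_ge (h1 hm)), ih h1]
    have : Subsingleton (H.Δ l ⟶ E.X₃) := by
      refine subsingleton_of_forall_eq 0 fun f => ?_
      by_contra hf
      obtain ⟨m, ⟨e'⟩⟩ := H.exists_iso _ hs
      have h2 := H.mem_factors_of_standard_hom hf
      rw [H.factors_of_iso e', H.factors_L, Set.mem_singleton_iff] at h2
      subst h2
      exact e.elim' e'
    rw [Module.finrank_zero_of_subsingleton, add_zero]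

end HighestWeightCategory

/-! ### Existence of composition multiplicities. -/

section CompositionSeries

variable {C : Type u} [Category.{v} C] [Abelian C]

theorem CompositionMultiplicity.of_iso {S X Y : C} {n : ℕ} (h : CompositionMultiplicity S X n)
    (e : X ≅ Y) : CompositionMultiplicity S Y n := by
  have key : ∀ E : ShortComplex C, E.ShortExact → ∀ e : E.X₂ ≅ Y,
      (ShortComplex.mk (E.f ≫ e.hom) (e.inv ≫ E.g) (by simp)).ShortExact := fun E hE e =>
    ShortComplex.shortExact_of_iso
      (ShortComplex.isoMk (S₁ := E) (S₂ := ShortComplex.mk (E.f ≫ e.hom) (e.inv ≫ E.g) (by simp))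
        (Iso.refl _) e (Iso.refl _) (by simp) (by simp)) hE
  cases h with
  | zero h => exact .zero (h.of_iso e.symm)
  | same hE hs h e' => exact .same (key _ hE e) hs h e'
  | other hE hs h e' => exact .other (key _ hE e) hs h e'

theorem CompositionMultiplicity.extension {S Z : C} {n : ℕ} (h₃ : CompositionMultiplicity S Z n)
    {X Y : C} {m : ℕ} {f : X ⟶ Y} {g : Y ⟶ Z} (w : f ≫ g = 0)
    (hS : (ShortComplex.mk f g w).ShortExact) (h₁ : CompositionMultiplicity S X m) :
    CompositionMultiplicity S Y (m + n) := by
  have key : ∀ {Y : C} (E : ShortComplex C) (_ : E.ShortExact) {f : X ⟶ Y} {g : Y ⟶ E.X₂}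
      (w : f ≫ g = 0) (_ : (ShortComplex.mk f g w).ShortExact),
      ∃ (Y' : C) (f' : X ⟶ Y') (g' : Y' ⟶ E.X₁) (w' : f' ≫ g' = 0) (j : Y' ⟶ Y)
        (wj : j ≫ g ≫ E.g = 0), (ShortComplex.mk f' g' w').ShortExact ∧
        (ShortComplex.mk j (g ≫ E.g) wj).ShortExact := by
    intro Y E hE f g w hS
    have := hE.epi_g
    have := hS.epi_g
    dsimp at this
    obtain ⟨w₁, g', w', hex, -⟩ := exists_shortExact_kernel_comp hS E.g
    let e : kernel E.g ≅ E.X₁ := IsLimit.conePointUniqueUpToIso (kernelIsKernel _) hE.fIsKernel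
    exact ⟨_, kernel.lift (g ≫ E.g) f w₁, g' ≫ e.hom, by rw [← Category.assoc, w', zero_comp],
      kernel.ι _, kernel.condition _, ShortComplex.shortExact_of_iso
        (ShortComplex.isoMk (S₁ := ShortComplex.mk _ g' w') (Iso.refl _) (Iso.refl _) e
          (by simp) (by simp)) hex, shortExact_kernel (g ≫ E.g)⟩
  induction h₃ generalizing Y with
  | zero h =>
    have : IsIso f := (hS.isIso_f_iff).2 h
    exact h₁.of_iso (asIso f)
  | same hE hs h e ih =>
    obtain ⟨Y', f', g', w', j, wj, h1, h2⟩ := key _ hE w hS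
    exact .same h2 hs (ih w' h1) e
  | other hE hs h e ih =>
    obtain ⟨Y', f', g', w', j, wj, h1, h2⟩ := key _ hE w hS
    exact .other h2 hs (ih w' h1) e

open ZeroObject in
theorem exists_compositionMultiplicity
    (hlen : ∀ X : C, IsNoetherianObject X ∧ IsArtinianObject X) (S X : C) :
    ∃ n, CompositionMultiplicity S X n := by
  let P : ObjectProperty C := fun X => ∃ n, CompositionMultiplicity S X n
  have : P.IsClosedUnderIsomorphisms := ⟨fun e ⟨n, hn⟩ => ⟨n, hn.of_iso e⟩⟩
  have : P.IsClosedUnderExtensions := ⟨fun {E} hE ⟨m, hm⟩ ⟨n, hn⟩ =>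
    ⟨m + n, hn.extension E.zero hE hm⟩⟩
  refine devissage hlen P (fun X hX => ⟨0, .zero hX⟩) (fun X hX => ?_) X
  have hE : (ShortComplex.mk (0 : (0 : C) ⟶ X) (𝟙 X) (by simp)).ShortExact :=
    (ShortComplex.Splitting.ofIsZeroOfIsIso _ (isZero_zero C) inferInstance).shortExact
  by_cases h : Nonempty (X ≅ S)
  · exact ⟨1, .same hE hX (.zero (isZero_zero C)) h⟩
  · exact ⟨0, .other hE hX (.zero (isZero_zero C)) (not_nonempty_iff.1 h)⟩

end CompositionSeries

/-- Allows M to be replaced by a summand containing the image of f while the cokernel stays a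
summand of the old one, so that it keeps its standard filtration. -/
theorem retract_cokernel {C : Type u} [Category.{v} C] [Abelian C] {A M D : C} {f : D ⟶ M}
    (i : A ⟶ M) (r : M ⟶ A) (h : i ≫ r = 𝟙 A)
    (hf : f ≫ r ≫ i = f) :
    ∃ (i' : cokernel (f ≫ r) ⟶ cokernel f) (r' : cokernel f ⟶ cokernel (f ≫ r)),
      i' ≫ r' = 𝟙 _ := by
  refine ⟨cokernel.desc _ (i ≫ cokernel.π f) ?_,
    cokernel.desc _ (r ≫ cokernel.π (f ≫ r)) ?_, ?_⟩
  · rw [Category.assoc, ← Category.assoc r, ← Category.assoc f, hf, cokernel.condition]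
  · rw [← Category.assoc, cokernel.condition]
  · rw [← cancel_epi (cokernel.π (f ≫ r))]
    simp [reassoc_of% h]

/-! ### Indecomposable tilting objects. -/

namespace HighestWeightCategory

variable {k : Type t} [Field k] {C : Type u} [Category.{v} C] [Abelian C] [Linear k C]
  [HasExt.{w} C] {Λ : Type s} [PartialOrder Λ] (H : HighestWeightCategory k C Λ)

/-- An embedding `Δ_l ⟶ M` whose cokernel has a standard filtration. -/
structure IsStandardEmbedding {l : Λ} {M : C} (f : H.Δ l ⟶ M) : Prop where
  mono : Mono f
  cokernel : HasFiltration H.Δ (cokernel f)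

/-- Existence of the indecomposable tilting objects. -/
theorem exists_isIndecomposableTilting (l : Λ) : ∃ M : C, H.IsIndecomposableTilting l M := by
  classical
  -- The object is found among tilting objects containing Δ_l with cokernel filtered by smaller
  -- standard objects, as one with the smallest endomorphism algebra.
  let P : ℕ → Prop := fun n => ∃ (M : C) (f : H.Δ l ⟶ M), Mono f ∧ H.IsTilting M ∧
    HasFiltration H.Δ (cokernel f) ∧ H.supp (cokernel f) ⊆ Set.Iio l ∧
    Module.finrank k (M ⟶ M) = n
  have hP : ∃ n, P n := by
    have hfin : (Set.Iio l).Finite := (H.lowerFinite l).subset Set.Iio_subset_Iic_self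
    obtain ⟨Y, j, h1, h2, h3, h4⟩ := H.exists_costandard_envelope hfin.toFinset (by
      simp only [Set.Finite.mem_toFinset, Set.mem_Iio]
      exact fun a ha b hb => hb.trans ha) (H.Δ l) (fun m hm => H.ext_one_standard fun n hn hlt => by
        simp only [Set.Finite.mem_toFinset, Set.mem_Iio] at hm
        exact hm (hlt.trans_le (H.factors_standard l hn)))
    exact ⟨_, Y, j, h1, ⟨.of_shortExact (shortExact_cokernel j) (.of_mem l) h3, h2⟩, h3,
      by simpa using h4, rfl⟩
  obtain ⟨M, f, hf, hM, hc, hsupp, hd⟩ := Nat.find_spec hP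
  have hS := shortExact_cokernel f
  have hcf : H.factors (cokernel f) ⊆ Set.Iio l := fun m hm => by
    obtain ⟨n, hn, hle⟩ := H.factors_of_hasFiltration_Δ hc hm
    exact lt_of_le_of_lt hle (hsupp hn)
  have hMf : H.factors M ⊆ Set.Iic l := by
    rw [H.factors_middle hS]
    exact Set.union_subset (H.factors_standard l) (hcf.trans Set.Iio_subset_Iic_self)
  have hspan : ∀ g : H.Δ l ⟶ M, ∃ c : k, g = c • f := fun g => by
    have h0 : g ≫ cokernel.π f = 0 := by
      by_contra h
      exact lt_irrefl l (hcf (H.mem_factors_of_standard_hom h))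
    obtain ⟨c, hc⟩ := H.exists_smul_of_end_standard l (Abelian.monoLift f g h0)
    refine ⟨c, ?_⟩
    rw [← Abelian.monoLift_comp f g h0, hc, Linear.smul_comp, Category.id_comp]
  have hfne : f ≠ 0 := fun h => H.standard_not_isZero l (IsZero.of_mono_eq_zero f h)
  -- By minimality no proper summand of M contains the image of f.
  have hmin : ∀ (A : C) (i : A ⟶ M) (r : M ⟶ A), i ≫ r = 𝟙 A → f ≫ r ≫ i = f → r ≫ i = 𝟙 M := by
    intro A i r hir hfri
    by_contra hne
    have := H.finite_hom M M
    obtain ⟨i', r', hir'⟩ := retract_cokernel i r hir hfri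
    have hmono : Mono (f ≫ r) := by
      have : Mono ((f ≫ r) ≫ i) := by rw [Category.assoc, hfri]; exact hf
      exact mono_of_mono _ i
    have : Epi r' := epi_of_epi_fac hir'
    have hlt := finrank_end_lt_of_retract (k := k) i r hir hne
    rw [hd] at hlt
    exact Nat.find_min hP hlt ⟨A, f ≫ r, hmono, hM.of_retract i r hir,
      hasFiltration_Δ_of_retract hc i' r' hir', (H.supp_of_epi r').trans hsupp, rfl⟩
  refine ⟨M, ⟨fun h => hfne (h.eq_of_tgt _ _), fun A B e => ?_⟩, hM,
    (H.mem_serreClosure_iff _ _).2 hMf, ?_⟩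
  -- Hom(Δ_l, M) is spanned by f, so the projector to A acts on f by a scalar c with c² = c. Hence f
  -- lies entirely in B or entirely in A, and the other summand is zero.
  · obtain ⟨c, hc⟩ := hspan (f ≫ e.hom ≫ biprod.fst ≫ biprod.inl ≫ e.inv)
    have hcc : c • c • f = c • f := by
      rw [← hc, ← Linear.smul_comp, ← hc]; simp
    rw [smul_smul] at hcc
    have hcc' : c * c = c := smul_left_injective k hfne hcc
    rcases IsIdempotentElem.iff_eq_zero_or_one.1 hcc' with h | h
    · left
      have h1 : f ≫ e.hom ≫ biprod.snd ≫ biprod.inr ≫ e.inv = f := by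
        have h2 : f ≫ e.hom ≫ (biprod.fst ≫ biprod.inl + biprod.snd ≫ biprod.inr) ≫ e.inv = f := by
          rw [biprod.total]; simp
        rw [Preadditive.add_comp, Preadditive.comp_add, Preadditive.comp_add, Category.assoc,
          Category.assoc, hc, h, zero_smul, zero_add] at h2
        exact h2
      have h3 := hmin B (biprod.inr ≫ e.inv) (e.hom ≫ biprod.snd) (by simp) (by simpa using h1)
      have h4 : (biprod.inl : A ⟶ A ⊞ B) = 0 := by
        have := (biprod.inl ≫ e.inv) ≫= h3
        simpa using this.symm
      exact IsZero.of_mono_eq_zero _ h4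
    · right
      rw [h, one_smul] at hc
      have h3 := hmin A (biprod.inl ≫ e.inv) (e.hom ≫ biprod.fst) (by simp) (by simpa using hc)
      have h4 : (biprod.inr : B ⟶ A ⊞ B) = 0 := by
        have := (biprod.inr ≫ e.inv) ≫= h3
        simpa using this.symm
      exact IsZero.of_mono_eq_zero _ h4
  · obtain ⟨n, hn⟩ := exists_compositionMultiplicity H.finiteLength (H.L l) M
    have h1 := H.finrank_eq_of_compositionMultiplicity hn hMf
    have h2 : Module.finrank k (H.Δ l ⟶ M) = 1 := by
      rw [finrank_eq_one_iff']
      exact ⟨f, hfne, fun g => (hspan g).imp fun c hc => hc.symm⟩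
    rw [h2] at h1
    rwa [← h1] at hn

/-- The bottom nonzero step of the filtration is a standard subobject, and the remaining steps
filter its cokernel. -/
theorem exists_isStandardEmbedding_of_ne {M : C} (hM : HasFiltration H.Δ M) (h0 : ¬ IsZero M) :
    ∃ (l : Λ) (f : H.Δ l ⟶ M), H.IsStandardEmbedding f := by
  induction hM with
  | zero h => exact absurd h h0
  | @step E hE h l e ih =>
    obtain ⟨e⟩ := e
    have := hE.mono_f
    by_cases hz : IsZero E.X₁
    · have := (hE.isIso_g_iff).2 hz
      exact ⟨l, e.inv ≫ inv E.g, inferInstance, .zero (isZero_cokernel_of_epi _)⟩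
    · obtain ⟨m, f, hf, hc⟩ := ih hz
      obtain ⟨w₁, u, w', hex⟩ := exists_shortExact_cokernel_comp (shortExact_cokernel f) E.f
      let e' : cokernel E.f ≅ E.X₃ :=
        IsColimit.coconePointUniqueUpToIso (cokernelIsCokernel _) hE.gIsCokernel
      exact ⟨m, f ≫ E.f, mono_comp _ _,
        .of_shortExact hex hc ((HasFiltration.of_mem l).of_iso (e.symm ≪≫ e'.symm))⟩

/-- Descend the filtration. If l is not a factor of the lower step, the top subquotient must be Δ_l,
and it splits off because Ext¹ from Δ_l to the lower step vanishes. The cokernel is then a retract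
of a standardly filtered object. -/
theorem exists_isStandardEmbedding_of_maximal {l : Λ} {M : C} (hM : HasFiltration H.Δ M)
    (hle : H.factors M ⊆ Set.Iic l) (hl : l ∈ H.factors M) :
    ∃ f : H.Δ l ⟶ M, H.IsStandardEmbedding f := by
  induction hM with
  | zero h => rw [H.factors_zero h] at hl; exact hl.elim
  | @step E hE h m e ih =>
    obtain ⟨e⟩ := e
    have := hE.mono_f
    have hfac := H.factors_middle hE
    by_cases hz : l ∈ H.factors E.X₁
    · obtain ⟨f, hf, hc⟩ := ih ((H.factors_of_mono E.f).trans hle) hz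
      obtain ⟨w₁, u, w', hex⟩ := exists_shortExact_cokernel_comp (shortExact_cokernel f) E.f
      let e' : cokernel E.f ≅ E.X₃ :=
        IsColimit.coconePointUniqueUpToIso (cokernelIsCokernel _) hE.gIsCokernel
      exact ⟨f ≫ E.f, mono_comp _ _,
        .of_shortExact hex hc ((HasFiltration.of_mem m).of_iso (e.symm ≪≫ e'.symm))⟩
    · have hE₂ : HasFiltration H.Δ E.X₂ := .step hE h m ⟨e⟩
      have h3 : l ∈ H.factors E.X₃ := by
        rw [hfac] at hl; exact hl.resolve_left hz
      rw [hfac, H.factors_of_iso e] at hle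
      rw [H.factors_of_iso e] at h3
      obtain rfl : l = m := le_antisymm (H.factors_standard m h3)
        (hle (Or.inr (H.mem_factors_standard m)))
      obtain ⟨f, hf⟩ := exists_lift_of_ext hE (H.ext_one_standard fun n hn hlt =>
        hlt.not_ge (hle (Or.inl hn))) e.inv
      have hfr : f ≫ E.g ≫ e.hom = 𝟙 _ := by rw [← Category.assoc, hf, e.inv_hom_id]
      refine ⟨f, mono_of_mono_fac hfr, ?_⟩
      let σ : cokernel f ⟶ E.X₂ := cokernel.desc f (𝟙 _ - (E.g ≫ e.hom) ≫ f) (by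
        rw [Preadditive.comp_sub, Category.comp_id, ← Category.assoc, hfr, Category.id_comp,
          sub_self])
      refine hasFiltration_Δ_of_retract hE₂ σ (cokernel.π f) ?_
      rw [← cancel_epi (cokernel.π f)]
      simp [σ]

variable {H}

namespace IsIndecomposableTilting

variable {l : Λ} {M : C}

theorem factors_subset (hM : H.IsIndecomposableTilting l M) : H.factors M ⊆ Set.Iic l :=
  (H.mem_serreClosure_iff _ _).1 hM.mem

theorem finrank_hom (hM : H.IsIndecomposableTilting l M) :
    Module.finrank k (H.Δ l ⟶ M) = 1 :=
  H.finrank_eq_of_compositionMultiplicity hM.multiplicity hM.factors_subset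

theorem mem_factors (hM : H.IsIndecomposableTilting l M) : l ∈ H.factors M := by
  have h := hM.finrank_hom
  have : Nontrivial (H.Δ l ⟶ M) := Module.nontrivial_of_finrank_pos (R := k) (by omega)
  obtain ⟨f, hf⟩ := exists_ne (0 : H.Δ l ⟶ M)
  exact H.mem_factors_of_standard_hom hf

theorem exists_isStandardEmbedding (hM : H.IsIndecomposableTilting l M) :
    ∃ f : H.Δ l ⟶ M, H.IsStandardEmbedding f :=
  H.exists_isStandardEmbedding_of_maximal hM.tilting.1 hM.factors_subset hM.mem_factors

theorem exists_smul (hM : H.IsIndecomposableTilting l M)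
    {f : H.Δ l ⟶ M} (hf : H.IsStandardEmbedding f) (g : H.Δ l ⟶ M) :
    ∃ c : k, c • f = g := by
  have hne : f ≠ 0 := fun h => H.standard_not_isZero l (have := hf.mono; IsZero.of_mono_eq_zero f h)
  exact (finrank_eq_one_iff_of_nonzero' f hne).1 hM.finrank_hom g

/-- As Hom(Δ_l, M) is a line, u acts on f by a scalar, here nonzero. So u is not nilpotent, and
Fitting's lemma applies to the indecomposable M. -/
theorem isIso_of_comp_ne_zero (hM : H.IsIndecomposableTilting l M)
    {f : H.Δ l ⟶ M} (hf : H.IsStandardEmbedding f) {u : M ⟶ M}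
    (hu : f ≫ u ≠ 0) : IsIso u := by
  have := H.finite_hom M M
  refine isIso_of_not_isNilpotent (k := k) hM.indecomposable (u := End.of u) ?_
  rintro ⟨n, hn⟩
  obtain ⟨c, hc⟩ := hM.exists_smul hf (f ≫ u)
  have hne : f ≠ 0 := by rintro rfl; exact hu zero_comp
  have hpow : ∀ n : ℕ, f ≫ End.asHom (End.of u ^ n) = c ^ n • f := fun n => by
    induction n with
    | zero => simp
    | succ n ih =>
      rw [pow_succ', End.mul_def, ← Category.assoc]
      change (f ≫ End.asHom (End.of u ^ n)) ≫ u = _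
      rw [ih, Linear.smul_comp, ← hc, smul_smul, pow_succ]
  have h1 := hpow n
  rw [hn] at h1
  have h2 : c ^ n • f = 0 := h1.symm.trans comp_zero
  rcases smul_eq_zero.1 h2 with h3 | h3
  · exact hu (by rw [← hc, eq_zero_of_pow_eq_zero h3, zero_smul])
  · exact hne h3

end IsIndecomposableTilting

/-- A tilting object into which `Δ_l` embeds nicely has the indecomposable tilting object of
highest weight `l` as a direct summand. -/
theorem IsIndecomposableTilting.exists_retract {l : Λ} {T M : C}
    (hT : H.IsIndecomposableTilting l T) (hM : H.IsTilting M) {f : H.Δ l ⟶ M}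
    (hf : H.IsStandardEmbedding f) : ∃ (i : T ⟶ M) (r : M ⟶ T), i ≫ r = 𝟙 T := by
  obtain ⟨j, hj⟩ := hT.exists_isStandardEmbedding
  have := hf.mono
  have := hj.mono
  -- Each of the two embeddings of Δ_l extends along the other, as Ext¹ from standardly filtered
  -- cokernels to tilting objects vanishes. The composite a ≫ b fixes j, hence is invertible.
  obtain ⟨a, ha⟩ := exists_desc_of_ext (shortExact_cokernel j)
    (ext_succ_of_filtrations hj.cokernel hM.2 0) f
  obtain ⟨b, hb⟩ := exists_desc_of_ext (shortExact_cokernel f)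
    (ext_succ_of_filtrations hf.cokernel hT.tilting.2 0) j
  dsimp at ha hb
  have hjne : j ≠ 0 := fun h => H.standard_not_isZero l (IsZero.of_mono_eq_zero j h)
  have hiso : IsIso (a ≫ b) := hT.isIso_of_comp_ne_zero hj (by
    rw [← Category.assoc, ha, hb]; exact hjne)
  exact ⟨a, b ≫ inv (a ≫ b), by rw [← Category.assoc, IsIso.hom_inv_id]⟩

theorem eq_of_iso_indecomposableTilting {l m : Λ} {M N : C} (hM : H.IsIndecomposableTilting l M)
    (hN : H.IsIndecomposableTilting m N) (e : M ≅ N) : l = m := by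
  have h := H.factors_of_iso e
  exact le_antisymm (hN.factors_subset (h ▸ hM.mem_factors))
    (hM.factors_subset (h ▸ hN.mem_factors))

end HighestWeightCategory

/-! ### Decompositions into members of a family, with multiplicities. -/

section Decompositions

variable {C : Type u} [Category.{v} C] [Abelian C] {Λ : Type s}

/-- `M` is a finite direct sum of objects `T l`, each of which occurs `m l` times. -/
def Decomposes (T : Λ → C) (M : C) (m : Λ → ℕ) : Prop :=
  ∃ (J : Type) (_ : Fintype J) (γ : J → Λ) (ι : ∀ j, T (γ j) ⟶ M) (π : ∀ j, M ⟶ T (γ j)),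
    (∀ j, ι j ≫ π j = 𝟙 _) ∧ (∀ j j', j ≠ j' → ι j ≫ π j' = 0) ∧ ∑ j, π j ≫ ι j = 𝟙 M ∧
    ∀ l, Nat.card {j // γ j = l} = m l

variable {T : Λ → C}

theorem Decomposes.of_isZero {M : C} (hM : IsZero M) : Decomposes T M 0 :=
  ⟨Empty, inferInstance, Empty.elim, fun j => j.elim, fun j => j.elim, fun j => j.elim,
    fun j => j.elim, hM.eq_of_src _ _, fun l => by simp⟩

theorem Decomposes.self [DecidableEq Λ] (l : Λ) : Decomposes T (T l) (Pi.single l 1) := by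
  refine ⟨Unit, inferInstance, fun _ => l, fun _ => 𝟙 _, fun _ => 𝟙 _, by simp, by simp, by simp,
    fun n => ?_⟩
  by_cases h : l = n
  · subst h; simp
  · have : IsEmpty {j : Unit // l = n} := ⟨fun j => h j.2⟩
    rw [Nat.card_of_isEmpty, Pi.single_eq_of_ne (Ne.symm h)]

theorem Decomposes.add {A B M : C} {m n : Λ → ℕ} (hA : Decomposes T A m) (hB : Decomposes T B n)
    {i : A ⟶ M} {r : M ⟶ A} {j : B ⟶ M} {q : M ⟶ B} (hir : i ≫ r = 𝟙 A) (hjq : j ≫ q = 𝟙 B)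
    (hiq : i ≫ q = 0) (hjr : j ≫ r = 0) (hsum : r ≫ i + q ≫ j = 𝟙 M) :
    Decomposes T M (m + n) := by
  obtain ⟨J, _, γ, ι, π, h1, h2, h3, h4⟩ := hA
  obtain ⟨J', _, γ', ι', π', h1', h2', h3', h4'⟩ := hB
  refine ⟨J ⊕ J', inferInstance, Sum.elim γ γ',
    Sum.rec (fun x => ι x ≫ i) (fun x => ι' x ≫ j),
    Sum.rec (fun x => r ≫ π x) (fun x => q ≫ π' x), ?_, ?_, ?_, ?_⟩
  · rintro (x | x)
    · simp [reassoc_of% hir, h1]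
    · simp [reassoc_of% hjq, h1']
  · rintro (x | x) (y | y) hxy
    · change (ι x ≫ i) ≫ r ≫ π y = (0 : T (γ x) ⟶ T (γ y))
      rw [Category.assoc, reassoc_of% hir, h2 x y (fun h => hxy (by rw [h]))]
    · change (ι x ≫ i) ≫ q ≫ π' y = (0 : T (γ x) ⟶ T (γ' y))
      rw [Category.assoc, reassoc_of% hiq, zero_comp, comp_zero]
    · change (ι' x ≫ j) ≫ r ≫ π y = (0 : T (γ' x) ⟶ T (γ y))
      rw [Category.assoc, reassoc_of% hjr, zero_comp, comp_zero]
    · change (ι' x ≫ j) ≫ q ≫ π' y = (0 : T (γ' x) ⟶ T (γ' y))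
      rw [Category.assoc, reassoc_of% hjq, h2' x y (fun h => hxy (by rw [h]))]
  · rw [Fintype.sum_sum_type, ← hsum]
    congr 1
    · calc _ = r ≫ (∑ x, π x ≫ ι x) ≫ i := by
            simp [Preadditive.sum_comp, Preadditive.comp_sum]
        _ = _ := by rw [h3, Category.id_comp]
    · calc _ = q ≫ (∑ x, π' x ≫ ι' x) ≫ j := by
            simp [Preadditive.sum_comp, Preadditive.comp_sum]
        _ = _ := by rw [h3', Category.id_comp]
  · intro l
    rw [Pi.add_apply, ← h4, ← h4', ← Nat.card_sum]
    exact Nat.card_congr Equiv.subtypeSum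

theorem Decomposes.of_iso {M N : C} {m : Λ → ℕ} (hM : Decomposes T M m) (e : M ≅ N) :
    Decomposes T N m := by
  obtain ⟨J, _, γ, ι, π, h1, h2, h3, h4⟩ := hM
  refine ⟨J, inferInstance, γ, fun j => ι j ≫ e.hom, fun j => e.inv ≫ π j, by simpa using h1,
    by simpa using h2, ?_, h4⟩
  calc _ = e.inv ≫ (∑ x, π x ≫ ι x) ≫ e.hom := by
            simp [Preadditive.sum_comp, Preadditive.comp_sum]
    _ = _ := by rw [h3, Category.id_comp, e.inv_hom_id]

theorem Decomposes.summandMultiplicity {M : C} {m : Λ → ℕ} (hM : Decomposes T M m)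
    (hT : ∀ l, Indecomposable (T l)) (hinj : ∀ l n, Nonempty (T l ≅ T n) → l = n) (l : Λ) :
    SummandMultiplicity M (T l) (m l) := by
  classical
  obtain ⟨J, _, γ, ι, π, h1, h2, h3, h4⟩ := hM
  let e := Fintype.equivFin J
  refine ⟨Fintype.card J, fun x => T (γ (e.symm x)), fun x => hT _, ⟨?_⟩, ?_⟩
  · let b : Bicone (fun x => T (γ (e.symm x))) :=
      { pt := M
        π := fun x => π (e.symm x)
        ι := fun x => ι (e.symm x)
        ι_π := fun x y => by
          split_ifs with h
          · subst h; simp [h1]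
          · exact h2 _ _ fun h' => h (e.symm.injective h') }
    exact biproduct.uniqueUpToIso _ (b := b) (isBilimitOfTotal b
      ((Equiv.sum_comp e.symm (fun j => π j ≫ ι j)).trans h3))
  · rw [← h4 l]
    refine Nat.card_congr ((e.symm.subtypeEquiv fun x => ?_))
    exact ⟨fun h => hinj _ _ h, fun h => ⟨eqToIso (congrArg T h)⟩⟩

end Decompositions

namespace HighestWeightCategory

variable {k : Type t} [Field k] {C : Type u} [Category.{v} C] [Abelian C] [Linear k C]
  [HasExt.{w} C] {Λ : Type s} [PartialOrder Λ] {H : HighestWeightCategory k C Λ}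

/-- Every tilting object is a direct sum of indecomposable tilting objects `T l`. -/
theorem IsTilting.exists_decomposes {T : Λ → C} (hT : ∀ l, H.IsIndecomposableTilting l (T l))
    {M : C} (hM : H.IsTilting M) : ∃ m, Decomposes T M m := by
  classical
  induction hn : Module.finrank k (M ⟶ M) using Nat.strong_induction_on generalizing M with
  | _ n ih =>
    by_cases h0 : IsZero M
    · exact ⟨0, .of_isZero h0⟩
    · obtain ⟨l, f, hf⟩ := H.exists_isStandardEmbedding_of_ne hM.1 h0
      obtain ⟨i, r, hir⟩ := (hT l).exists_retract hM hf
      obtain ⟨B, j, q, hjq, hiq, hjr, hsum⟩ := exists_complement i r hir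
      have := H.finite_hom M M
      have hlt := finrank_end_lt_of_retract (k := k) j q hjq (fun h => by
        have h2 : i = 0 := by rw [← Category.comp_id i, ← h, reassoc_of% hiq, zero_comp]
        rw [h2, zero_comp] at hir
        exact (hT l).indecomposable.1 ((IsZero.iff_id_eq_zero _).2 hir.symm))
      rw [hn] at hlt
      obtain ⟨m, hm⟩ := ih _ hlt (hM.of_retract j q hjq) rfl
      exact ⟨_, (Decomposes.self l).add hm hir hjq hiq hjr hsum⟩

end HighestWeightCategory

/-! ### Minimal tilting coresolutions. -/

section Coresolutions

variable {k : Type t} [Field k] {C : Type u} [Category.{v} C] [Abelian C] [Linear k C]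

theorem Decomposes.exists_retract {Λ : Type s} {T : Λ → C} {M : C} {m : Λ → ℕ} (hM : Decomposes T M m) {l : Λ}
    (hl : m l ≠ 0) : ∃ (i : T l ⟶ M) (r : M ⟶ T l), i ≫ r = 𝟙 _ := by
  obtain ⟨J, _, γ, ι, π, h1, h2, h3, h4⟩ := hM
  rw [← h4 l] at hl
  obtain ⟨⟨j, rfl⟩⟩ : Nonempty {j // γ j = l} := by
    by_contra h
    rw [not_nonempty_iff] at h
    exact hl Nat.card_of_isEmpty
  exact ⟨ι j, π j, h1 j⟩

namespace HighestWeightCategory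

variable [HasExt.{w} C] {Λ : Type s} [PartialOrder Λ]

/-- Minimal coresolutions of `X` by tilting objects, with weights in `I`, such that the
multiplicity of `T_l` in degree `n` is `c n l`. -/
inductive MinimalCoresolution (H : HighestWeightCategory k C Λ) (T : Λ → C) (I : Set Λ) :
    C → (ℕ → Λ → ℕ) → Prop
  | zero {X : C} (h : IsZero X) : MinimalCoresolution H T I X 0
  | step {S : ShortComplex C} (hS : S.ShortExact) (h₂ : H.IsTilting S.X₂)
      (h₃ : HasFiltration H.Δ S.X₃)
      (hmin : ∀ (Z : C) (g : S.X₂ ⟶ Z) (s : Z ⟶ S.X₂), S.f ≫ g = 0 → s ≫ g = 𝟙 Z → IsZero Z)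
      {m : Λ → ℕ} (hm : Decomposes T S.X₂ m) (hI : ∀ l, m l ≠ 0 → l ∈ I)
      {c : ℕ → Λ → ℕ} (hc : MinimalCoresolution H T I S.X₃ c) :
      MinimalCoresolution H T I S.X₁ (fun n => Nat.casesOn n m c)

variable (H : HighestWeightCategory k C Λ)

/-- The costandard envelope of a standardly filtered object is tilting. Among such embeddings, one
whose target has the smallest endomorphism algebra is minimal: a nonzero summand Z on which f
projects to zero could be discarded. -/
theorem exists_minimal_tilting_embedding {X : C} (hX : HasFiltration H.Δ X) :
    ∃ (M : C) (f : X ⟶ M), Mono f ∧ H.IsTilting M ∧ HasFiltration H.Δ (cokernel f) ∧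
      H.supp (cokernel f) ⊆ {l | ∃ m ∈ H.supp X, l < m} ∧
      ∀ (Z : C) (g : M ⟶ Z) (s : Z ⟶ M), f ≫ g = 0 → s ≫ g = 𝟙 Z → IsZero Z := by
  classical
  let P : ℕ → Prop := fun n => ∃ (M : C) (f : X ⟶ M), Mono f ∧ H.IsTilting M ∧
    HasFiltration H.Δ (cokernel f) ∧ H.supp (cokernel f) ⊆ {l | ∃ m ∈ H.supp X, l < m} ∧
    Module.finrank k (M ⟶ M) = n
  have hP : ∃ n, P n := by
    have hfin := H.finite_strictly_below ((H.factors_finite X).subset (H.supp_subset_factors X))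
    obtain ⟨Y, j, h1, h2, h3, h4⟩ := H.exists_costandard_envelope hfin.toFinset (by
      simp only [Set.Finite.mem_toFinset]
      rintro l ⟨m, hm, hlt⟩ n hn
      exact ⟨m, hm, hn.trans hlt⟩) X (fun l hl => H.ext_one_standard_of_supp hX fun m hm hlt =>
        hl (by simpa using ⟨m, hm, hlt⟩))
    exact ⟨_, Y, j, h1, ⟨.of_shortExact (shortExact_cokernel j) hX h3, h2⟩, h3,
      by simpa using h4, rfl⟩
  obtain ⟨M, f, hf, hM, hc, hsupp, hd⟩ := Nat.find_spec hP
  refine ⟨M, f, hf, hM, hc, hsupp, fun Z g s hfg hsg => ?_⟩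
  by_contra hZ
  obtain ⟨A, i, r, hir, hsr, hig, hsum⟩ := exists_complement s g hsg
  have hfri : f ≫ r ≫ i = f := by
    have h := f ≫= hsum
    rwa [Preadditive.comp_add, reassoc_of% hfg, zero_comp, zero_add, Category.comp_id] at h
  have hne : r ≫ i ≠ 𝟙 M := fun h => hZ (by
    rw [IsZero.iff_id_eq_zero, ← hsg, ← Category.id_comp g, ← h, Category.assoc, hig]
    simp)
  have := H.finite_hom M M
  obtain ⟨i', r', hir'⟩ := retract_cokernel i r hir hfri
  have hmono : Mono (f ≫ r) := by
    have : Mono ((f ≫ r) ≫ i) := by rw [Category.assoc, hfri]; exact hf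
    exact mono_of_mono _ i
  have : Epi r' := epi_of_epi_fac hir'
  have hlt := finrank_end_lt_of_retract (k := k) i r hir hne
  rw [hd] at hlt
  exact Nat.find_min hP hlt ⟨A, f ≫ r, hmono, hM.of_retract i r hir,
    hasFiltration_Δ_of_retract hc i' r' hir', (H.supp_of_epi r').trans hsupp, rfl⟩

/-- Iterate minimal embeddings on the cokernels. The order ideal generated by the support shrinks
strictly at each step and stays inside the finite ideal of weights ≤ ν. -/
theorem exists_minimalCoresolution {T : Λ → C} (hT : ∀ l, H.IsIndecomposableTilting l (T l))
    {ν : Λ} {X : C} (hX : HasFiltration H.Δ X) (hν : H.supp X ⊆ Set.Iic ν) :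
    ∃ c, H.MinimalCoresolution T (Set.Iic ν) X c := by
  induction hn : {l | ∃ m ∈ H.supp X, l ≤ m}.ncard using Nat.strong_induction_on
    generalizing X with
  | _ n ih =>
    by_cases h0 : IsZero X
    · exact ⟨0, .zero h0⟩
    obtain ⟨M, f, hf, hM, hc, hsupp, hmin⟩ := H.exists_minimal_tilting_embedding hX
    have hfX : {l | ∃ m ∈ H.supp X, l ≤ m}.Finite := (H.lowerFinite ν).subset (by
      rintro l ⟨m, hm, hle⟩; exact hle.trans (hν hm))
    have hsub : {l | ∃ m ∈ H.supp (cokernel f), l ≤ m} ⊂ {l | ∃ m ∈ H.supp X, l ≤ m} := by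
      refine ⟨?_, ?_⟩
      · rintro l ⟨m, hm, hle⟩
        obtain ⟨m', hm', hlt⟩ := hsupp hm
        exact ⟨m', hm', hle.trans hlt.le⟩
      -- A maximal weight of the support of X is not below any weight of the support of the
      -- cokernel.
      · intro hle
        obtain ⟨m, hm, hmax⟩ := ((H.factors_finite X).subset
          (H.supp_subset_factors X)).exists_maximal (H.exists_hom_costandard h0)
        obtain ⟨a, ha, hma⟩ := hle ⟨m, hm, le_rfl⟩
        obtain ⟨b, hb, hab⟩ := hsupp ha
        exact (hma.trans_lt hab).not_ge (hmax hb (hma.trans_lt hab).le)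
    have hcν : H.supp (cokernel f) ⊆ Set.Iic ν := fun l hl => by
      obtain ⟨m, hm, hlt⟩ := hsupp hl
      exact hlt.le.trans (hν hm)
    obtain ⟨c, hcc⟩ := ih _ (hn ▸ Set.ncard_lt_ncard hsub hfX) hc hcν rfl
    obtain ⟨m, hm⟩ := hM.exists_decomposes hT
    refine ⟨_, MinimalCoresolution.step (shortExact_cokernel f) hM hc hmin hm (fun l hl => ?_) hcc⟩
    obtain ⟨i, r, hir⟩ := hm.exists_retract hl
    have : Mono i := mono_of_mono_fac hir
    obtain ⟨a, ha, hla⟩ := H.factors_of_hasFiltration_Δ hM.1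
      (H.factors_of_mono i (hT l).mem_factors)
    rcases H.supp_middle_subset (shortExact_cokernel f) ha with h | h
    · exact hla.trans (hν h)
    · exact hla.trans (hcν h)

end HighestWeightCategory

end Coresolutions

/-! ### Dimension shifting. -/

section DimensionShift

variable {k : Type t} [Field k] {D : Type u} [Category.{v} D] [Abelian D] [Linear k D]

/-- Dimension shifting along a short exact sequence with injective middle term. -/
theorem nonempty_ext_linearEquiv_of_injective [HasExt.{w} D] {S : ShortComplex D} (hS : S.ShortExact)
    [Injective S.X₂] (X : D) (h : ∀ g : X ⟶ S.X₂, g ≫ S.g = 0) (n : ℕ) :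
    Nonempty (Ext X S.X₃ n ≃ₗ[k] Ext X S.X₁ (n + 1)) := by
  let φ : Ext X S.X₃ n →ₗ[k] Ext X S.X₁ (n + 1) :=
    { toFun := fun x => x.comp hS.extClass rfl
      map_add' := fun x y => by simp
      map_smul' := fun c x => by simp }
  have hz : ∀ x : Ext X S.X₂ n, x.comp (Ext.mk₀ S.g) (add_zero n) = 0 := by
    cases n with
    | zero =>
      intro x
      obtain ⟨g, rfl⟩ := (Ext.mk₀_bijective _ _).2 x
      rw [Ext.mk₀_comp_mk₀, h, Ext.mk₀_zero]
    | succ n =>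
      intro x
      rw [Ext.eq_zero_of_injective x, Ext.zero_comp]
  refine ⟨LinearEquiv.ofBijective φ ⟨?_, ?_⟩⟩
  · refine (injective_iff_map_eq_zero φ).2 fun x hx => ?_
    obtain ⟨y, rfl⟩ := Ext.covariant_sequence_exact₃ X hS x rfl hx
    exact hz y
  · intro y
    obtain ⟨x, hx⟩ := Ext.covariant_sequence_exact₁ X hS y
      (Ext.eq_zero_of_injective _) (n₀ := n) rfl
    exact ⟨x, hx⟩

theorem nonempty_hom_linearEquiv_of_comp_eq_zero {S : ShortComplex D} (hS : S.ShortExact) (X : D)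
    (h : ∀ g : X ⟶ S.X₂, g ≫ S.g = 0) : Nonempty ((X ⟶ S.X₁) ≃ₗ[k] (X ⟶ S.X₂)) := by
  have := hS.mono_f
  refine ⟨LinearEquiv.ofBijective (Linear.rightComp k X S.f) ⟨fun f g hfg => ?_, fun g => ?_⟩⟩
  · exact (cancel_mono S.f).1 hfg
  · exact ⟨hS.exact.lift g (h g), hS.exact.lift_f g (h g)⟩

end DimensionShift

/-! ### Monomorphisms and exactness in finite-dimensional modules. -/

section FinDimMod

variable {k : Type t} [Field k] {A : Type v} [Ring A] [Algebra k A]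

theorem FinDimMod.injective_of_mono {X Y : FinDimMod.{w} k A} (f : X ⟶ Y) [Mono f] :
    Function.Injective f.hom.hom := by
  rw [← LinearMap.ker_eq_bot]
  let K : FinDimMod.{w} k A := ⟨ModuleCat.of A (LinearMap.ker f.hom.hom),
    have : Mono (ModuleCat.ofHom (LinearMap.ker f.hom.hom).subtype) :=
      (ModuleCat.mono_iff_injective _).2 (Submodule.subtype_injective _)
    (isFinDim k A).prop_of_mono (ModuleCat.ofHom (LinearMap.ker f.hom.hom).subtype) X.property⟩
  let j : K ⟶ X := ObjectProperty.homMk (ModuleCat.ofHom (LinearMap.ker f.hom.hom).subtype)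
  have h0 : j = 0 := by
    rw [← cancel_mono f, zero_comp]
    ext x
    exact x.2
  rw [eq_bot_iff]
  intro x hx
  have := congrArg (fun g => g.hom.hom ⟨x, hx⟩) h0
  exact this

theorem FinDimMod.shortExact {S : ShortComplex (FinDimMod.{w} k A)}
    (h₁ : Function.Injective S.f.hom.hom) (h₂ : Function.Exact S.f.hom.hom S.g.hom.hom)
    (h₃ : Function.Surjective S.g.hom.hom) : S.ShortExact :=
  ShortExact.reflects_shortExact_of_faithful (isFinDim k A).ι
    { exact := (ShortComplex.ShortExact.moduleCat_exact_iff_function_exact _).2 h₂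
      mono_f := (ModuleCat.mono_iff_injective _).2 h₁
      epi_g := (ModuleCat.epi_iff_surjective _).2 h₃ }

end FinDimMod

/-! ### The functor Hom(-, G)^*. -/

section DualHom

open scoped ModuleCat

variable {k : Type t} [Field k] {C : Type u} [Category.{v} C] [Abelian C] [Linear k C]

/-- The underlying functional of an element of `Hom(X, G)^*`. -/
def DualHom.eval {G X : C} (φ : DualHom k G X) : (X ⟶ G) →ₗ[k] k := φ

theorem DualHom.ext {G X : C} {φ ψ : DualHom k G X} (h : ∀ f, φ.eval f = ψ.eval f) : φ = ψ :=
  LinearMap.ext h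

/-- The action of a morphism on the spaces `Hom(-, G)^*`. -/
noncomputable def dualHomMap (G : C) {X Y : C} (f : X ⟶ Y) :
    DualHom k G X →ₗ[(End G)ᵐᵒᵖ] DualHom k G Y where
  toFun φ := φ.eval.comp (Linear.leftComp k G f)
  map_add' _ _ := rfl
  map_smul' a φ := DualHom.ext fun g =>
    congrArg φ.eval (Category.assoc f g (End.asHom a.unop))

theorem dualHomMap_eval (G : C) {X Y : C} (f : X ⟶ Y) (φ : DualHom k G X) (g : Y ⟶ G) :
    (dualHomMap G f φ).eval g = φ.eval (f ≫ g) := rfl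

variable [HasExt.{w} C] {Λ : Type s} [PartialOrder Λ] (H : HighestWeightCategory k C Λ)

namespace HighestWeightCategory

/-- The functor `Hom(-, G)^*` with values in finite-dimensional modules over `End(G)^op`. -/
noncomputable def dualHomFunctor (G : C) : C ⥤ FinDimMod.{max t v} k (End G)ᵐᵒᵖ where
  obj X := ⟨ModuleCat.of _ (DualHom k G X),
    have := H.finite_hom X G
    isFinDim_dualHom k _ _⟩
  map f := ObjectProperty.homMk (ModuleCat.ofHom (dualHomMap G f))
  map_id X := by
    ext φ
    exact DualHom.ext fun g => congrArg (DualHom.eval φ) (Category.id_comp g)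
  map_comp f g := by
    ext φ
    exact DualHom.ext fun h => congrArg (DualHom.eval φ) (Category.assoc f g h)

instance (G : C) : (H.dualHomFunctor G).Additive where
  map_add {X Y f g} := by
    ext φ
    refine DualHom.ext fun h => ?_
    exact (congrArg (DualHom.eval φ) (Preadditive.add_comp _ _ _ f g h)).trans (map_add _ _ _)

/-- Vanishing of Ext¹(S.X₃, G) makes Hom(-, G) exact on S, and duality over a field is exact. -/
theorem dualHomFunctor_shortExact {G : C} {S : ShortComplex C} (hS : S.ShortExact)
    (h : Subsingleton (Ext S.X₃ G 1)) : (S.map (H.dualHomFunctor G)).ShortExact := by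
  have := hS.epi_g
  have hdesc := exists_desc_of_ext hS h (Y := G)
  refine FinDimMod.shortExact ?_ ?_ ?_
  · refine (injective_iff_map_eq_zero (dualHomMap G S.f)).2 fun φ hφ => DualHom.ext fun f => ?_
    obtain ⟨g, rfl⟩ := hdesc f
    rw [← dualHomMap_eval, hφ]
    rfl
  · change Function.Exact (dualHomMap (k := k) G S.f) (dualHomMap G S.g)
    intro ψ
    constructor
    · intro hψ
      have hker : LinearMap.ker (Linear.leftComp k G S.f) ≤ LinearMap.ker ψ.eval := fun f hf => by
        obtain ⟨g, rfl⟩ := kernel_exact hS f hf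
        rw [LinearMap.mem_ker, ← dualHomMap_eval, hψ]
        rfl
      have hsurj : Function.Surjective (Linear.leftComp k G S.f) := hdesc
      obtain ⟨s, hs⟩ := (Linear.leftComp k G S.f).exists_rightInverse_of_surjective
        (LinearMap.range_eq_top.2 hsurj)
      refine ⟨ψ.eval.comp s, DualHom.ext fun f => ?_⟩
      have : s (S.f ≫ f) - f ∈ LinearMap.ker ψ.eval := hker (by
        rw [LinearMap.mem_ker, map_sub]
        exact sub_eq_zero.2 (LinearMap.congr_fun hs (S.f ≫ f)))
      rw [LinearMap.mem_ker, map_sub, sub_eq_zero] at this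
      exact this
    · rintro ⟨φ, rfl⟩
      refine DualHom.ext fun f => ?_
      rw [dualHomMap_eval, dualHomMap_eval, ← Category.assoc, S.zero, zero_comp, map_zero]
      rfl
  · intro ψ
    obtain ⟨s, hs⟩ := (Linear.leftComp k G S.g).exists_leftInverse_of_injective
      (LinearMap.ker_eq_bot.2 fun f g hfg => (cancel_epi S.g).1 hfg)
    refine ⟨(DualHom.eval ψ).comp s, DualHom.ext fun f => ?_⟩
    exact congrArg (DualHom.eval ψ) (LinearMap.congr_fun hs f)

/-- Hom(G, G)^* is the dual of the regular module, so module maps into it amount to k-linear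
functionals, by evaluation at the identity. Functionals extend along injections. -/
theorem injective_dualHomFunctor_self (G : C) : Injective ((H.dualHomFunctor G).obj G) where
  factors {X Y} g f _ := by
    have hinj := FinDimMod.injective_of_mono f
    let θ : X.obj →ₗ[k] k :=
      { toFun := fun x => DualHom.eval (g.hom.hom x) (𝟙 G)
        map_add' := fun x y => by rw [map_add]; rfl
        map_smul' := fun c x => by
          change DualHom.eval (g.hom.hom ((algebraMap k (End G)ᵐᵒᵖ c) • x)) (𝟙 G) = _
          rw [map_smul]
          change DualHom.eval (g.hom.hom x) (𝟙 G ≫ (c • 𝟙 G)) = _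
          simp }
    -- A k-linear retraction s of f extends the functional θ to Y; the module map e is the one
    -- corresponding to the extended functional.
    obtain ⟨s, hs⟩ := (f.hom.hom.restrictScalars k).exists_leftInverse_of_injective
      (LinearMap.ker_eq_bot.2 hinj)
    let e : Y.obj →ₗ[(End G)ᵐᵒᵖ] DualHom k G G :=
      { toFun := fun y =>
          ({ toFun := fun f => θ (s (MulOpposite.op (End.of f) • y))
             map_add' := fun f f' => by
               rw [← map_add, ← map_add, ← add_smul]; rfl
             map_smul' := fun c f => by
               rw [RingHom.id_apply, ← map_smul, ← map_smul]
               congr 2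
               rw [← algebraMap_smul (End G)ᵐᵒᵖ c (MulOpposite.op (End.of f) • y), smul_smul]
               congr 1
               refine MulOpposite.unop_injective ?_
               change c • f = (c • 𝟙 G) ≫ f
               simp } : (G ⟶ G) →ₗ[k] k)
        map_add' := fun y y' => DualHom.ext fun f => by
          change θ (s (_ • (y + y'))) = θ (s (_ • y)) + θ (s (_ • y'))
          rw [smul_add, map_add, map_add]
        map_smul' := fun a y => DualHom.ext fun f => by
          change θ (s (_ • (a • y))) = θ (s (_ • y))
          rw [smul_smul]
          rfl }
    refine ⟨ObjectProperty.homMk (ModuleCat.ofHom e), ?_⟩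
    ext x
    refine DualHom.ext fun a => ?_
    change θ (s (MulOpposite.op (End.of a) • f.hom.hom x)) = DualHom.eval (g.hom.hom x) a
    rw [← map_smul]
    have : ∀ z, s (f.hom.hom z) = z := fun z => LinearMap.congr_fun hs z
    rw [this]
    change DualHom.eval (g.hom.hom (MulOpposite.op (End.of a) • x)) (𝟙 G) = _
    rw [map_smul]
    exact congrArg (DualHom.eval (g.hom.hom x)) (Category.id_comp a)

end HighestWeightCategory

end DualHom

theorem Decomposes.mem_of_support {C : Type u} [Category.{v} C] [Abelian C] {Λ : Type s} {T : Λ → C} {M : C} {m : Λ → ℕ} {I : Set Λ}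
    (hM : Decomposes T M m) (hI : ∀ l, m l ≠ 0 → l ∈ I) :
    ∃ (J : Type) (_ : Fintype J) (γ : J → I) (ι : ∀ j, T (γ j) ⟶ M) (π : ∀ j, M ⟶ T (γ j)),
    (∀ j, ι j ≫ π j = 𝟙 _) ∧ (∀ j j', j ≠ j' → ι j ≫ π j' = 0) ∧ ∑ j, π j ≫ ι j = 𝟙 M ∧
    ∀ l, Nat.card {j // (γ j : Λ) = l} = m l := by
  obtain ⟨J, _, γ, ι, π, h1, h2, h3, h4⟩ := hM
  refine ⟨J, inferInstance, fun j => ⟨γ j, hI _ ?_⟩, ι, π, h1, h2, h3, h4⟩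
  rw [← h4]
  have : Nonempty {i // γ i = γ j} := ⟨⟨j, rfl⟩⟩
  exact Nat.card_pos.ne'

/-! ### The characteristic tilting object. -/

section CharTilting

variable {C : Type u} [Category.{v} C] [Abelian C] {Λ : Type s} [PartialOrder Λ]
  (T : Λ → C) (Γ : LowerSet Λ) [Finite Γ]

/-- The inclusion of a summand of the characteristic tilting object. -/
noncomputable def charTilting.ι (g : Γ) : T g ⟶ charTilting T Γ :=
  biproduct.ι (fun g : Γ => T g) g

/-- The projection to a summand of the characteristic tilting object. -/
noncomputable def charTilting.π (g : Γ) : charTilting T Γ ⟶ T g :=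
  biproduct.π (fun g : Γ => T g) g

@[simp]
theorem charTilting.ι_π_self (g : Γ) : charTilting.ι T Γ g ≫ charTilting.π T Γ g = 𝟙 _ :=
  biproduct.ι_π_self _ _

theorem charTilting.ι_π_ne {g g' : Γ} (h : g ≠ g') :
    charTilting.ι T Γ g ≫ charTilting.π T Γ g' = 0 :=
  biproduct.ι_π_ne _ h

theorem charTilting.hom_ext {X : C} {f g : X ⟶ charTilting T Γ}
    (h : ∀ x, f ≫ charTilting.π T Γ x = g ≫ charTilting.π T Γ x) : f = g :=
  biproduct.hom_ext f g h

theorem charTilting.total [Fintype Γ] :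
    ∑ g, charTilting.π T Γ g ≫ charTilting.ι T Γ g = 𝟙 (charTilting T Γ) := by
  classical
  refine charTilting.hom_ext T Γ fun g => ?_
  rw [Preadditive.sum_comp, Finset.sum_eq_single g]
  · simp
  · intro x _ hx
    rw [Category.assoc, charTilting.ι_π_ne T Γ hx, comp_zero]
  · simp

end CharTilting

/-! ### Socles of the dual costandard objects and Ext groups in the Ringel dual. -/

section RingelDual

variable {k : Type t} [Field k] {C : Type u} [Category.{v} C] [Abelian C] [Linear k C]
  [HasExt.{w} C] {Λ : Type s} [PartialOrder Λ]

namespace HighestWeightCategory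

variable {H : HighestWeightCategory k C Λ} {T : Λ → C} (Γ : LowerSet Λ) [Finite Γ]

theorem hasFiltration_N_charTilting (hT : ∀ l, H.IsIndecomposableTilting l (T l)) :
    HasFiltration H.N (charTilting T Γ) := by
  have := Fintype.ofFinite Γ
  refine H.hasFiltration_N_of_ext _ fun m => subsingleton_of_forall_eq 0 fun α => ?_
  have h1 : ∀ g : Γ, α.comp (Ext.mk₀ (charTilting.π T Γ g)) (add_zero 1) = 0 := fun g =>
    (ext_succ_of_filtrations (H := H) (.of_mem m) (hT g).tilting.2 0).elim _ _
  rw [← Ext.comp_mk₀_id α, ← charTilting.total T Γ, ← Ext.addEquiv₀_symm_apply, map_sum,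
    Ext.comp_sum]
  refine Finset.sum_eq_zero fun g _ => ?_
  rw [Ext.addEquiv₀_symm_apply, ← Ext.mk₀_comp_mk₀, ← Ext.comp_assoc_of_second_deg_zero, h1,
    Ext.zero_comp]

/-- Otherwise x ≫ y is invertible, so T_l is a nonzero summand of the indecomposable T_m, and
comparing highest weights gives l = m. -/
theorem comp_eq_zero_of_ne (hT : ∀ l, H.IsIndecomposableTilting l (T l)) {l m : Λ} (h : l ≠ m)
    {j : H.Δ l ⟶ T l} (hj : H.IsStandardEmbedding j) (x : T l ⟶ T m) (y : T m ⟶ T l) :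
    j ≫ x ≫ y = 0 := by
  by_contra hne
  have := (hT l).isIso_of_comp_ne_zero hj hne
  have h1 : x ≫ y ≫ inv (x ≫ y) = 𝟙 _ := by
    rw [← Category.assoc]; exact IsIso.hom_inv_id _
  rcases eq_zero_or_eq_id_of_indecomposable (hT m).indecomposable
    (e := (y ≫ inv (x ≫ y)) ≫ x) (by simp [reassoc_of% h1]) with h2 | h2
  · refine (hT l).indecomposable.1 ((IsZero.iff_id_eq_zero _).2 ?_)
    have h3 := x ≫= h2 =≫ (y ≫ inv (x ≫ y))
    simpa [reassoc_of% h1, h1] using h3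
  · exact h (eq_of_iso_indecomposableTilting (hT l) (hT m) ⟨x, _, h1, h2⟩)

variable {Γ}

section

variable {m : Γ} {j : H.Δ m ⟶ T m} {φ₀ : DualHom k (charTilting T Γ) (H.Δ m)}

/-- Hom(Δ_m, T_m) is spanned by j, so the T_m-component of f is a multiple of j; φ₀ reads off the
coefficient. -/
theorem exists_socle_functional (hT : ∀ l, H.IsIndecomposableTilting l (T l)) (m : Γ)
    {j : H.Δ m ⟶ T m} (hj : H.IsStandardEmbedding j) :
    ∃ φ₀ : DualHom k (charTilting T Γ) (H.Δ m),
      ∀ f, f ≫ charTilting.π T Γ m = φ₀.eval f • j := by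
  have hne : j ≠ 0 := fun h => H.standard_not_isZero m (have := hj.mono; IsZero.of_mono_eq_zero j h)
  let e : k ≃ₗ[k] (H.Δ m ⟶ T m) := LinearEquiv.ofBijective (LinearMap.toSpanSingleton k _ j)
    ⟨smul_left_injective k hne, fun g => (hT m).exists_smul hj g⟩
  refine ⟨(e.symm.toLinearMap.comp (Linear.rightComp k _ (charTilting.π T Γ m)) :
    (H.Δ m ⟶ charTilting T Γ) →ₗ[k] k), fun f => ?_⟩
  exact (e.apply_symm_apply (f ≫ charTilting.π T Γ m)).symm

theorem exists_extension (hT : ∀ l, H.IsIndecomposableTilting l (T l))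
    (hj : H.IsStandardEmbedding j) (f : H.Δ m ⟶ charTilting T Γ) :
    ∃ g : T m ⟶ charTilting T Γ, j ≫ g = f := by
  have := hj.mono
  exact exists_desc_of_ext (shortExact_cokernel j)
    (ext_succ_of_filtrations hj.cokernel (hasFiltration_N_charTilting Γ hT) 0) f

/-- The algebra acts on φ₀ through scalars. Extend f to T_m and expand over the summands of T_Γ: a
path from T_m to T_m through T_x with x ≠ m contributes nothing by `comp_eq_zero_of_ne`, and only
the scalar on the T_m-part of a remains. -/
theorem socle_functional_comp (hT : ∀ l, H.IsIndecomposableTilting l (T l))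
    (hj : H.IsStandardEmbedding j) (hφ : ∀ f, f ≫ charTilting.π T Γ m = φ₀.eval f • j)
    (f : H.Δ m ⟶ charTilting T Γ) (a : charTilting T Γ ⟶ charTilting T Γ) :
    φ₀.eval (f ≫ a) = φ₀.eval (j ≫ charTilting.ι T Γ m ≫ a) * φ₀.eval f := by
  classical
  have := Fintype.ofFinite Γ
  have hne : j ≠ 0 := fun h => H.standard_not_isZero m (have := hj.mono; IsZero.of_mono_eq_zero j h)
  refine smul_left_injective k hne ?_
  change φ₀.eval (f ≫ a) • j = (φ₀.eval (j ≫ charTilting.ι T Γ m ≫ a) * φ₀.eval f) • j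
  obtain ⟨g, rfl⟩ := exists_extension hT hj f
  have h1 : (j ≫ g) ≫ a = ∑ x, j ≫ (g ≫ charTilting.π T Γ x) ≫ charTilting.ι T Γ x ≫ a := by
    calc (j ≫ g) ≫ a = (j ≫ g) ≫ (∑ x, charTilting.π T Γ x ≫ charTilting.ι T Γ x) ≫ a := by
          rw [charTilting.total, Category.id_comp]
      _ = _ := by simp [Preadditive.sum_comp, Preadditive.comp_sum]
  rw [← hφ, h1, Preadditive.sum_comp, Finset.sum_eq_single m, mul_comm, mul_smul, ← hφ,
    ← Linear.smul_comp, ← Linear.smul_comp]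
  · rw [← hφ (j ≫ g)]
    simp only [Category.assoc]
  · intro x _ hx
    simpa using comp_eq_zero_of_ne hT (fun h => hx (Subtype.ext h.symm)) hj
      (g ≫ charTilting.π T Γ x) (charTilting.ι T Γ x ≫ a ≫ charTilting.π T Γ m)
  · simp

/-- Every nonzero submodule of `∇'_m` contains the distinguished functional. -/
theorem exists_smul_eq_socle_functional (hT : ∀ l, H.IsIndecomposableTilting l (T l))
    (hj : H.IsStandardEmbedding j) (hφ : ∀ f, f ≫ charTilting.π T Γ m = φ₀.eval f • j)
    {φ : DualHom k (charTilting T Γ) (H.Δ m)} (hne : φ ≠ 0) :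
    ∃ a : RingelAlgebra T Γ, a • φ = φ₀ := by
  obtain ⟨f, hf⟩ : ∃ f, φ.eval f ≠ 0 := by
    by_contra! h
    exact hne (DualHom.ext h)
  obtain ⟨g, rfl⟩ := exists_extension hT hj f
  -- With g extending an f on which φ is nonzero, projecting to T_m and applying g sends any h to
  -- φ₀(h) times j ≫ g; the inverse normalises the value of φ there.
  refine ⟨MulOpposite.op (End.of ((φ.eval (j ≫ g))⁻¹ • (charTilting.π T Γ m ≫ g))),
    DualHom.ext fun f => ?_⟩
  change φ.eval (f ≫ ((φ.eval (j ≫ g))⁻¹ • (charTilting.π T Γ m ≫ g))) = _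
  rw [Linear.comp_smul, ← Category.assoc, hφ, Linear.smul_comp, map_smul, map_smul, smul_eq_mul,
    smul_eq_mul, mul_comm, mul_assoc, mul_inv_cancel₀ hf, mul_one]

theorem socle_functional_ne_zero
    (hj : H.IsStandardEmbedding j) (hφ : ∀ f, f ≫ charTilting.π T Γ m = φ₀.eval f • j) :
    φ₀.eval (j ≫ charTilting.ι T Γ m) = 1 := by
  have hne : j ≠ 0 := fun h => H.standard_not_isZero m (have := hj.mono; IsZero.of_mono_eq_zero j h)
  refine smul_left_injective k hne ?_
  change φ₀.eval (j ≫ charTilting.ι T Γ m) • j = (1 : k) • j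
  rw [← hφ]
  simp

/-- Every nonzero submodule contains φ₀, so the span of φ₀ is the unique minimal submodule. -/
theorem socle_dualHom (hT : ∀ l, H.IsIndecomposableTilting l (T l))
    (hj : H.IsStandardEmbedding j) (hφ : ∀ f, f ≫ charTilting.π T Γ m = φ₀.eval f • j) :
    socle (RingelAlgebra T Γ) (DualHom k (charTilting T Γ) (H.Δ m)) =
      Submodule.span (RingelAlgebra T Γ) {φ₀} := by
  have h0 : φ₀ ≠ 0 := fun h => by
    have h1 := socle_functional_ne_zero hj hφ
    rw [h] at h1
    exact zero_ne_one h1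
  have hle : ∀ S : Submodule (RingelAlgebra T Γ) (DualHom k (charTilting T Γ) (H.Δ m)), S ≠ ⊥ →
      Submodule.span (RingelAlgebra T Γ) {φ₀} ≤ S := fun S hS => by
    obtain ⟨φ, hφS, hne⟩ := S.ne_bot_iff.1 hS
    obtain ⟨a, rfl⟩ := exists_smul_eq_socle_functional hT hj hφ hne
    exact (Submodule.span_singleton_le_iff_mem _ _).2 (S.smul_mem a hφS)
  have hatom : IsAtom (Submodule.span (RingelAlgebra T Γ) {φ₀}) := by
    refine ⟨by simpa using h0, fun S hS => ?_⟩
    by_contra h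
    exact hS.not_ge (hle S h)
  refine le_antisymm (sSup_le fun S hS => ?_) (le_sSup (isSimpleModule_iff_isAtom.2 hatom))
  have hS' : IsAtom S := isSimpleModule_iff_isAtom.1 hS
  exact ((hS'.le_iff_eq hatom.1).1 (hle S hS'.1)).ge

/-- The inclusion of `L'_m` into `∇'_m`. -/
noncomputable def dualSimpleInclusion (H : HighestWeightCategory k C Λ) (T : Λ → C)
    (Γ : LowerSet Λ) [Finite Γ] (m : Λ) :
    H.dualSimple T Γ m ⟶ (H.dualHomFunctor (charTilting T Γ)).obj (H.Δ m) :=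
  ObjectProperty.homMk (ModuleCat.ofHom
    (socle (RingelAlgebra T Γ) (DualHom k (charTilting T Γ) (H.Δ m))).subtype)

theorem dualSimple_hom_ext (hT : ∀ l, H.IsIndecomposableTilting l (T l))
    (hj : H.IsStandardEmbedding j) (hφ : ∀ f, f ≫ charTilting.π T Γ m = φ₀.eval f • j)
    (hmem : φ₀ ∈ socle (RingelAlgebra T Γ) (DualHom k (charTilting T Γ) (H.Δ m)))
    {Y : FinDimMod.{max t v} k (RingelAlgebra T Γ)} {f g : H.dualSimple T Γ m ⟶ Y}
    (h : f.hom.hom ⟨φ₀, hmem⟩ = g.hom.hom ⟨φ₀, hmem⟩) : f = g := by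
  refine ObjectProperty.hom_ext _ (ModuleCat.hom_ext (LinearMap.ext ?_))
  rintro ⟨φ, hφs⟩
  have hφ' := hφs
  rw [socle_dualHom hT hj hφ, Submodule.mem_span_singleton] at hφ'
  obtain ⟨a, rfl⟩ := hφ'
  exact (f.hom.hom.map_smul a ⟨φ₀, hmem⟩).trans
    ((congrArg (a • ·) h).trans (g.hom.hom.map_smul a ⟨φ₀, hmem⟩).symm)

/-- The element a and the scalar c act equally on φ₀, hence also on its image under g. -/
theorem dualSimple_hom_eval (hT : ∀ l, H.IsIndecomposableTilting l (T l))
    (hj : H.IsStandardEmbedding j) (hφ : ∀ f, f ≫ charTilting.π T Γ m = φ₀.eval f • j)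
    (hmem : φ₀ ∈ socle (RingelAlgebra T Γ) (DualHom k (charTilting T Γ) (H.Δ m))) {X : C}
    (g : H.dualSimple T Γ m ⟶ (H.dualHomFunctor (charTilting T Γ)).obj X)
    (f : X ⟶ charTilting T Γ) (a : charTilting T Γ ⟶ charTilting T Γ) :
    DualHom.eval (g.hom.hom ⟨φ₀, hmem⟩) (f ≫ a) =
      φ₀.eval (j ≫ charTilting.ι T Γ m ≫ a) * DualHom.eval (g.hom.hom ⟨φ₀, hmem⟩) f := by
  set c := φ₀.eval (j ≫ charTilting.ι T Γ m ≫ a) with hc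
  have h1 : MulOpposite.op (End.of a) • φ₀ =
      MulOpposite.op (End.of (c • 𝟙 (charTilting T Γ))) • φ₀ := DualHom.ext fun f => by
    change φ₀.eval (f ≫ a) = φ₀.eval (f ≫ (c • 𝟙 _))
    rw [socle_functional_comp hT hj hφ]
    simp [hc]
  have h2 : MulOpposite.op (End.of a) • (⟨φ₀, hmem⟩ : socle (RingelAlgebra T Γ)
      (DualHom k (charTilting T Γ) (H.Δ m))) =
      MulOpposite.op (End.of (c • 𝟙 (charTilting T Γ))) • ⟨φ₀, hmem⟩ := Subtype.ext h1
  have h3 := (g.hom.hom.map_smul (MulOpposite.op (End.of a)) ⟨φ₀, hmem⟩).symm.trans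
    ((congrArg g.hom.hom h2).trans (g.hom.hom.map_smul _ ⟨φ₀, hmem⟩))
  have h4 := congrArg (fun ψ : DualHom k (charTilting T Γ) X => ψ.eval f) h3
  refine h4.trans ?_
  change DualHom.eval (g.hom.hom ⟨φ₀, hmem⟩) (f ≫ (c • 𝟙 _)) = _
  simp

/-- Apply `dualSimple_hom_eval` to an a that factors through the projection to T_g: for g ≠ m its
scalar is zero, while every f out of T_g is the inclusion followed by such an a. -/
theorem dualSimple_hom_eq_zero (hT : ∀ l, H.IsIndecomposableTilting l (T l)) {m g : Γ} (h : m ≠ g)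
    (x : H.dualSimple T Γ m ⟶ (H.dualHomFunctor (charTilting T Γ)).obj (T g)) : x = 0 := by
  obtain ⟨j, hj⟩ := (hT m).exists_isStandardEmbedding
  obtain ⟨φ₀, hφ⟩ := exists_socle_functional hT m hj
  have hmem : φ₀ ∈ socle (RingelAlgebra T Γ) (DualHom k (charTilting T Γ) (H.Δ m)) := by
    rw [socle_dualHom hT hj hφ]; exact Submodule.mem_span_singleton_self φ₀
  refine dualSimple_hom_ext hT hj hφ hmem (DualHom.ext fun f => ?_)
  have h1 := dualSimple_hom_eval hT hj hφ hmem x (charTilting.ι T Γ g) (charTilting.π T Γ g ≫ f)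
  rw [← Category.assoc, charTilting.ι_π_self, Category.id_comp, ← Category.assoc _ _ f,
    charTilting.ι_π_ne T Γ h, zero_comp, comp_zero, map_zero, zero_mul] at h1
  exact h1

/-- As in the previous case, the image of φ₀ is determined by its value on the inclusion of T_m, and
this value is the scalar c. -/
theorem dualSimple_hom_eq_smul (hT : ∀ l, H.IsIndecomposableTilting l (T l)) (m : Γ)
    {j : H.Δ m ⟶ T m} (hj : H.IsStandardEmbedding j)
    (x : H.dualSimple T Γ m ⟶ (H.dualHomFunctor (charTilting T Γ)).obj (T m)) :
    ∃ c : k, c • (H.dualSimpleInclusion T Γ m ≫ (H.dualHomFunctor (charTilting T Γ)).map j) = x := by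
  obtain ⟨φ₀, hφ⟩ := exists_socle_functional hT m hj
  have hmem : φ₀ ∈ socle (RingelAlgebra T Γ) (DualHom k (charTilting T Γ) (H.Δ m)) := by
    rw [socle_dualHom hT hj hφ]; exact Submodule.mem_span_singleton_self φ₀
  refine ⟨DualHom.eval (x.hom.hom ⟨φ₀, hmem⟩) (charTilting.ι T Γ m),
    dualSimple_hom_ext hT hj hφ hmem (DualHom.ext fun f => ?_)⟩
  have h1 := dualSimple_hom_eval hT hj hφ hmem x (charTilting.ι T Γ m) (charTilting.π T Γ m ≫ f)
  rw [← Category.assoc, charTilting.ι_π_self, Category.id_comp] at h1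
  refine Eq.trans ?_ h1.symm
  generalize DualHom.eval (x.hom.hom ⟨φ₀, hmem⟩) (charTilting.ι T Γ m) = c
  change φ₀.eval (j ≫ f ≫ (c • 𝟙 _)) = φ₀.eval (j ≫ f) * c
  simp [mul_comm]

theorem dualSimpleInclusion_map_ne_zero (hT : ∀ l, H.IsIndecomposableTilting l (T l)) (m : Γ)
    {j : H.Δ m ⟶ T m} (hj : H.IsStandardEmbedding j) :
    H.dualSimpleInclusion T Γ m ≫ (H.dualHomFunctor (charTilting T Γ)).map j ≠ 0 := by
  obtain ⟨φ₀, hφ⟩ := exists_socle_functional hT m hj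
  have hmem : φ₀ ∈ socle (RingelAlgebra T Γ) (DualHom k (charTilting T Γ) (H.Δ m)) := by
    rw [socle_dualHom hT hj hφ]; exact Submodule.mem_span_singleton_self φ₀
  intro h
  have h1 := congrArg (fun y => DualHom.eval (y.hom.hom ⟨φ₀, hmem⟩) (charTilting.ι T Γ m)) h
  exact one_ne_zero ((socle_functional_ne_zero hj hφ).symm.trans h1)

/-- The value of φ₀ on j ≫ x ≫ f is the coefficient of j in a map factoring through some y : X ⟶
T_m, which vanishes by hypothesis. -/
theorem dualSimpleInclusion_map_eq_zero (hT : ∀ l, H.IsIndecomposableTilting l (T l)) (m : Γ)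
    {j : H.Δ m ⟶ T m} (hj : H.IsStandardEmbedding j) {X : C} (x : T m ⟶ X)
    (h : ∀ y : X ⟶ T m, j ≫ x ≫ y = 0) :
    H.dualSimpleInclusion T Γ m ≫ (H.dualHomFunctor (charTilting T Γ)).map (j ≫ x) = 0 := by
  obtain ⟨φ₀, hφ⟩ := exists_socle_functional hT m hj
  have hmem : φ₀ ∈ socle (RingelAlgebra T Γ) (DualHom k (charTilting T Γ) (H.Δ m)) := by
    rw [socle_dualHom hT hj hφ]; exact Submodule.mem_span_singleton_self φ₀
  refine dualSimple_hom_ext hT hj hφ hmem (DualHom.ext fun f => ?_)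
  change φ₀.eval ((j ≫ x) ≫ f) = 0
  have hne : j ≠ 0 := fun h => H.standard_not_isZero m (have := hj.mono; IsZero.of_mono_eq_zero j h)
  have h1 := hφ ((j ≫ x) ≫ f)
  rw [Category.assoc, Category.assoc, h] at h1
  exact (smul_eq_zero.1 h1.symm).resolve_right hne

theorem finrank_dualSimple_hom (hT : ∀ l, H.IsIndecomposableTilting l (T l)) (m g : Γ)
    [Decidable (g = m)] :
    Module.Finite k (H.dualSimple T Γ m ⟶ (H.dualHomFunctor (charTilting T Γ)).obj (T g)) ∧
    Module.finrank k (H.dualSimple T Γ m ⟶ (H.dualHomFunctor (charTilting T Γ)).obj (T g)) =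
      if g = m then 1 else 0 := by
  split_ifs with h
  · subst h
    obtain ⟨j, hj⟩ := (hT g).exists_isStandardEmbedding
    have h1 := (finrank_eq_one_iff_of_nonzero' (K := k) _
      (dualSimpleInclusion_map_ne_zero hT g hj)).2 (dualSimple_hom_eq_smul hT g hj)
    exact ⟨Module.finite_of_finrank_eq_succ h1, h1⟩
  · have : Subsingleton (H.dualSimple T Γ m ⟶ (H.dualHomFunctor (charTilting T Γ)).obj (T g)) :=
      subsingleton_of_forall_eq 0 (dualSimple_hom_eq_zero hT (Ne.symm h))
    exact ⟨inferInstance, Module.finrank_zero_of_subsingleton⟩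

end

end HighestWeightCategory

namespace HighestWeightCategory

variable {H : HighestWeightCategory k C Λ} {T : Λ → C} {Γ : LowerSet Λ} [Finite Γ]

/-- M is a retract of a finite power of T_Γ, whose image is injective by
`injective_dualHomFunctor_self`. -/
theorem injective_dualHomFunctor_obj {M : C} {m : Λ → ℕ} (hM : Decomposes T M m)
    (hI : ∀ l, m l ≠ 0 → l ∈ (Γ : Set Λ)) :
    Injective ((H.dualHomFunctor (charTilting T Γ)).obj M) where
  factors {X Y} g f _ := by
    have := H.injective_dualHomFunctor_self (charTilting T Γ)
    obtain ⟨J, _, γ, ι, π, h1, h2, h3, h4⟩ := hM.mem_of_support hI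
    let F := H.dualHomFunctor (charTilting T Γ)
    let a := fun x => π x ≫ charTilting.ι T Γ (γ x)
    let b := fun x => charTilting.π T Γ (γ x) ≫ ι x
    have hab : ∑ x, F.map (a x) ≫ F.map (b x) = 𝟙 _ := by
      rw [← F.map_id, ← h3, F.map_sum]
      refine Finset.sum_congr rfl fun x _ => ?_
      have h5 := charTilting.ι_π_self T Γ (γ x)
      rw [← F.map_comp]
      simp only [a, b, Category.assoc, reassoc_of% h5]
    refine ⟨∑ x, Injective.factorThru (g ≫ F.map (a x)) f ≫ F.map (b x), ?_⟩
    rw [Preadditive.comp_sum]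
    simp only [Injective.comp_factorThru_assoc, Category.assoc]
    rw [← Preadditive.comp_sum, hab, Category.comp_id]

theorem finrank_dualSimple_hom_of_decomposes (hT : ∀ l, H.IsIndecomposableTilting l (T l)) (μ : Γ)
    {M : C} {m : Λ → ℕ} (hM : Decomposes T M m) (hI : ∀ l, m l ≠ 0 → l ∈ (Γ : Set Λ)) :
    Module.Finite k (H.dualSimple T Γ μ ⟶ (H.dualHomFunctor (charTilting T Γ)).obj M) ∧
    Module.finrank k (H.dualSimple T Γ μ ⟶ (H.dualHomFunctor (charTilting T Γ)).obj M) = m μ := by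
  classical
  obtain ⟨J, _, γ, ι, π, h1, h2, h3, h4⟩ := hM.mem_of_support hI
  let F := H.dualHomFunctor (charTilting T Γ)
  have hfin : ∀ x, Module.Finite k (H.dualSimple T Γ μ ⟶ F.obj (T (γ x))) := fun x =>
    (finrank_dualSimple_hom hT μ (γ x)).1
  let e : (H.dualSimple T Γ μ ⟶ F.obj M) ≃ₗ[k]
      (∀ x, (H.dualSimple T Γ μ ⟶ F.obj (T (γ x)))) :=
    { toFun := fun g x => g ≫ F.map (π x)
      invFun := fun g => ∑ x, g x ≫ F.map (ι x)
      map_add' := fun g g' => funext fun x => Preadditive.add_comp _ _ _ _ _ _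
      map_smul' := fun c g => funext fun x => Linear.smul_comp _ _ _ _ _ _
      left_inv := fun g => by
        simp only [Category.assoc, ← F.map_comp]
        rw [← Preadditive.comp_sum, ← F.map_sum, h3, F.map_id, Category.comp_id]
      right_inv := fun g => funext fun x => by
        simp only [Preadditive.sum_comp, Category.assoc, ← F.map_comp]
        rw [Finset.sum_eq_single x, h1, F.map_id, Category.comp_id]
        · intro y _ hy
          rw [h2 y x hy, F.map_zero, comp_zero]
        · simp }
  refine ⟨Module.Finite.equiv e.symm, ?_⟩
  rw [e.finrank_eq, Module.finrank_pi_fintype, ← h4]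
  have h5 : ∀ x, Module.finrank k (H.dualSimple T Γ μ ⟶ F.obj (T (γ x))) =
      if γ x = μ then 1 else 0 := fun x => (finrank_dualSimple_hom hT μ (γ x)).2
  simp only [h5]
  rw [Finset.sum_boole, Nat.cast_id, Nat.card_eq_fintype_card, Fintype.card_subtype]
  simp only [Subtype.ext_iff]

/-- Minimality of the coresolution becomes minimality of the injective resolution. Only the summands
T_μ of S.X₂ matter. If one of them contributed, some S.X₃ ⟶ T_μ would make the composite T_μ ⟶ S.X₃
⟶ T_μ invertible; this splits T_μ off S.X₂ by a map vanishing on S.X₁, which `hmin` forbids. -/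
theorem dualSimple_hom_comp_eq_zero (hT : ∀ l, H.IsIndecomposableTilting l (T l)) (μ : Γ)
    {S : ShortComplex C} {m : Λ → ℕ} (hM : Decomposes T S.X₂ m)
    (hI : ∀ l, m l ≠ 0 → l ∈ (Γ : Set Λ))
    (hmin : ∀ (Z : C) (g : S.X₂ ⟶ Z) (s : Z ⟶ S.X₂), S.f ≫ g = 0 → s ≫ g = 𝟙 Z → IsZero Z)
    (x : H.dualSimple T Γ μ ⟶ (H.dualHomFunctor (charTilting T Γ)).obj S.X₂) :
    x ≫ (H.dualHomFunctor (charTilting T Γ)).map S.g = 0 := by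
  classical
  obtain ⟨J, _, γ, ι, π, h1, h2, h3, h4⟩ := hM.mem_of_support hI
  let F := H.dualHomFunctor (charTilting T Γ)
  have h5 : x ≫ F.map S.g = ∑ y, (x ≫ F.map (π y)) ≫ F.map (ι y ≫ S.g) := by
    simp only [Category.assoc, ← F.map_comp]
    rw [← Preadditive.comp_sum, ← F.map_sum]
    simp only [← Category.assoc]
    rw [← Preadditive.sum_comp, h3, Category.id_comp]
  refine h5.trans (Finset.sum_eq_zero fun y _ => ?_)
  by_cases hy : μ = γ y
  · subst hy
    obtain ⟨j, hj⟩ := (hT (γ y)).exists_isStandardEmbedding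
    obtain ⟨c, hc⟩ := dualSimple_hom_eq_smul hT (γ y) hj (x ≫ F.map (π y))
    rw [← hc, Linear.smul_comp, Category.assoc, ← F.map_comp,
      dualSimpleInclusion_map_eq_zero hT (γ y) hj, smul_zero]
    intro z
    by_contra hne
    have := (hT (γ y)).isIso_of_comp_ne_zero hj hne
    refine (hT (γ y)).indecomposable.1 (hmin _
      (S.g ≫ z ≫ inv ((ι y ≫ S.g) ≫ z)) (ι y) ?_ ?_)
    · rw [← Category.assoc, S.zero, zero_comp]
    · simpa only [Category.assoc] using IsIso.hom_inv_id ((ι y ≫ S.g) ≫ z)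
  · rw [dualSimple_hom_eq_zero hT hy (x ≫ F.map (π y)), zero_comp]

/-- The multiplicities in a minimal tilting coresolution of `X` are the dimensions of the spaces
`Ext^n(L'_μ, Hom(X, T_Γ)^*)` in the Ringel dual. -/
theorem MinimalCoresolution.finrank_ext (hT : ∀ l, H.IsIndecomposableTilting l (T l)) (μ : Γ)
    {I : Set Λ} (hI : I ⊆ Γ) {X : C} {c : ℕ → Λ → ℕ} (hX : H.MinimalCoresolution T I X c) (n : ℕ) :
    Module.Finite k (Ext (H.dualSimple T Γ μ)
      ((H.dualHomFunctor (charTilting T Γ)).obj X) n) ∧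
    Module.finrank k (Ext (H.dualSimple T Γ μ)
      ((H.dualHomFunctor (charTilting T Γ)).obj X) n) = c n μ := by
  induction hX generalizing n with
  | @zero X h =>
    have := ext_subsingleton_of_isZero_right (X := H.dualSimple T Γ μ) (n := n)
      (Functor.map_isZero (H.dualHomFunctor (charTilting T Γ)) h)
    exact ⟨inferInstance, Module.finrank_zero_of_subsingleton⟩
  | @step S hS h₂ h₃ hmin m hm hmI c hc ih =>
    have hmΓ : ∀ l, m l ≠ 0 → l ∈ (Γ : Set Λ) := fun l hl => hI (hmI l hl)
    -- The image sequence is exact with injective middle term, and maps from L'_μ to that term die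
    -- in the third one. So degree zero counts copies of T_μ in the first tilting term, and higher
    -- degrees shift to the coresolution of S.X₃.
    have hS' := H.dualHomFunctor_shortExact hS
      (ext_succ_of_filtrations h₃ (hasFiltration_N_charTilting Γ hT) 0)
    have hz := dualSimple_hom_comp_eq_zero hT μ hm hmΓ hmin
    have : Injective (S.map (H.dualHomFunctor (charTilting T Γ))).X₂ :=
      injective_dualHomFunctor_obj (H := H) hm hmΓ
    cases n with
    | zero =>
      obtain ⟨e⟩ := nonempty_hom_linearEquiv_of_comp_eq_zero (k := k) hS' (H.dualSimple T Γ μ) hz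
      have e' := (Ext.linearEquiv₀ (R := k)).trans e
      obtain ⟨h1, h2⟩ := finrank_dualSimple_hom_of_decomposes hT μ hm hmΓ
      have h1' : Module.Finite k (H.dualSimple T Γ μ ⟶
        (S.map (H.dualHomFunctor (charTilting T Γ))).X₂) := h1
      exact ⟨Module.Finite.equiv e'.symm, e'.finrank_eq.trans h2⟩
    | succ n =>
      obtain ⟨e⟩ := nonempty_ext_linearEquiv_of_injective (k := k) hS' (H.dualSimple T Γ μ) hz n
      obtain ⟨h1, h2⟩ := ih n
      have h1' : Module.Finite k (Ext (H.dualSimple T Γ μ)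
        (S.map (H.dualHomFunctor (charTilting T Γ))).X₃ n) := h1
      exact ⟨Module.Finite.equiv e, e.finrank_eq.symm.trans h2⟩

end HighestWeightCategory

end RingelDual

/-! ### Dévissage of full faithfulness along distinguished triangles. -/

section FullyFaithful

open Pretriangulated

variable {A : Type*} [Category* A] [Preadditive A] [HasZeroObject A] [HasShift A ℤ]
  [∀ n : ℤ, (shiftFunctor A n).Additive] [Pretriangulated A]
  {B : Type*} [Category* B] [Preadditive B] [HasZeroObject B] [HasShift B ℤ]
  [∀ n : ℤ, (shiftFunctor B n).Additive] [Pretriangulated B]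
  (F : A ⥤ B) [F.CommShift ℤ] [F.IsTriangulated]

/-- The functor `F` is bijective on morphisms from `X` to `Y`. -/
def MapBijective {A : Type*} [Category* A] {B : Type*} [Category* B] (F : A ⥤ B) (X Y : A) : Prop :=
  Function.Bijective (F.map : (X ⟶ Y) → (F.obj X ⟶ F.obj Y))

theorem MapBijective.of_iso {A : Type*} [Category* A] {B : Type*} [Category* B] {F : A ⥤ B}
    {X X' Y Y' : A} (h : MapBijective F X Y) (e : X ≅ X') (e' : Y ≅ Y') : MapBijective F X' Y' := by
  constructor
  · intro f g hfg
    have h1 : e.hom ≫ f ≫ e'.inv = e.hom ≫ g ≫ e'.inv := h.1 (by simp [hfg])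
    simpa using h1
  · intro f
    obtain ⟨g, hg⟩ := h.2 (F.map e.hom ≫ f ≫ F.map e'.inv)
    exact ⟨e.inv ≫ g ≫ e'.hom, by simp [hg]⟩

variable {F}

/-- Exactness at the first vertex, before and after F, packaged so that the rotated triangle need
not be handled again. -/
theorem exists_connecting_morphism {T : Triangle A} (hT : T ∈ distTriang A) :
    ∃ w : T.obj₃⟦(-1 : ℤ)⟧ ⟶ T.obj₁, w ≫ T.mor₁ = 0 ∧
      (∀ {Y : A} (f : T.obj₁ ⟶ Y), w ≫ f = 0 → ∃ g : T.obj₂ ⟶ Y, f = T.mor₁ ≫ g) ∧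
      ∀ {X : B} (f : X ⟶ F.obj T.obj₁), f ≫ F.map T.mor₁ = 0 →
        ∃ g : X ⟶ F.obj (T.obj₃⟦(-1 : ℤ)⟧), f = g ≫ F.map w :=
  have hT' := inv_rot_of_distTriang _ hT
  ⟨T.invRotate.mor₁, comp_distTriang_mor_zero₁₂ _ hT',
    fun f hf => Triangle.yoneda_exact₂ _ hT' f hf,
    fun f hf => Triangle.coyoneda_exact₂ _ (F.map_distinguished _ hT') f hf⟩

/-- The five lemma for the long exact sequences of Hom(-, Y) and Hom(F -, F Y), by diagram chase. -/
theorem mapBijective_of_triangle_left {T : Triangle A} (hT : T ∈ distTriang A) {Y : A}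
    (h₁ : MapBijective F T.obj₁ Y) (h₃ : MapBijective F T.obj₃ Y)
    (h₁' : MapBijective F (T.obj₁⟦(1 : ℤ)⟧) Y) (h₃' : MapBijective F (T.obj₃⟦(-1 : ℤ)⟧) Y) :
    MapBijective F T.obj₂ Y := by
  have hF := F.map_distinguished T hT
  have hF₂ : ∀ f : F.obj T.obj₂ ⟶ F.obj Y, F.map T.mor₁ ≫ f = 0 →
      ∃ g : F.obj T.obj₃ ⟶ F.obj Y, f = F.map T.mor₂ ≫ g :=
    fun f hf => Triangle.yoneda_exact₂ _ hF f hf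
  have hF₃ : ∀ f : F.obj T.obj₃ ⟶ F.obj Y, F.map T.mor₂ ≫ f = 0 →
      ∃ g : (F.obj T.obj₁)⟦(1 : ℤ)⟧ ⟶ F.obj Y,
        f = (F.map T.mor₃ ≫ (F.commShiftIso (1 : ℤ)).hom.app T.obj₁) ≫ g :=
    fun f hf => Triangle.yoneda_exact₃ _ hF f hf
  obtain ⟨w, hw, hw', -⟩ := exists_connecting_morphism (F := F) hT
  constructor
  · refine (injective_iff_map_eq_zero (F.mapAddHom : (T.obj₂ ⟶ Y) →+ _)).2 fun b hb => ?_
    have hb : F.map b = 0 := hb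
    obtain ⟨c, rfl⟩ := Triangle.yoneda_exact₂ T hT b (h₁.1 (by simp [hb]))
    obtain ⟨e, he⟩ := hF₃ (F.map c) (by simpa using hb)
    obtain ⟨e', he'⟩ := h₁'.2 ((F.commShiftIso (1 : ℤ)).hom.app T.obj₁ ≫ e)
    have h : c = T.mor₃ ≫ e' := h₃.1 (by rw [F.map_comp, he', he, Category.assoc])
    rw [h, ← Category.assoc, comp_distTriang_mor_zero₂₃ _ hT, zero_comp]
  · intro g
    obtain ⟨a, ha⟩ := h₁.2 (F.map T.mor₁ ≫ g)
    obtain ⟨b, rfl⟩ := hw' a (h₃'.1 (by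
      rw [F.map_comp, ha, ← Category.assoc, ← F.map_comp, hw]
      simp))
    obtain ⟨c, hc⟩ := hF₂ (g - F.map b) (by
      rw [Preadditive.comp_sub, ← ha, ← F.map_comp, sub_self])
    obtain ⟨c', hc'⟩ := h₃.2 c
    refine ⟨b + T.mor₂ ≫ c', ?_⟩
    rw [F.map_add, F.map_comp, hc', ← hc]
    abel

theorem mapBijective_of_triangle_right {T : Triangle A} (hT : T ∈ distTriang A) {X : A}
    (h₁ : MapBijective F X T.obj₁) (h₃ : MapBijective F X T.obj₃)
    (h₁' : MapBijective F X (T.obj₁⟦(1 : ℤ)⟧)) (h₃' : MapBijective F X (T.obj₃⟦(-1 : ℤ)⟧)) :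
    MapBijective F X T.obj₂ := by
  have hF := F.map_distinguished T hT
  have hF₂ : ∀ f : F.obj X ⟶ F.obj T.obj₂, f ≫ F.map T.mor₂ = 0 →
      ∃ g : F.obj X ⟶ F.obj T.obj₁, f = g ≫ F.map T.mor₁ :=
    fun f hf => Triangle.coyoneda_exact₂ _ hF f hf
  obtain ⟨w, hw, -, hw'⟩ := exists_connecting_morphism (F := F) hT
  constructor
  · refine (injective_iff_map_eq_zero (F.mapAddHom : (X ⟶ T.obj₂) →+ _)).2 fun b hb => ?_
    have hb : F.map b = 0 := hb
    obtain ⟨c, rfl⟩ := Triangle.coyoneda_exact₂ T hT b (h₃.1 (by simp [hb]))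
    obtain ⟨e, he⟩ := hw' (F.map c) (by simpa using hb)
    obtain ⟨e', he'⟩ := h₃'.2 e
    have h : c = e' ≫ w := h₁.1 (by rw [F.map_comp, he', he])
    rw [h, Category.assoc, hw, comp_zero]
  · intro g
    obtain ⟨a, ha⟩ := h₃.2 (g ≫ F.map T.mor₂)
    obtain ⟨b, hb⟩ := Triangle.coyoneda_exact₃ _ hT a (h₁'.1 (by
      rw [F.map_comp, ha, Category.assoc, ← F.map_comp, comp_distTriang_mor_zero₂₃ _ hT]
      simp))
    obtain ⟨c, hc⟩ := hF₂ (g - F.map b) (by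
      rw [Preadditive.sub_comp, ← ha, ← F.map_comp, ← hb, sub_self])
    obtain ⟨c', hc'⟩ := h₁.2 c
    refine ⟨b + c' ≫ T.mor₁, ?_⟩
    rw [F.map_add, F.map_comp, hc', ← hc]
    abel

theorem mapBijective_shift_of_triangle_left {T : Triangle A} (hT : T ∈ distTriang A) {Y : A}
    (h₁ : ∀ n : ℤ, MapBijective F (T.obj₁⟦n⟧) Y) (h₃ : ∀ n : ℤ, MapBijective F (T.obj₃⟦n⟧) Y)
    (n : ℤ) : MapBijective F (T.obj₂⟦n⟧) Y :=
  mapBijective_of_triangle_left (T.shift_distinguished hT n) (h₁ n) (h₃ n)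
    ((h₁ (n + 1)).of_iso ((shiftFunctorAdd A n 1).app _) (Iso.refl _))
    ((h₃ (n + (-1))).of_iso ((shiftFunctorAdd A n (-1)).app _) (Iso.refl _))

theorem mapBijective_shift_of_triangle_right {T : Triangle A} (hT : T ∈ distTriang A) {X : A}
    (h₁ : ∀ n : ℤ, MapBijective F X (T.obj₁⟦n⟧)) (h₃ : ∀ n : ℤ, MapBijective F X (T.obj₃⟦n⟧))
    (n : ℤ) : MapBijective F X (T.obj₂⟦n⟧) :=
  mapBijective_of_triangle_right (T.shift_distinguished hT n) (h₁ n) (h₃ n)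
    ((h₁ (n + 1)).of_iso (Iso.refl _) ((shiftFunctorAdd A n 1).app _))
    ((h₃ (n + (-1))).of_iso (Iso.refl _) ((shiftFunctorAdd A n (-1)).app _))

end FullyFaithful

/-! ### Induction on the length of bounded complexes. -/

section Bounded

open Pretriangulated

variable {C : Type u} [Category.{v} C] [Abelian C]

/-- The top term of a bounded above complex, as a degreewise split subcomplex. -/
theorem exists_top_triangle (K : CochainComplex C ℤ) (b : ℤ) [K.IsStrictlyLE b] :
    ∃ (K' : CochainComplex C ℤ) (T : Triangle (HomotopyCategory C (ComplexShape.up ℤ))),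
      T ∈ distTriang _ ∧
      T.obj₁ = (HomotopyCategory.quotient C _).obj
        ((HomologicalComplex.single C (ComplexShape.up ℤ) b).obj (K.X b)) ∧
      T.obj₂ = (HomotopyCategory.quotient C _).obj K ∧
      T.obj₃ = (HomotopyCategory.quotient C _).obj K' ∧
      IsZero (K'.X b) ∧ ∀ n, n ≠ b → Nonempty (K.X n ≅ K'.X n) := by
  let f : (HomologicalComplex.single C (ComplexShape.up ℤ) b).obj (K.X b) ⟶ K :=
    HomologicalComplex.mkHomFromSingle (𝟙 _) (fun j hj => by
      obtain rfl : b + 1 = j := hj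
      exact (K.isZero_of_isStrictlyLE b (b + 1)).eq_of_tgt _ _)
  have hb : IsIso (f.f b) := by
    simp only [f, HomologicalComplex.mkHomFromSingle_f, Category.comp_id]
    infer_instance
  have hz : ∀ n, n ≠ b → IsZero
      (((HomologicalComplex.single C (ComplexShape.up ℤ) b).obj (K.X b)).X n) := fun n hn =>
    HomologicalComplex.isZero_single_obj_X _ _ _ _ hn
  have hmono : Mono f := by
    refine HomologicalComplex.mono_of_mono_f f fun n => ?_
    by_cases hn : n = b
    · subst hn; infer_instance
    · exact ⟨fun g h _ => (hz n hn).eq_of_tgt _ _⟩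
  let S := ShortComplex.mk f (cokernel.π f) (cokernel.condition f)
  have hS : S.ShortExact := shortExact_cokernel f
  have hSn : ∀ n, (S.map (HomologicalComplex.eval C _ n)).ShortExact := fun n =>
    hS.map_of_exact (HomologicalComplex.eval C _ n)
  have h0 : IsZero ((cokernel f).X b) := (hSn b).isIso_f_iff.1 hb
  have hi : ∀ n, n ≠ b → IsIso ((cokernel.π f).f n) := fun n hn => (hSn n).isIso_g_iff.2 (hz n hn)
  let σ : ∀ n, (S.map (HomologicalComplex.eval C _ n)).Splitting := fun n =>
    if hn : n = b then ShortComplex.Splitting.ofIsIsoOfIsZero _ (by subst hn; exact hb)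
      (by subst hn; exact h0)
    else ShortComplex.Splitting.ofIsZeroOfIsIso _ (hz n hn) (hi n hn)
  refine ⟨cokernel f, CochainComplex.trianglehOfDegreewiseSplit S σ,
    (HomotopyCategory.distinguished_iff_iso_trianglehOfDegreewiseSplit _).2 ⟨S, σ, ⟨Iso.refl _⟩⟩,
    rfl, rfl, rfl, h0, fun n hn => ?_⟩
  have := hi n hn
  exact ⟨asIso ((cokernel.π f).f n)⟩

/-- Split off the top term until none is left. The terms of the quotient complex are known only up
to isomorphism, whence the invariance required of R. -/
theorem bounded_complex_induction {P : HomotopyCategory C (ComplexShape.up ℤ) → Prop}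
    {R : C → Prop} (hR : ∀ {X Y : C}, (X ≅ Y) → R X → R Y) (hR0 : ∀ X, IsZero X → R X)
    (h0 : ∀ X, IsZero X → P X)
    (hs : ∀ (i : ℤ) (A : C), R A → P ((HomotopyCategory.quotient C _).obj
        ((HomologicalComplex.single C (ComplexShape.up ℤ) i).obj A)))
    (ht : ∀ T : Triangle (HomotopyCategory C (ComplexShape.up ℤ)), T ∈ distTriang _ →
      P T.obj₁ → P T.obj₃ → P T.obj₂)
    (K : CochainComplex C ℤ) (hK : ∀ n, R (K.X n)) {a b : ℤ} (ha : K.IsStrictlyGE a)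
    (hb : K.IsStrictlyLE b) : P ((HomotopyCategory.quotient C _).obj K) := by
  induction hn : (b + 1 - a).toNat generalizing K b with
  | zero =>
    refine h0 _ (Functor.map_isZero _ ?_)
    rw [IsZero.iff_id_eq_zero]
    ext n
    by_cases h : n < a
    · exact (K.isZero_of_isStrictlyGE a n h).eq_of_src _ _
    · exact (K.isZero_of_isStrictlyLE b n (by omega)).eq_of_src _ _
  | succ n ih =>
    obtain ⟨K', T, hT, h1, h2, h3, h4, h5⟩ := exists_top_triangle K b
    rw [← h2]
    refine ht T hT (h1 ▸ hs b _ (hK b)) (h3 ▸ ih (b := b - 1) K' (fun m => ?_) ?_ ?_ (by omega))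
    · by_cases hm : m = b
      · subst hm; exact hR0 _ h4
      · exact hR (h5 m hm).some (hK m)
    · rw [CochainComplex.isStrictlyGE_iff]
      intro m hm
      by_cases hmb : m = b
      · subst hmb; exact h4
      · exact (K.isZero_of_isStrictlyGE a m hm).of_iso (h5 m hmb).some.symm
    · rw [CochainComplex.isStrictlyLE_iff]
      intro m hm
      by_cases hmb : m = b
      · subst hmb; exact h4
      · exact (K.isZero_of_isStrictlyLE b m (by omega)).of_iso (h5 m hmb).some.symm

end Bounded

/-! ### From the homotopy category to the derived category. -/

section Derived

open Pretriangulated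

variable {C : Type u} [Category.{v} C] [Abelian C] [HasDerivedCategory.{w'} C]

/-- For i < j the t-structure forbids nonzero maps; for i > j the maps form a positive Ext group. -/
theorem subsingleton_single_hom [HasExt.{w} C] {A B : C}
    (h : ∀ n : ℕ, Subsingleton (Ext A B (n + 1))) {i j : ℤ} (hij : i ≠ j) :
    Subsingleton ((DerivedCategory.singleFunctor C i).obj A ⟶
      (DerivedCategory.singleFunctor C j).obj B) := by
  refine subsingleton_of_forall_eq 0 fun f => ?_
  rcases lt_or_gt_of_ne hij with h' | h'
  · exact DerivedCategory.TStructure.t.zero_of_isLE_of_isGE f i j h' inferInstance inferInstance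
  · obtain ⟨n, hn⟩ : ∃ n : ℕ, i = j + ((n + 1 : ℕ) : ℤ) :=
      ⟨(i - j - 1).toNat, by omega⟩
    let e₁ := ((DerivedCategory.singleFunctors C).shiftIso i 0 i (by omega)).app A
    let e₂ := ((DerivedCategory.singleFunctors C).shiftIso j 0 j (by omega)).app B
    let e₃ := (shiftFunctorAdd' (DerivedCategory C) j ((n + 1 : ℕ) : ℤ) i hn.symm).app
      ((DerivedCategory.singleFunctor C j).obj B)
    have h1 : Subsingleton ((DerivedCategory.singleFunctor C 0).obj A ⟶
      ((DerivedCategory.singleFunctor C 0).obj B)⟦((n + 1 : ℕ) : ℤ)⟧) :=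
      (Ext.homEquiv (X := A) (Y := B) (n := n + 1)).symm.subsingleton_congr.2 (h n)
    apply (shiftFunctor (DerivedCategory C) i).map_injective
    rw [← cancel_epi e₁.inv, ← cancel_mono (e₃.hom ≫ e₂.hom⟦((n + 1 : ℕ) : ℤ)⟧')]
    exact Subsingleton.elim _ _

theorem mapBijective_Qh_single [HasExt.{w} C] {A B : C}
    (h : ∀ n : ℕ, Subsingleton (Ext A B (n + 1))) (i j : ℤ) :
    MapBijective (DerivedCategory.Qh (C := C))
      ((HomotopyCategory.quotient C _).obj
        ((HomologicalComplex.single C (ComplexShape.up ℤ) i).obj A))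
      ((HomotopyCategory.quotient C _).obj
        ((HomologicalComplex.single C (ComplexShape.up ℤ) j).obj B)) := by
  by_cases hij : i = j
  · subst hij
    let F := HomologicalComplex.single C (ComplexShape.up ℤ) i
    let G := HomotopyCategory.quotient C (ComplexShape.up ℤ)
    have h1 : Function.Surjective fun f : A ⟶ B => G.map (F.map f) :=
      G.map_surjective.comp F.map_surjective
    have h2 : Function.Bijective fun f : A ⟶ B => DerivedCategory.Qh.map (G.map (F.map f)) :=
      ⟨(DerivedCategory.singleFunctor C i).map_injective,
        (DerivedCategory.singleFunctor C i).map_surjective⟩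
    refine ⟨fun f g hfg => ?_, fun f => ?_⟩
    · obtain ⟨f, rfl⟩ := h1 f
      obtain ⟨g, rfl⟩ := h1 g
      exact congrArg (fun f => G.map (F.map f)) (h2.1 hfg)
    · obtain ⟨g, hg⟩ := h2.2 f
      exact ⟨_, hg⟩
  · have := subsingleton_single_hom h hij
    refine ⟨fun f g _ => ?_, fun f => ⟨0, Subsingleton.elim (α :=
      (DerivedCategory.singleFunctor C i).obj A ⟶ (DerivedCategory.singleFunctor C j).obj B) _ _⟩⟩
    obtain ⟨f, rfl⟩ := (HomotopyCategory.quotient C _).map_surjective f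
    obtain ⟨g, rfl⟩ := (HomotopyCategory.quotient C _).map_surjective g
    congr 1
    refine HomologicalComplex.hom_ext _ _ fun n => ?_
    by_cases hn : n = i
    · subst hn
      exact (HomologicalComplex.isZero_single_obj_X _ _ _ _ hij).eq_of_tgt _ _
    · exact (HomologicalComplex.isZero_single_obj_X _ _ _ _ hn).eq_of_src _ _

/-- Dévissage in the target and then in the source reduces to single objects. All shifts are carried
along because the five lemma involves neighbouring ones. -/
theorem mapBijective_Qh [HasExt.{w} C] {R R' : C → Prop} (hR : ∀ {X Y : C}, (X ≅ Y) → R X → R Y)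
    (hR0 : ∀ X, IsZero X → R X) (hR' : ∀ {X Y : C}, (X ≅ Y) → R' X → R' Y)
    (hR0' : ∀ X, IsZero X → R' X)
    (h : ∀ A B, R A → R' B → ∀ n : ℕ, Subsingleton (Ext A B (n + 1)))
    {K K' : CochainComplex C ℤ} (hK : ∀ n, R (K.X n)) (hK' : ∀ n, R' (K'.X n)) {a b a' b' : ℤ}
    (ha : K.IsStrictlyGE a) (hb : K.IsStrictlyLE b) (ha' : K'.IsStrictlyGE a')
    (hb' : K'.IsStrictlyLE b') :
    MapBijective (DerivedCategory.Qh (C := C)) ((HomotopyCategory.quotient C _).obj K)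
      ((HomotopyCategory.quotient C _).obj K') := by
  have hzero : ∀ X Y : HomotopyCategory C (ComplexShape.up ℤ), IsZero X ∨ IsZero Y →
      MapBijective (DerivedCategory.Qh (C := C)) X Y := by
    intro X Y hXY
    have h1 : Subsingleton (X ⟶ Y) := by
      rcases hXY with h | h
      · exact ⟨h.eq_of_src⟩
      · exact ⟨h.eq_of_tgt⟩
    have h2 : Subsingleton (DerivedCategory.Qh.obj X ⟶ DerivedCategory.Qh.obj Y) := by
      rcases hXY with h | h
      · exact ⟨(Functor.map_isZero _ h).eq_of_src⟩
      · exact ⟨(Functor.map_isZero _ h).eq_of_tgt⟩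
    exact ⟨fun _ _ _ => Subsingleton.elim _ _, fun f => ⟨0, Subsingleton.elim _ _⟩⟩
  have hsh : ∀ (i n : ℤ) (A : C), Nonempty (((HomotopyCategory.quotient C _).obj
        ((HomologicalComplex.single C (ComplexShape.up ℤ) (i - n)).obj A)) ≅
      ((HomotopyCategory.quotient C _).obj
        ((HomologicalComplex.single C (ComplexShape.up ℤ) i).obj A))⟦n⟧) := fun i n A =>
    ⟨(((HomotopyCategory.singleFunctors C).shiftIso n (i - n) i (by omega)).app A).symm⟩
  have hsing : ∀ (i : ℤ) (A : C), R A →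
      MapBijective (DerivedCategory.Qh (C := C)) ((HomotopyCategory.quotient C _).obj
        ((HomologicalComplex.single C (ComplexShape.up ℤ) i).obj A))
        ((HomotopyCategory.quotient C _).obj K') := fun i A hA => by
    have h1 := bounded_complex_induction
      (P := fun Y => ∀ n : ℤ, MapBijective (DerivedCategory.Qh (C := C))
        ((HomotopyCategory.quotient C _).obj
          ((HomologicalComplex.single C (ComplexShape.up ℤ) i).obj A)) (Y⟦n⟧)) hR' hR0'
      (fun X hX n => hzero _ _ (Or.inr (Functor.map_isZero _ hX)))
      (fun j B hB n => (mapBijective_Qh_single (h A B hA hB) i (j - n)).of_iso (Iso.refl _)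
        (hsh j n B).some)
      (fun T hT h₁ h₃ => mapBijective_shift_of_triangle_right hT h₁ h₃) K' hK' ha' hb'
    exact (h1 0).of_iso (Iso.refl _) ((shiftFunctorZero _ ℤ).app _)
  have h1 := bounded_complex_induction
    (P := fun X => ∀ n : ℤ, MapBijective (DerivedCategory.Qh (C := C)) (X⟦n⟧)
      ((HomotopyCategory.quotient C _).obj K')) hR hR0
    (fun X hX n => hzero _ _ (Or.inl (Functor.map_isZero _ hX)))
    (fun i A hA n => (hsing (i - n) A hA).of_iso (hsh i n A).some (Iso.refl _))
    (fun T hT h₁ h₃ => mapBijective_shift_of_triangle_left hT h₁ h₃) K hK ha hb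
  exact (h1 0).of_iso ((shiftFunctorZero _ ℤ).app _) (Iso.refl _)

end Derived

section Derived

variable {k : Type t} [Field k] {C : Type u} [Category.{v} C] [Abelian C] [Linear k C]
  [HasExt.{w} C] [HasDerivedCategory.{w'} C] {Λ : Type s} [PartialOrder Λ]
  {H : HighestWeightCategory k C Λ}

namespace HighestWeightCategory

theorem IsTiltingComplex.mapBijective {K K' : CochainComplex C ℤ} (hK : H.IsTiltingComplex K)
    (hK' : H.IsTiltingComplex K') :
    MapBijective (DerivedCategory.Qh (C := C)) ((HomotopyCategory.quotient C _).obj K)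
      ((HomotopyCategory.quotient C _).obj K') := by
  obtain ⟨a, b, ha, hb⟩ := hK.bounded
  obtain ⟨a', b', ha', hb'⟩ := hK'.bounded
  exact mapBijective_Qh (R := HasFiltration H.Δ) (R' := HasFiltration H.N)
    (fun e h => h.of_iso e) (fun _ h => .zero h) (fun e h => h.of_iso e) (fun _ h => .zero h)
    (fun A B hA hB n => ext_succ_of_filtrations hA hB n) (fun n => (hK.tilting n).1)
    (fun n => (hK'.tilting n).2) ha hb ha' hb'

theorem IsTiltingComplex.exists_map_eq {K K' : CochainComplex C ℤ} (hK : H.IsTiltingComplex K)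
    (hK' : H.IsTiltingComplex K') (f : DerivedCategory.Q.obj K ⟶ DerivedCategory.Q.obj K') :
    ∃ φ : K ⟶ K', DerivedCategory.Q.map φ = f := by
  obtain ⟨g, hg⟩ := (hK.mapBijective hK').2 f
  obtain ⟨φ, rfl⟩ := (HomotopyCategory.quotient C _).map_surjective g
  exact ⟨φ, hg⟩

theorem IsTiltingComplex.nonempty_homotopy {K K' : CochainComplex C ℤ} (hK : H.IsTiltingComplex K)
    (hK' : H.IsTiltingComplex K') {f g : K ⟶ K'}
    (h : DerivedCategory.Q.map f = DerivedCategory.Q.map g) : Nonempty (Homotopy f g) :=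
  ⟨HomotopyCategory.homotopyOfEq _ _ ((hK.mapBijective hK').1 h)⟩

end HighestWeightCategory

end Derived

/-! ### Objects represented by tilting complexes with given multiplicities. -/

section HasTilt

open Pretriangulated ZeroObject

variable {k : Type t} [Field k] {C : Type u} [Category.{v} C] [Abelian C] [Linear k C]
  [HasExt.{w} C] {Λ : Type s} [PartialOrder Λ]

namespace HighestWeightCategory

theorem IsTiltingComplex.shift {H : HighestWeightCategory k C Λ} {K : CochainComplex C ℤ}
    (hK : H.IsTiltingComplex K) (n : ℤ) : H.IsTiltingComplex (K⟦n⟧) := by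
  obtain ⟨a, b, ha, hb⟩ := hK.bounded
  exact ⟨fun i => hK.tilting (i + n), a - n, b - n, K.isStrictlyGE_shift a n _ (by omega),
    K.isStrictlyLE_shift b n _ (by omega)⟩

theorem IsTiltingComplex.mappingCone {H : HighestWeightCategory k C Λ} {K L : CochainComplex C ℤ}
    (hK : H.IsTiltingComplex K) (hL : H.IsTiltingComplex L) (φ : K ⟶ L) :
    H.IsTiltingComplex (CochainComplex.mappingCone φ) := by
  obtain ⟨a, b, ha, hb⟩ := hK.bounded
  obtain ⟨a', b', ha', hb'⟩ := hL.bounded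
  refine ⟨fun n => ?_, min (a - 1) a', max b b', ?_, ?_⟩
  · let e : K.X (n + 1) ⊞ L.X n ≅ (CochainComplex.mappingCone φ).X n :=
      { hom := biprod.desc ((CochainComplex.mappingCone.inl φ).v (n + 1) n (by omega))
          ((CochainComplex.mappingCone.inr φ).f n)
        inv := biprod.lift ((CochainComplex.mappingCone.fst φ).1.v n (n + 1) rfl)
          ((CochainComplex.mappingCone.snd φ).v n n (add_zero n))
        hom_inv_id := by ext <;> simp
        inv_hom_id := by simp [CochainComplex.mappingCone.id_X φ n (n + 1) rfl] }
    exact ((hK.tilting (n + 1)).biprod (hL.tilting n)).of_iso e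
  · rw [CochainComplex.isStrictlyGE_iff]
    intro i hi
    rw [CochainComplex.mappingCone.isZero_X_iff]
    exact ⟨K.isZero_of_isStrictlyGE a _ (by omega), L.isZero_of_isStrictlyGE a' _ (by omega)⟩
  · rw [CochainComplex.isStrictlyLE_iff]
    intro i hi
    rw [CochainComplex.mappingCone.isZero_X_iff]
    exact ⟨K.isZero_of_isStrictlyLE b _ (by omega), L.isZero_of_isStrictlyLE b' _ (by omega)⟩

variable [HasDerivedCategory.{w'} C] (H : HighestWeightCategory k C Λ) (T : Λ → C)

/-- The object `X` of the derived category is represented by a bounded complex of tilting objects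
in which `T_l` has multiplicity `m i l` in degree `i`. -/
def HasTilt (X : DerivedCategory C) (m : ℤ → Λ → ℕ) : Prop :=
  ∃ K : CochainComplex C ℤ, H.IsTiltingComplex K ∧ (∀ i, Decomposes T (K.X i) (m i)) ∧
    Nonempty (DerivedCategory.Q.obj K ≅ X)

variable {H T}

theorem HasTilt.shift {X : DerivedCategory C} {m : ℤ → Λ → ℕ} (h : H.HasTilt T X m) (n : ℤ) :
    H.HasTilt T (X⟦n⟧) (fun i => m (i + n)) := by
  obtain ⟨K, h1, h2, ⟨e⟩⟩ := h
  exact ⟨K⟦n⟧, h1.shift n, fun i => h2 (i + n),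
    ⟨(DerivedCategory.Q.commShiftIso n).app K ≪≫ (shiftFunctor _ n).mapIso e⟩⟩

theorem HasTilt.of_isZero {X : DerivedCategory C} (h : IsZero X) : H.HasTilt T X 0 := by
  have h0 : ∀ i, IsZero ((0 : CochainComplex C ℤ).X i) := fun i =>
    Functor.map_isZero (HomologicalComplex.eval C _ i) (isZero_zero _)
  refine ⟨0, ⟨fun n => .of_isZero (h0 n), 0, 0, ?_, ?_⟩, fun i => .of_isZero (h0 i),
    ⟨(Functor.map_isZero _ (isZero_zero _)).iso h⟩⟩
  · rw [CochainComplex.isStrictlyGE_iff]; exact fun i _ => h0 i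
  · rw [CochainComplex.isStrictlyLE_iff]; exact fun i _ => h0 i

/-- By full faithfulness the first morphism of the triangle is represented by a chain map of tilting
complexes; its mapping cone has the terms K.X (i + 1) ⊞ L.X i. -/
theorem HasTilt.cone {S : Triangle (DerivedCategory C)} (hS : S ∈ distTriang _)
    {m n : ℤ → Λ → ℕ} (h₁ : H.HasTilt T S.obj₁ m) (h₂ : H.HasTilt T S.obj₂ n) :
    H.HasTilt T S.obj₃ (fun i => m (i + 1) + n i) := by
  obtain ⟨K, hK, hKm, ⟨e⟩⟩ := h₁
  obtain ⟨L, hL, hLn, ⟨e'⟩⟩ := h₂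
  obtain ⟨φ, hφ⟩ := hK.exists_map_eq hL (e.hom ≫ S.mor₁ ≫ e'.inv)
  refine ⟨CochainComplex.mappingCone φ, hK.mappingCone hL φ, fun i => ?_, ⟨?_⟩⟩
  · refine (hKm (i + 1)).add (hLn i)
      (i := (CochainComplex.mappingCone.inl φ).v (i + 1) i (by omega))
      (r := (CochainComplex.mappingCone.fst φ).1.v i (i + 1) rfl)
      (j := (CochainComplex.mappingCone.inr φ).f i)
      (q := (CochainComplex.mappingCone.snd φ).v i i (add_zero i)) ?_ ?_ ?_ ?_ ?_
    · simp
    · simp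
    · simp
    · simp
    · exact CochainComplex.mappingCone.id_X φ i (i + 1) rfl
  · exact Triangle.π₃.mapIso (isoTriangleOfIso₁₂ _ _
      (DerivedCategory.mappingCone_triangle_distinguished φ) hS e e' (by
        change DerivedCategory.Q.map φ ≫ e'.hom = e.hom ≫ S.mor₁
        simp [hφ]))

theorem HasTilt.middle {S : Triangle (DerivedCategory C)} (hS : S ∈ distTriang _)
    {m n : ℤ → Λ → ℕ} (h₁ : H.HasTilt T S.obj₁ m) (h₃ : H.HasTilt T S.obj₃ n) :
    H.HasTilt T S.obj₂ (n + m) := by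
  have h := HasTilt.cone (inv_rot_of_distTriang _ hS) (h₃.shift (-1)) h₁
  have hmn : n + m = fun i => n (i + 1 + -1) + m i := by
    ext i l
    simp only [Pi.add_apply, add_neg_cancel_right]
  rw [hmn]
  exact h

theorem HasTilt.single {X : C} {m : Λ → ℕ} (hX : H.IsTilting X) (hm : Decomposes T X m) :
    H.HasTilt T ((DerivedCategory.singleFunctor C 0).obj X) (fun i => if i = 0 then m else 0) := by
  refine ⟨(HomologicalComplex.single C (ComplexShape.up ℤ) 0).obj X, ⟨fun n => ?_, 0, 0,
    inferInstance, inferInstance⟩, fun n => ?_, ⟨Iso.refl _⟩⟩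
  · by_cases hn : n = 0
    · subst hn
      exact hX.of_iso (HomologicalComplex.singleObjXSelf _ _ _).symm
    · exact .of_isZero (HomologicalComplex.isZero_single_obj_X _ _ _ _ hn)
  · by_cases hn : n = 0
    · subst hn
      simpa using hm.of_iso (HomologicalComplex.singleObjXSelf (ComplexShape.up ℤ) 0 X).symm
    · simpa [hn] using Decomposes.of_isZero (T := T)
        (HomologicalComplex.isZero_single_obj_X (ComplexShape.up ℤ) 0 X n hn)

/-- The extension of a sequence by zero to negative degrees. -/
def extendZero (c : ℕ → Λ → ℕ) : ℤ → Λ → ℕ := fun i => if 0 ≤ i then c i.toNat else 0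

/-- Rotating the triangle of S exhibits S.X₁ as an extension of S.X₂ by S.X₃[-1], so the
multiplicities of the coresolution of S.X₃ move up by one degree. -/
theorem MinimalCoresolution.hasTilt {I : Set Λ} {X : C} {c : ℕ → Λ → ℕ}
    (hX : H.MinimalCoresolution T I X c) :
    H.HasTilt T ((DerivedCategory.singleFunctor C 0).obj X) (extendZero c) := by
  induction hX with
  | zero h =>
    convert HasTilt.of_isZero (H := H) (T := T)
      (Functor.map_isZero (DerivedCategory.singleFunctor C 0) h) using 1
    ext i
    simp [extendZero]
  | @step S hS h₂ h₃ hmin m hm hI c hc ih =>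
    have h := HasTilt.middle (inv_rot_of_distTriang _ hS.singleTriangle_distinguished)
      (ih.shift (-1)) (HasTilt.single h₂ hm)
    suffices hcm : extendZero (fun n => Nat.casesOn n m c) =
        (fun i : ℤ => if i = 0 then m else 0) + fun i => extendZero c (i + -1) by
      rw [hcm]
      exact h
    ext i l
    rcases lt_trichotomy i 0 with hi | rfl | hi
    · simp [extendZero, hi.ne, hi.not_ge, show ¬ (1 ≤ i) by omega]
    · simp [extendZero]
    · obtain ⟨n, rfl⟩ : ∃ n : ℕ, i = n + 1 := ⟨(i - 1).toNat, by omega⟩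
      have h1 : ((n : ℤ) + 1).toNat = n + 1 := by omega
      simp [extendZero, h1, hi.ne', show (0 : ℤ) ≤ n + 1 by omega]

end HighestWeightCategory

end HasTilt

/-! ### Morphisms into shifted triangles. -/

section ShiftedTriangles

open Pretriangulated

variable {A : Type*} [Category* A] [Preadditive A] [HasZeroObject A] [HasShift A ℤ]
  [∀ n : ℤ, (shiftFunctor A n).Additive] [Pretriangulated A]

theorem subsingleton_hom_of_iso {A : Type*} [Category* A] {X Y Z : A} (e : X ≅ Y)
    (h : Subsingleton (Z ⟶ X)) : Subsingleton (Z ⟶ Y) :=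
  ⟨fun _ _ => (cancel_mono e.inv).1 (h.elim _ _)⟩

/-- The shifted triangle carries the sign (-1)^n on its morphisms, which is absorbed into the lift.
-/
theorem exists_lift_shift_of_comp_eq_zero {T : Triangle A} (hT : T ∈ distTriang A) (n : ℤ) {Z : A}
    (f : Z ⟶ T.obj₂⟦n⟧) (hf : f ≫ T.mor₂⟦n⟧' = 0) : ∃ g, f = g ≫ T.mor₁⟦n⟧' := by
  have h : ∀ f : Z ⟶ T.obj₂⟦n⟧, f ≫ (n.negOnePow • T.mor₂⟦n⟧') = 0 →
    ∃ g : Z ⟶ T.obj₁⟦n⟧, f = g ≫ (n.negOnePow • T.mor₁⟦n⟧') :=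
    fun f hf => Triangle.coyoneda_exact₂ _ (T.shift_distinguished hT n) f hf
  obtain ⟨g, hg⟩ := h f (by rw [Linear.comp_units_smul, hf, smul_zero])
  exact ⟨n.negOnePow • g, by rw [hg, Linear.comp_units_smul, Linear.units_smul_comp]⟩

theorem exists_lift_shift {T : Triangle A} (hT : T ∈ distTriang A) (n : ℤ) {Z : A}
    (h₁ : Subsingleton (Z ⟶ T.obj₁⟦n + 1⟧)) (f : Z ⟶ T.obj₃⟦n⟧) : ∃ g, f = g ≫ T.mor₂⟦n⟧' := by
  have h1 : Subsingleton (Z ⟶ T.obj₁⟦n⟧⟦(1 : ℤ)⟧) :=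
    subsingleton_hom_of_iso ((shiftFunctorAdd A n 1).app T.obj₁) h₁
  have h : ∀ f : Z ⟶ T.obj₃⟦n⟧, ∃ g : Z ⟶ T.obj₂⟦n⟧, f = g ≫ (n.negOnePow • T.mor₂⟦n⟧') :=
    fun f => Triangle.coyoneda_exact₃ _ (T.shift_distinguished hT n) f (h1.elim _ _)
  obtain ⟨g, hg⟩ := h f
  exact ⟨n.negOnePow • g, by rw [hg, Linear.comp_units_smul, Linear.units_smul_comp]⟩

theorem subsingleton_shift_left {T : Triangle A} (hT : T ∈ distTriang A) (n : ℤ) {Z : A}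
    (h₂ : Subsingleton (Z ⟶ T.obj₂⟦n⟧)) (h₃ : Subsingleton (Z ⟶ T.obj₃⟦n - 1⟧)) :
    Subsingleton (Z ⟶ T.obj₁⟦n⟧) := by
  have h2 : Subsingleton (Z ⟶ T.obj₂⟦n - 1⟧⟦(1 : ℤ)⟧) :=
    subsingleton_hom_of_iso ((shiftFunctorAdd' A (n - 1) 1 n (by omega)).app T.obj₂) h₂
  have h : ∀ f : Z ⟶ T.obj₁⟦n - 1⟧⟦(1 : ℤ)⟧, f = 0 := fun f => by
    obtain ⟨g, hg⟩ := Triangle.coyoneda_exact₁ _ (T.shift_distinguished hT (n - 1)) f (h2.elim _ _)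
    rw [hg]
    exact (congrArg (· ≫ _) (h₃.elim g 0)).trans zero_comp
  have h1 : Subsingleton (Z ⟶ T.obj₁⟦n - 1⟧⟦(1 : ℤ)⟧) := subsingleton_of_forall_eq 0 h
  exact subsingleton_hom_of_iso ((shiftFunctorAdd' A (n - 1) 1 n (by omega)).app T.obj₁).symm h1

theorem subsingleton_shift_middle {T : Triangle A} (hT : T ∈ distTriang A) (n : ℤ) {Z : A}
    (h₁ : Subsingleton (Z ⟶ T.obj₁⟦n⟧)) (h₃ : Subsingleton (Z ⟶ T.obj₃⟦n⟧)) :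
    Subsingleton (Z ⟶ T.obj₂⟦n⟧) := by
  refine subsingleton_of_forall_eq 0 fun f => ?_
  obtain ⟨g, rfl⟩ := exists_lift_shift_of_comp_eq_zero hT n f (h₃.elim _ _)
  rw [h₁.elim g 0, zero_comp]

end ShiftedTriangles

theorem HighestWeightCategory.wellFounded_lt {k : Type t} [Field k] {C : Type u} [Category.{v} C]
    [Abelian C] [Linear k C] [HasExt.{w} C] {Λ : Type s} [PartialOrder Λ]
    (H : HighestWeightCategory k C Λ) :
    WellFounded (fun l m : Λ => l < m) := by
  refine Subrelation.wf (r := InvImage (· < ·) fun l : Λ => (Set.Iic l).ncard) ?_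
    (InvImage.wf _ Nat.lt_wfRel.wf)
  intro l m hlm
  exact Set.ncard_lt_ncard (Set.Iic_ssubset_Iic.2 hlm) (H.lowerFinite m)

/-! ### Duality of shifted standard and costandard objects. -/

section DerivedHoms

open Pretriangulated

variable {k : Type t} [Field k] {C : Type u} [Category.{v} C] [Abelian C] [Linear k C]
  [HasExt.{w} C] [HasDerivedCategory.{w'} C] {Λ : Type s} [PartialOrder Λ]
  (H : HighestWeightCategory k C Λ)

/-- An object of `C` as an object of the derived category. -/
noncomputable abbrev single₀ {C : Type u} [Category.{v} C] [Abelian C] [HasDerivedCategory.{w'} C]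
    (X : C) : DerivedCategory C :=
  (DerivedCategory.singleFunctor C 0).obj X

namespace HighestWeightCategory

/-- An object without morphisms to the shifts of `∇_m` for `m` in an order ideal has no morphisms
to the shifts of objects in the corresponding Serre subcategory. -/
theorem subsingleton_hom_of_costandard {Z : DerivedCategory C} {I : Set Λ} (hI : IsLowerSet I)
    (h : ∀ l ∈ I, ∀ n : ℤ, Subsingleton (Z ⟶ (single₀ (H.N l))⟦n⟧)) {M : C}
    (hM : H.factors M ⊆ I) (n : ℤ) : Subsingleton (Z ⟶ (single₀ M)⟦n⟧) := by
  have key : ∀ {M : C}, (∀ l ∈ H.factors M, ∀ n : ℤ, Subsingleton (Z ⟶ (single₀ (H.L l))⟦n⟧)) →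
      ∀ n : ℤ, Subsingleton (Z ⟶ (single₀ M)⟦n⟧) := by
    intro M hM
    refine H.induction_factors (fun M => ∀ n : ℤ, Subsingleton (Z ⟶ (single₀ M)⟦n⟧))
      (fun X hX n => ?_) (fun X Y e hX n => ?_) (fun S hS h₁ h₃ n => ?_) M hM
    · exact ⟨(Functor.map_isZero (shiftFunctor (DerivedCategory C) n)
        (Functor.map_isZero (DerivedCategory.singleFunctor C 0) hX)).eq_of_tgt⟩
    · exact subsingleton_hom_of_iso ((shiftFunctor (DerivedCategory C) n).mapIso
        ((DerivedCategory.singleFunctor C 0).mapIso e)) (hX n)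
    · exact subsingleton_shift_middle hS.singleTriangle_distinguished n (h₁ n) (h₃ n)
  refine key (fun l hl => ?_) n
  replace hl := hM hl
  clear hM
  induction l using H.wellFounded_lt.induction with
  | _ l ih =>
    intro n
    have := (H.injectiveHull l).mono
    -- L_l sits in ∇_l with a quotient whose factors are smaller than l, so the induction hypothesis
    -- handles the quotient.
    refine subsingleton_shift_left (shortExact_cokernel (H.i l)).singleTriangle_distinguished n
      (h l hl n) (key (fun m hm => ?_) (n - 1))
    have hm' : m < l := H.factors_cokernel_i l hm
    exact ih m hm' (hI hm'.le hl)

theorem nonempty_single₀_shift_iso {C : Type u} [Category.{v} C] [Abelian C]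
    [HasDerivedCategory.{w'} C] (X : C) (j : ℤ) :
    Nonempty ((DerivedCategory.singleFunctor C (-j)).obj X ≅ (single₀ X)⟦j⟧) :=
  ⟨(((DerivedCategory.singleFunctors C).shiftIso j (-j) 0 (by omega)).app X).symm⟩

theorem subsingleton_standard_shift_costandard {l m : Λ} {i j : ℤ} (h : (l, i) ≠ (m, j)) :
    Subsingleton ((single₀ (H.Δ l))⟦i⟧ ⟶ (single₀ (H.N m))⟦j⟧) := by
  obtain ⟨e⟩ := nonempty_single₀_shift_iso (H.Δ l) i
  obtain ⟨e'⟩ := nonempty_single₀_shift_iso (H.N m) j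
  by_cases hij : i = j
  · subst hij
    have hlm : l ≠ m := fun h' => h (by rw [h'])
    refine subsingleton_of_forall_eq 0 fun f => ?_
    obtain ⟨g, hg⟩ := (shiftFunctor (DerivedCategory C) i).map_surjective f
    obtain ⟨g', hg'⟩ := (DerivedCategory.singleFunctor C 0).map_surjective g
    rw [← hg, ← hg', H.standard_costandard_eq_zero hlm g']
    simp
  · have := subsingleton_single_hom (A := H.Δ l) (B := H.N m)
      (fun n => ext_succ_of_filtrations (H := H) (.of_mem l) (.of_mem m) n)
      (i := -i) (j := -j) (by omega)
    refine subsingleton_of_forall_eq 0 fun f => ?_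
    rw [← cancel_epi e.hom, ← cancel_mono e'.inv]
    exact Subsingleton.elim _ _

theorem exists_smul_standard_shift_costandard (l : Λ) (j : ℤ)
    (f : (single₀ (H.Δ l))⟦j⟧ ⟶ (single₀ (H.N l))⟦j⟧) :
    ∃ c : k, f = c • ((DerivedCategory.singleFunctor C 0).map (H.p l ≫ H.i l))⟦j⟧' := by
  obtain ⟨g, hg⟩ := (shiftFunctor (DerivedCategory C) j).map_surjective f
  obtain ⟨g', hg'⟩ := (DerivedCategory.singleFunctor C 0).map_surjective g
  obtain ⟨c, hc⟩ := H.exists_smul_of_standard_costandard l g'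
  refine ⟨c, ?_⟩
  rw [← hg, ← hg', hc, Functor.map_smul, Functor.map_smul]

/-- Morphisms to `∇_l[j]` lift to `Δ_l[j]` if there are no morphisms to the shifts of smaller
costandard objects. -/
theorem exists_lift_standard {X : DerivedCategory C} {l : Λ}
    (h : ∀ m < l, ∀ n : ℤ, Subsingleton (X ⟶ (single₀ (H.N m))⟦n⟧)) (j : ℤ)
    (g : X ⟶ (single₀ (H.N l))⟦j⟧) : ∃ f : X ⟶ (single₀ (H.Δ l))⟦j⟧,
      f ≫ ((DerivedCategory.singleFunctor C 0).map (H.p l ≫ H.i l))⟦j⟧' = g := by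
  have := (H.injectiveHull l).mono
  have := (H.projectiveCover l).epi
  have hI : IsLowerSet (Set.Iio l) := isLowerSet_Iio l
  have h1 := fun n => H.subsingleton_hom_of_costandard hI h (H.factors_kernel_p l) n
  have h2 := fun n => H.subsingleton_hom_of_costandard hI h (H.factors_cokernel_i l) n
  -- The two obstructions to lifting g, first to L_l and then to Δ_l, lie in morphisms to shifts of
  -- ∇_l/L_l and of the kernel of Δ_l → L_l. Both have only factors below l, hence receive no maps
  -- from X.
  obtain ⟨a, ha⟩ : ∃ a : X ⟶ (single₀ (H.L l))⟦j⟧,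
      g = a ≫ ((DerivedCategory.singleFunctor C 0).map (H.i l))⟦j⟧' :=
    exists_lift_shift_of_comp_eq_zero
      (shortExact_cokernel (H.i l)).singleTriangle_distinguished j g ((h2 j).elim _ _)
  obtain ⟨b, hb⟩ : ∃ b : X ⟶ (single₀ (H.Δ l))⟦j⟧,
      a = b ≫ ((DerivedCategory.singleFunctor C 0).map (H.p l))⟦j⟧' :=
    exists_lift_shift
      (shortExact_kernel (H.p l)).singleTriangle_distinguished j (h1 (j + 1)) a
  refine ⟨b, ?_⟩
  rw [Functor.map_comp, Functor.map_comp, ← Category.assoc, ← hb, ← ha]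

end HighestWeightCategory

end DerivedHoms

/-! ### Peeling off standard objects. -/

section Construction

open Pretriangulated

variable {k : Type t} [Field k] {C : Type u} [Category.{v} C] [Abelian C] [Linear k C]
  [HasExt.{w} C] [HasDerivedCategory.{w'} C] {Λ : Type s} [PartialOrder Λ]
  (H : HighestWeightCategory k C Λ)

namespace HighestWeightCategory

section

variable {X X' : DerivedCategory C} {l : Λ} {j : ℤ} {y : X' ⟶ X}
  {f : X ⟶ (single₀ (H.Δ l))⟦j⟧} {δ : (single₀ (H.Δ l))⟦j⟧ ⟶ X'⟦(1 : ℤ)⟧}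

/-- The obstruction to extending a is a map Δ_l[j] → ∇_m[i + 1]. It is zero or a multiple of the
canonical map; since f ≫ δ = 0 while f composed with the canonical map is nonzero, the multiple is
zero too. -/
theorem exists_extension_of_triangle (hS : Triangle.mk y f δ ∈ distTriang _)
    (hf : f ≫ ((DerivedCategory.singleFunctor C 0).map (H.p l ≫ H.i l))⟦j⟧' ≠ 0) {m : Λ} {i : ℤ}
    (a : X' ⟶ (single₀ (H.N m))⟦i⟧) : ∃ b, y ≫ b = a := by
  let e := (shiftFunctorAdd (DerivedCategory C) i 1).app (single₀ (H.N m))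
  have h0 : f ≫ δ = 0 := comp_distTriang_mor_zero₂₃ _ hS
  have h1 : δ ≫ a⟦(1 : ℤ)⟧' ≫ e.inv = 0 := by
    by_cases hlm : (l, j) = (m, i + 1)
    · obtain ⟨rfl, rfl⟩ := Prod.mk.inj hlm
      obtain ⟨c, hc⟩ := H.exists_smul_standard_shift_costandard l (i + 1)
        (δ ≫ a⟦(1 : ℤ)⟧' ≫ e.inv)
      have h2 := f ≫= hc
      rw [← Category.assoc, h0, zero_comp, Linear.comp_smul] at h2
      rw [hc, (smul_eq_zero.1 h2.symm).resolve_right hf, zero_smul]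
    · exact (H.subsingleton_standard_shift_costandard hlm).elim _ _
  have h2 : δ ≫ a⟦(1 : ℤ)⟧' = 0 := by
    rw [← cancel_mono e.inv, Category.assoc, h1, zero_comp]
  obtain ⟨b, hb⟩ : ∃ b : X⟦(1 : ℤ)⟧ ⟶ (single₀ (H.N m))⟦i⟧⟦(1 : ℤ)⟧,
      a⟦(1 : ℤ)⟧' = (-y⟦(1 : ℤ)⟧') ≫ b :=
    Triangle.yoneda_exact₃ _ (rot_of_distTriang _ hS) _ h2
  obtain ⟨b, rfl⟩ := (shiftFunctor (DerivedCategory C) (1 : ℤ)).map_surjective b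
  refine ⟨-b, (shiftFunctor (DerivedCategory C) (1 : ℤ)).map_injective ?_⟩
  rw [hb, Functor.map_comp, Functor.map_neg, Preadditive.comp_neg, Preadditive.neg_comp]

theorem exists_factor_of_triangle (hS : Triangle.mk y f δ ∈ distTriang _) {Y : DerivedCategory C}
    (b : X ⟶ Y) (hb : y ≫ b = 0) : ∃ z, b = f ≫ z :=
  Triangle.yoneda_exact₂ _ hS b hb

/-- Restriction along y is onto, and its kernel consists of the maps that factor through f: a line
if (m, i) = (l, j) and zero otherwise. -/
theorem finrank_hom_of_triangle [DecidableEq (Λ × ℤ)] (hS : Triangle.mk y f δ ∈ distTriang _)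
    (hf : f ≫ ((DerivedCategory.singleFunctor C 0).map (H.p l ≫ H.i l))⟦j⟧' ≠ 0) (m : Λ) (i : ℤ)
    [Module.Finite k (X ⟶ (single₀ (H.N m))⟦i⟧)] :
    Module.Finite k (X' ⟶ (single₀ (H.N m))⟦i⟧) ∧
      Module.finrank k (X' ⟶ (single₀ (H.N m))⟦i⟧) + (if (l, j) = (m, i) then 1 else 0) =
      Module.finrank k (X ⟶ (single₀ (H.N m))⟦i⟧) := by
  let ρ := Linear.leftComp k ((single₀ (H.N m))⟦i⟧) y
  have hρ : Function.Surjective ρ := fun a => H.exists_extension_of_triangle hS hf a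
  refine ⟨Module.Finite.of_surjective ρ hρ, ?_⟩
  rw [← LinearMap.finrank_range_add_finrank_ker ρ, LinearMap.range_eq_top.2 hρ, finrank_top]
  congr 1
  split_ifs with h
  · obtain ⟨rfl, rfl⟩ := Prod.mk.inj h
    symm
    rw [finrank_eq_one_iff']
    refine ⟨⟨f ≫ ((DerivedCategory.singleFunctor C 0).map (H.p l ≫ H.i l))⟦j⟧', ?_⟩,
      fun h => hf (congrArg Subtype.val h), ?_⟩
    · have h0 : y ≫ f = 0 := comp_distTriang_mor_zero₁₂ _ hS
      change y ≫ f ≫ _ = 0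
      rw [← Category.assoc, h0, zero_comp]
    · rintro ⟨b, hb⟩
      obtain ⟨z, rfl⟩ := H.exists_factor_of_triangle hS b hb
      obtain ⟨c, rfl⟩ := H.exists_smul_standard_shift_costandard l j z
      exact ⟨c, Subtype.ext (Linear.comp_smul _ _ _ _ _ _).symm⟩
  · have := H.subsingleton_standard_shift_costandard h
    have : LinearMap.ker ρ = ⊥ := by
      rw [eq_bot_iff]
      intro b hb
      obtain ⟨z, rfl⟩ := H.exists_factor_of_triangle hS b hb
      rw [Submodule.mem_bot, Subsingleton.elim z 0, comp_zero]
    rw [this, finrank_bot]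

end

variable {H}

/-- An object of the derived category with finite-dimensional spaces of morphisms to the shifts
of costandard objects is represented by a complex of tilting objects, with multiplicities
prescribed by the dimensions of these spaces. -/
theorem hasTilt_of_finsupp {T : Λ → C} {c : Λ → ℤ → Λ → ℕ}
    (hc : ∀ l, H.HasTilt T (single₀ (H.Δ l)) (c l)) (h : Λ × ℤ →₀ ℕ) (X : DerivedCategory C)
    (hG : ∀ Z : DerivedCategory C, (∀ (M : C) (n : ℤ), Subsingleton (Z ⟶ (single₀ M)⟦n⟧)) →
      Subsingleton (Z ⟶ X))
    (hX : ∀ l j, Module.Finite k (X ⟶ (single₀ (H.N l))⟦j⟧) ∧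
      Module.finrank k (X ⟶ (single₀ (H.N l))⟦j⟧) = h (l, j)) :
    H.HasTilt T X (fun i => h.sum fun q n => n • c q.1 (i + q.2)) := by
  classical
  induction hd : h.degree generalizing h X with
  | zero =>
    obtain rfl : h = 0 := (Finsupp.degree_eq_zero_iff h).1 hd
    -- Without maps to costandard objects, X has no maps to any shifted object of C. By `hG` it then
    -- has no nonzero endomorphism.
    have h1 : ∀ (M : C) (n : ℤ), Subsingleton (X ⟶ (single₀ M)⟦n⟧) := fun M n =>
      H.subsingleton_hom_of_costandard (I := Set.univ) isLowerSet_univ (fun l _ j => by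
        have := (hX l j).1
        exact Module.finrank_zero_iff.1 (hX l j).2) (Set.subset_univ _) n
    have h2 := hG X h1
    exact HasTilt.of_isZero ((IsZero.iff_id_eq_zero _).2 (h2.elim _ _))
  | succ d ih =>
    have hne : h.support.Nonempty := by
      rw [Finsupp.support_nonempty_iff]
      rintro rfl
      simp at hd
    -- Minimality of l is what allows a map to ∇_l[j] to be lifted to Δ_l[j].
    obtain ⟨l, hl, hmin⟩ := (h.support.image Prod.fst).exists_minimal (hne.image _)
    simp only [Finset.mem_image, Finsupp.mem_support_iff, Prod.exists, exists_and_right,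
      exists_eq_right] at hl hmin
    obtain ⟨j, hj⟩ := hl
    have := (hX l j).1
    have : Nontrivial (X ⟶ (single₀ (H.N l))⟦j⟧) :=
      Module.nontrivial_of_finrank_pos (R := k) (by rw [(hX l j).2]; omega)
    obtain ⟨g, hg⟩ := exists_ne (0 : X ⟶ (single₀ (H.N l))⟦j⟧)
    obtain ⟨f, rfl⟩ := H.exists_lift_standard (fun m hm n => by
      have := (hX m n).1
      refine Module.finrank_zero_iff.1 ((hX m n).2.trans ?_)
      by_contra h0
      exact hm.not_ge (hmin ⟨n, h0⟩ hm.le)) j g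
    obtain ⟨X', y, δ, hS⟩ := distinguished_cocone_triangle₁ f
    have hh : h = (h - Finsupp.single (l, j) 1) + Finsupp.single (l, j) 1 := by
      refine (tsub_add_cancel_of_le ?_).symm
      rw [Finsupp.single_le_iff]
      omega
    set h' := h - Finsupp.single (l, j) 1 with hh'
    have hX' : H.HasTilt T X' (fun i => h'.sum fun q n => n • c q.1 (i + q.2)) := by
      refine ih h' X' (fun Z hZ => ?_) (fun m i => ?_) ?_
      -- The property `hG`, which takes the place of boundedness, passes to the fibre X', an
      -- extension of X by Δ_l[j - 1].
      · refine subsingleton_of_forall_eq 0 fun z => ?_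
        obtain ⟨w, hw⟩ : ∃ w : Z ⟶ (single₀ (H.Δ l))⟦j⟧⟦(-1 : ℤ)⟧, z = w ≫ _ :=
          Triangle.coyoneda_exact₂ _ (inv_rot_of_distTriang _ hS) z ((hG Z hZ).elim _ _)
        have h3 : Subsingleton (Z ⟶ (single₀ (H.Δ l))⟦j⟧⟦(-1 : ℤ)⟧) :=
          subsingleton_hom_of_iso ((shiftFunctorAdd (DerivedCategory C) j (-1)).app _) (hZ _ _)
        exact hw.trans ((congrArg (· ≫ _) (h3.elim w 0)).trans zero_comp)
      · have := (hX m i).1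
        obtain ⟨h3, h4⟩ := H.finrank_hom_of_triangle hS hg m i
        refine ⟨h3, ?_⟩
        have h5 := congrArg (fun q => q (m, i)) hh
        simp only [Finsupp.add_apply, Finsupp.single_apply] at h5
        rw [(hX m i).2, h5] at h4
        exact Nat.add_right_cancel h4
      · have h6 := congrArg Finsupp.degree hh
        rw [map_add, Finsupp.degree_single, hd] at h6
        omega
    have h7 := HasTilt.middle hS hX' ((hc l).shift j)
    have h8 : (fun i => h.sum fun q n => n • c q.1 (i + q.2)) =
        (fun i => c l (i + j)) + fun i => h'.sum fun q n => n • c q.1 (i + q.2) := by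
      ext1 i
      rw [hh, Finsupp.sum_add_index' (by simp) (by intros; rw [add_smul]),
        Finsupp.sum_single_index (by simp), one_smul, add_comm]
      rfl
    rw [h8]
    exact h7

end HighestWeightCategory

end Construction

/-! ### Finiteness of Ext from simple to costandard objects. -/

section ExtFiniteness

variable {k : Type t} [Field k] {C : Type u} [Category.{v} C] [Abelian C] [Linear k C]
  [HasExt.{w} C] {Λ : Type s} [PartialOrder Λ] (H : HighestWeightCategory k C Λ)

namespace HighestWeightCategory

theorem finite_ext_left_of_L {n : ℕ} {X M : C}
    (h : ∀ l ∈ H.factors X, Module.Finite k (Ext (H.L l) M n)) : Module.Finite k (Ext X M n) := by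
  refine H.induction_factors (fun X => Module.Finite k (Ext X M n)) ?_ ?_ ?_ X h
  · intro Y hY
    have : Subsingleton (Ext Y M n) := ext_subsingleton_of_isZero_left hY
    infer_instance
  · intro Y Z e hY
    refine Module.Finite.of_surjective
      ((Ext.mk₀ e.inv).precompOfLinear k M (zero_add n)) fun α => ?_
    refine ⟨(Ext.mk₀ e.hom).comp α (zero_add n), ?_⟩
    simp
  · intro S hS h₁ h₃
    exact finite_of_exact ((Ext.mk₀ S.g).precompOfLinear k M (zero_add n))
      ((Ext.mk₀ S.f).precompOfLinear k M (zero_add n))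
      fun α hα => Ext.contravariant_sequence_exact₂ hS _ α hα

/-- Let R be the kernel of Δ_l → L_l. Since Δ_l has no higher Ext to ∇_m, Ext^j(R, ∇_m) surjects
onto Ext^{j+1}(L_l, ∇_m). -/
theorem finite_ext_L_costandard (l m : Λ) (j : ℕ) : Module.Finite k (Ext (H.L l) (H.N m) j) := by
  induction j generalizing l with
  | zero =>
    have := H.finite_hom (H.L l) (H.N m)
    exact Module.Finite.equiv (Ext.linearEquiv₀ (R := k)).symm
  | succ j ih =>
    have := (H.projectiveCover l).epi
    have hS := shortExact_kernel (H.p l)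
    have : Module.Finite k (Ext (kernel (H.p l)) (H.N m) j) :=
      H.finite_ext_left_of_L fun l' _ => ih l'
    have := ext_succ_of_filtrations (H := H) (.of_mem l) (.of_mem m) j
    refine Module.Finite.of_surjective (hS.extClass.precompOfLinear k (H.N m) (add_comm 1 j))
      fun α => ?_
    exact Ext.contravariant_sequence_exact₃ hS _ α (Subsingleton.elim _ _) (add_comm 1 j)

theorem exists_ext_L_costandard_subsingleton (l m : Λ) :
    ∃ n, ∀ j, n ≤ j → Subsingleton (Ext (H.L l) (H.N m) j) := by
  induction l using H.wellFounded_lt.induction with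
  | _ l ih =>
    choose! n hn using ih
    have := (H.projectiveCover l).epi
    -- By the same dimension shift, one more than a bound for the finitely many smaller factors of
    -- the kernel of p is a bound for l.
    obtain ⟨b, hb⟩ := ((H.factors_finite (kernel (H.p l))).image n).bddAbove
    refine ⟨b + 1, fun j hj => ?_⟩
    obtain ⟨j, rfl⟩ : ∃ i, j = i + 1 := ⟨j - 1, by omega⟩
    refine ext_quotient_left (shortExact_kernel (H.p l)) _ j
      (ext_succ_of_filtrations (H := H) (.of_mem l) (.of_mem m) j)
      (H.ext_subsingleton_left_of_L fun l' hl' => hn l' (H.factors_kernel_p l hl') j ?_)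
    have := hb ⟨l', hl', rfl⟩
    omega

theorem ext_L_costandard_subsingleton {l m : Λ} (h : ¬ m ≤ l) (j : ℕ) :
    Subsingleton (Ext (H.L l) (H.N m) j) := by
  induction j generalizing l with
  | zero =>
    rw [ext_zero_subsingleton_iff]
    intro f
    by_contra hf
    have := H.mem_factors_of_hom_costandard hf
    rw [H.factors_L] at this
    exact h (le_of_eq this)
  | succ j ih =>
    have := (H.projectiveCover l).epi
    refine ext_quotient_left (shortExact_kernel (H.p l)) _ j
      (ext_succ_of_filtrations (H := H) (.of_mem l) (.of_mem m) j)
      (H.ext_subsingleton_left_of_L fun l' hl' => ih fun hm => ?_)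
    exact h (hm.trans (le_of_lt (H.factors_kernel_p l hl')))

theorem subsingleton_single₀_shift {C : Type u} [Category.{v} C] [Abelian C]
    [HasDerivedCategory.{w'} C] (X Y : C) {j : ℤ} (hj : j < 0) :
    Subsingleton (single₀ X ⟶ (single₀ Y)⟦j⟧) := by
  obtain ⟨e⟩ := nonempty_single₀_shift_iso Y j
  refine subsingleton_hom_of_iso e (subsingleton_of_forall_eq 0 fun f => ?_)
  exact DerivedCategory.TStructure.t.zero_of_isLE_of_isGE f 0 (-j) (by omega)
    inferInstance inferInstance

/-- The finitely supported function `(m, j) ↦ dim Ext^j(L_l, ∇_m)`. -/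
theorem exists_finsupp_ext (l : Λ) : ∃ h : Λ × ℤ →₀ ℕ,
    (∀ m (j : ℕ), h (m, j) = Module.finrank k (Ext (H.L l) (H.N m) j)) ∧
    (∀ m j, j < 0 → h (m, j) = 0) ∧ (∀ m j, ¬ m ≤ l → h (m, j) = 0) := by
  classical
  choose n hn using H.exists_ext_L_costandard_subsingleton l
  obtain ⟨b, hb⟩ := ((H.lowerFinite l).image n).bddAbove
  let f : Λ × ℤ → ℕ := fun q =>
    if 0 ≤ q.2 then Module.finrank k (Ext (H.L l) (H.N q.1) q.2.toNat) else 0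
  have hf : (Function.support f).Finite := by
    refine ((H.lowerFinite l).prod (Set.finite_Icc (0 : ℤ) b)).subset fun q hq => ?_
    have h0 : 0 ≤ q.2 := by
      by_contra h
      exact hq (if_neg h)
    have hq' : Module.finrank k (Ext (H.L l) (H.N q.1) q.2.toNat) ≠ 0 := by
      simpa [f, h0] using hq
    have h1 : q.1 ≤ l := by
      by_contra h
      have := H.ext_L_costandard_subsingleton h q.2.toNat
      exact hq' Module.finrank_zero_of_subsingleton
    refine ⟨h1, h0, ?_⟩
    by_contra h
    have h2 := hb ⟨q.1, h1, rfl⟩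
    have := hn q.1 q.2.toNat (by omega)
    exact hq' Module.finrank_zero_of_subsingleton
  refine ⟨Finsupp.ofSupportFinite f hf, fun m j => ?_, fun m j hj => ?_, fun m j hm => ?_⟩
  · change f (m, j) = _
    simp [f]
  · change f (m, j) = _
    simp [f, hj]
  · have := fun i => H.ext_L_costandard_subsingleton hm i
    change f (m, j) = _
    simp [f, Module.finrank_zero_of_subsingleton]

theorem exists_hasTilt_L [HasDerivedCategory.{w'} C] {T : Λ → C} {c : Λ → ℤ → Λ → ℕ}
    (hc : ∀ l, H.HasTilt T (single₀ (H.Δ l)) (c l)) (l : Λ) : ∃ h : Λ × ℤ →₀ ℕ,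
    (∀ m (j : ℕ), h (m, j) = Module.finrank k (Ext (H.L l) (H.N m) j)) ∧
    (∀ m j, j < 0 → h (m, j) = 0) ∧ (∀ m j, ¬ m ≤ l → h (m, j) = 0) ∧
    H.HasTilt T (single₀ (H.L l)) (fun i => h.sum fun q n => n • c q.1 (i + q.2)) := by
  obtain ⟨h, h1, h2, h3⟩ := H.exists_finsupp_ext l
  refine ⟨h, h1, h2, h3, H.hasTilt_of_finsupp hc h _ (fun Z hZ => ?_) (fun m j => ?_)⟩
  -- The test objects include L_l itself in shift zero.
  · exact subsingleton_hom_of_iso ((shiftFunctorZero (DerivedCategory C) ℤ).app _) (hZ (H.L l) 0)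
  · by_cases hj : j < 0
    · have := subsingleton_single₀_shift (H.L l) (H.N m) hj
      exact ⟨inferInstance, by rw [h2 m j hj, Module.finrank_zero_of_subsingleton]⟩
    · obtain ⟨j, rfl⟩ := Int.eq_ofNat_of_zero_le (not_lt.1 hj)
      let e : Ext (H.L l) (H.N m) j ≃ₗ[k] (single₀ (H.L l) ⟶ (single₀ (H.N m))⟦(j : ℤ)⟧) :=
        Ext.homLinearEquiv (R := k)
      have := H.finite_ext_L_costandard l m j
      exact ⟨Module.Finite.equiv e, by rw [h1, e.finrank_eq]⟩

end HighestWeightCategory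

end ExtFiniteness

/-! ### Null-homotopic idempotents of complexes. -/

section NullHomotopicIdempotents

variable {C : Type u} [Category.{v} C] [Abelian C]

theorem nonempty_iso_biprod {A B M : C} {i : A ⟶ M} {r : M ⟶ A} {j : B ⟶ M} {q : M ⟶ B}
    (hir : i ≫ r = 𝟙 A) (hjq : j ≫ q = 𝟙 B) (hiq : i ≫ q = 0) (hjr : j ≫ r = 0)
    (hsum : r ≫ i + q ≫ j = 𝟙 M) : Nonempty (M ≅ A ⊞ B) :=
  ⟨{ hom := biprod.lift r q
     inv := biprod.desc i j
     hom_inv_id := by simp [hsum]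
     inv_hom_id := by ext <;> simp [hir, hjq, hiq, hjr] }⟩

theorem isUnit_one_add_of_mem_jacobson (k : Type*) [Field k] {R : Type*} [Ring R] [Algebra k R]
    [Module.Finite k R] {x : R} (hx : x ∈ Ring.jacobson R) : IsUnit (x + 1) := by
  rw [← Ideal.jacobson_bot] at hx
  obtain ⟨s, hs⟩ := Ideal.exists_mul_add_sub_mem_of_mem_jacobson x hx
  rw [Ideal.mem_bot, sub_eq_zero] at hs
  have := IsArtinianRing.of_finite k R
  exact IsUnit.of_mul_eq_one_right _ hs

/-- A summand of a differential gives a null-homotopic idempotent endomorphism of the complex. -/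
theorem exists_nullHomotopic_idempotent (K : CochainComplex C ℤ) (n : ℤ) {S : C} (s : S ⟶ K.X n)
    (r : K.X (n + 1) ⟶ S) (h : s ≫ K.d n (n + 1) ≫ r = 𝟙 S) :
    ∃ e : K ⟶ K, e ≫ e = e ∧ Nonempty (Homotopy e 0) ∧ e.f n = K.d n (n + 1) ≫ r ≫ s := by
  -- The homotopy has the single component r ≫ s from degree n + 1 to degree n. The induced map is d
  -- ≫ r ≫ s in degree n, r ≫ s ≫ d in degree n + 1 and zero elsewhere; s ≫ d ≫ r = 𝟙 makes it
  -- idempotent.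
  let σ : ∀ i j, (ComplexShape.up ℤ).Rel j i → (K.X i ⟶ K.X j) := fun i j hij =>
    if hj : j = n then
      (K.XIsoOfEq (show i = n + 1 by have : j + 1 = i := hij; omega)).hom ≫ r ≫ s ≫
        (K.XIsoOfEq hj.symm).hom
    else 0
  have hσ : σ (n + 1) n rfl = r ≫ s := by
    simp [σ, HomologicalComplex.XIsoOfEq]
  have hσ0 : ∀ {i j} hij, j ≠ n → σ i j hij = 0 := fun _ hj => dif_neg hj
  have hf : ∀ i, (Homotopy.nullHomotopicMap' σ).f i =
      K.d i (i + 1) ≫ σ (i + 1) i rfl + σ i (i - 1) (by simp) ≫ K.d (i - 1) i := fun i =>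
    Homotopy.nullHomotopicMap'_f (c := ComplexShape.up ℤ) (by simp) rfl σ
  have hfn : (Homotopy.nullHomotopicMap' σ).f n = K.d n (n + 1) ≫ r ≫ s := by
    rw [hf, hσ, hσ0 (i := n) (by simp) (show n - 1 ≠ n by omega), zero_comp, add_zero]
  have hfn' : (Homotopy.nullHomotopicMap' σ).f (n + 1) = r ≫ s ≫ K.d n (n + 1) := by
    have h1 := Homotopy.nullHomotopicMap'_f (c := ComplexShape.up ℤ) (k₂ := n) (k₁ := n + 1)
      (k₀ := n + 1 + 1) rfl rfl σ
    rw [h1, hσ, hσ0 rfl (show n + 1 ≠ n by omega), comp_zero, zero_add, Category.assoc]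
  refine ⟨Homotopy.nullHomotopicMap' σ, ?_, ⟨Homotopy.nullHomotopy' σ⟩, hfn⟩
  ext i
  rw [HomologicalComplex.comp_f]
  by_cases hi : i = n
  · subst hi
    rw [hfn]
    simp only [Category.assoc]
    rw [reassoc_of% h]
  · by_cases hi' : i = n + 1
    · subst hi'
      rw [hfn']
      simp only [Category.assoc]
      rw [reassoc_of% h]
    · rw [hf, hσ0 rfl hi, hσ0 (i := i) (by simp) (show i - 1 ≠ n by omega)]
      simp

theorem finrank_end_le_of_retract {k : Type t} [Field k] [Linear k C] {A M : C} (i : A ⟶ M)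
    (r : M ⟶ A) (h : i ≫ r = 𝟙 A) [Module.Finite k (M ⟶ M)] :
    Module.finrank k (A ⟶ A) ≤ Module.finrank k (M ⟶ M) := by
  by_cases hne : r ≫ i = 𝟙 M
  · let e : A ≅ M := ⟨i, r, h, hne⟩
    exact (Linear.homCongr k e e).finrank_eq.le
  · exact (finrank_end_lt_of_retract i r h hne).le

theorem isStrictlyGE_of_retract {M K : CochainComplex C ℤ} (i : M ⟶ K) (r : K ⟶ M)
    (h : i ≫ r = 𝟙 M) {a : ℤ} (ha : K.IsStrictlyGE a) : M.IsStrictlyGE a := by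
  rw [CochainComplex.isStrictlyGE_iff]
  intro n hn
  have h1 : i.f n ≫ r.f n = 𝟙 _ := by rw [← HomologicalComplex.comp_f, h]; rfl
  rw [IsZero.iff_id_eq_zero, ← h1, (K.isZero_of_isStrictlyGE a n hn).eq_of_tgt (i.f n) 0, zero_comp]

theorem isStrictlyLE_of_retract {M K : CochainComplex C ℤ} (i : M ⟶ K) (r : K ⟶ M)
    (h : i ≫ r = 𝟙 M) {a : ℤ} (ha : K.IsStrictlyLE a) : M.IsStrictlyLE a := by
  rw [CochainComplex.isStrictlyLE_iff]
  intro n hn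
  have h1 : i.f n ≫ r.f n = 𝟙 _ := by rw [← HomologicalComplex.comp_f, h]; rfl
  rw [IsZero.iff_id_eq_zero, ← h1, (K.isZero_of_isStrictlyLE a n hn).eq_of_tgt (i.f n) 0, zero_comp]

end NullHomotopicIdempotents

/-! ### Minimal tilting complexes. -/

section MinimalComplexes

variable {k : Type t} [Field k] {C : Type u} [Category.{v} C] [Abelian C] [Linear k C]
  [HasExt.{w} C] {Λ : Type s} [PartialOrder Λ] {H : HighestWeightCategory k C Λ}

namespace HighestWeightCategory

theorem IsTiltingComplex.of_retract {M K : CochainComplex C ℤ} (hK : H.IsTiltingComplex K)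
    (i : M ⟶ K) (r : K ⟶ M) (h : i ≫ r = 𝟙 M) : H.IsTiltingComplex M := by
  obtain ⟨a, b, ha, hb⟩ := hK.bounded
  refine ⟨fun n => (hK.tilting n).of_retract (i.f n) (r.f n) ?_, a, b,
    isStrictlyGE_of_retract i r h ha, isStrictlyLE_of_retract i r h hb⟩
  rw [← HomologicalComplex.comp_f, h]
  rfl

/-- In each degree φ differs from the identity by terms containing a differential, which lie in the
Jacobson radical by minimality. -/
theorem isIso_f_of_homotopy_id {M : CochainComplex C ℤ} (H : HighestWeightCategory k C Λ)
    (hM : H.IsTiltingComplex M) (hmin : ∀ n : ℤ, InRadical H.IsTilting (M.d n (n + 1)))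
    {φ : M ⟶ M} (h : Homotopy φ (𝟙 M)) (n : ℤ) : IsIso (φ.f n) := by
  have hc := h.comm n
  rw [dNext_eq h.hom (show (ComplexShape.up ℤ).Rel n (n + 1) from rfl),
    prevD_eq h.hom (show (ComplexShape.up ℤ).Rel (n - 1) n by simp)] at hc
  have h1 : (End.of (M.d n (n + 1) ≫ h.hom (n + 1) n) : End (M.X n)) ∈
      Ring.jacobson (End (M.X n)) := by
    simpa using hmin n (M.X n) (hM.tilting n) (𝟙 _) (h.hom (n + 1) n)
  have h2 : (End.of (h.hom n (n - 1) ≫ M.d (n - 1) n) : End (M.X n)) ∈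
      Ring.jacobson (End (M.X n)) := by
    have := hmin (n - 1)
    rw [sub_add_cancel] at this
    simpa using this (M.X n) (hM.tilting n) (h.hom n (n - 1)) (𝟙 _)
  have : Module.Finite k (End (M.X n)) := H.finite_hom _ _
  have h3 := isUnit_one_add_of_mem_jacobson k (Ideal.add_mem _ h1 h2)
  rw [hc]
  exact (isUnit_iff_isIso _).1 h3

variable [HasDerivedCategory.{w'} C]

/-- A differential outside the radical is an isomorphism between nonzero summands of neighbouring
terms. The resulting null-homotopic idempotent e splits off; the image of 1 - e is isomorphic to K
in the derived category, and the total dimension of the endomorphism algebras of the terms drops. -/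
theorem IsTiltingComplex.exists_minimal {X : C} {K : CochainComplex C ℤ}
    (hK : H.IsTiltingComplex K) (hX : IsoInDerived K X) :
    ∃ M : CochainComplex C ℤ, H.IsMinimalTiltingComplex X M := by
  have hfin := H.finite_hom
  obtain ⟨a, b, ha, hb⟩ := hK.bounded
  induction hN : ∑ n ∈ Finset.Icc a b, Module.finrank k (K.X n ⟶ K.X n)
    using Nat.strong_induction_on generalizing K with
  | _ N ih =>
    by_cases hmin : ∀ n : ℤ, InRadical H.IsTilting (K.d n (n + 1))
    · exact ⟨K, hK, hmin, hX⟩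
    · simp only [InRadical, not_forall] at hmin
      obtain ⟨n, Z, -, x, y, hxy⟩ := hmin
      obtain ⟨S, s, r, hS, hsr⟩ := exists_retract_of_notMem_jacobson k hxy
      have hsr' : s ≫ (x ≫ K.d n (n + 1) ≫ y) ≫ r = 𝟙 S := hsr
      have hsr'' : (s ≫ x) ≫ K.d n (n + 1) ≫ (y ≫ r) = 𝟙 S := by simpa using hsr'
      obtain ⟨e, he, ⟨h0⟩, hen⟩ := exists_nullHomotopic_idempotent K n (s ≫ x) (y ≫ r) hsr''
      have hen0 : e.f n ≠ 0 := fun h => hS (by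
        rw [IsZero.iff_id_eq_zero]
        calc 𝟙 S = (s ≫ x) ≫ (K.d n (n + 1) ≫ (y ≫ r) ≫ s ≫ x) ≫ K.d n (n + 1) ≫ (y ≫ r) := by
              simp only [Category.assoc] at hsr'' ⊢
              rw [reassoc_of% hsr'', hsr'']
          _ = 0 := by rw [← hen, h, zero_comp, comp_zero])
      obtain ⟨M, j, q, hjq, hqj⟩ := IsIdempotentComplete.idempotents_split K (𝟙 K - e)
        (by simp [he])
      have hM := hK.of_retract j q hjq
      have hjq' : ∀ m, j.f m ≫ q.f m = 𝟙 _ := fun m => by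
        rw [← HomologicalComplex.comp_f, hjq]; rfl
      refine ih _ ?_ hM ?_ (isStrictlyGE_of_retract j q hjq ha)
        (isStrictlyLE_of_retract j q hjq hb) rfl
      · rw [← hN]
        refine Finset.sum_lt_sum (fun m _ => finrank_end_le_of_retract (j.f m) (q.f m) (hjq' m))
          ⟨n, ?_, finrank_end_lt_of_retract (j.f n) (q.f n) (hjq' n) fun h => hen0 ?_⟩
        · rw [Finset.mem_Icc]
          by_contra hn
          refine hen0 (IsZero.eq_of_src ?_ _ _)
          by_cases h1 : n < a
          · exact K.isZero_of_isStrictlyGE a n h1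
          · exact K.isZero_of_isStrictlyLE b n (by omega)
        · rw [← HomologicalComplex.comp_f, hqj] at h
          simpa using h
      · obtain ⟨φ⟩ := hX
        have h1 : DerivedCategory.Q.map e = 0 :=
          (DerivedCategory.Q_map_eq_of_homotopy C h0).trans (by simp)
        exact ⟨⟨DerivedCategory.Q.map j, DerivedCategory.Q.map q,
          by rw [← Functor.map_comp, hjq, CategoryTheory.Functor.map_id],
          by rw [← Functor.map_comp, hqj, Functor.map_sub, h1]; simp⟩ ≪≫ φ⟩

/-- Mutually inverse isomorphisms in the derived category come from chain maps f and g, with f ≫ g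
homotopic to the identity of M. Minimality makes f ≫ g invertible, so f is a split mono. -/
theorem IsMinimalTiltingComplex.isSummand {X : C} {M K : CochainComplex C ℤ}
    (hM : H.IsMinimalTiltingComplex X M) (hK : H.IsTiltingComplex K) (hX : IsoInDerived K X) :
    H.IsSummand M K := by
  obtain ⟨e⟩ := hM.iso
  obtain ⟨e'⟩ := hX
  obtain ⟨f, hf⟩ := hM.tilting.exists_map_eq hK (e.hom ≫ e'.inv)
  obtain ⟨g, hg⟩ := hK.exists_map_eq hM.tilting (e'.hom ≫ e.inv)
  obtain ⟨h⟩ := hM.tilting.nonempty_homotopy hM.tilting (f := f ≫ g) (g := 𝟙 M)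
    (by rw [Functor.map_comp, hf, hg]; simp)
  have := fun n => H.isIso_f_of_homotopy_id hM.tilting hM.minimal h n
  have : IsIso (f ≫ g) := HomologicalComplex.Hom.isIso_of_components _
  obtain ⟨B, j, q, hjq, hiq, hjr, hsum⟩ := exists_complement f (g ≫ inv (f ≫ g))
    (by rw [← Category.assoc, IsIso.hom_inv_id])
  exact ⟨B, hK.of_retract j q hjq, nonempty_iso_biprod
    (by rw [← Category.assoc, IsIso.hom_inv_id]) hjq hiq hjr hsum⟩

end HighestWeightCategory

end MinimalComplexes

/-! ### The multiplicity formula. -/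

section MultiplicityFormula

/-- Reindexing by j ↦ (j, i + j): pairs (j, k) of naturals with k - j = i correspond to those j with
i + j ≥ 0, and only finitely many j contribute. -/
theorem finsupp_sum_eq_sum_finsum {Λ : Type*} (h : Λ × ℤ →₀ ℕ) (S : Finset Λ)
    (hneg : ∀ n j, j < 0 → h (n, j) = 0) (hS : ∀ n j, n ∉ S → h (n, j) = 0) (i : ℤ)
    (F : Λ → ℕ → ℕ) :
    (h.sum fun q a => a * if 0 ≤ i + q.2 then F q.1 (i + q.2).toNat else 0) =
      ∑ n ∈ S, ∑ᶠ (q : ℕ × ℕ) (_ : (q.2 : ℤ) - (q.1 : ℤ) = i), h (n, q.1) * F n q.2 := by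
  classical
  obtain ⟨b, hb⟩ : ∃ b : ℕ, ∀ q ∈ h.support, q.2 < b := by
    refine ⟨(h.support.sup fun q => q.2.toNat) + 1, fun q hq => ?_⟩
    have : q.2.toNat ≤ _ := Finset.le_sup (f := fun q : Λ × ℤ => q.2.toNat) hq
    omega
  have hsub : h.support ⊆ S ×ˢ (Finset.range b).map Nat.castEmbedding := by
    intro q hq
    have hq0 : h (q.1, q.2) ≠ 0 := Finsupp.mem_support_iff.1 hq
    rw [Finset.mem_product]
    refine ⟨by_contra fun h' => hq0 (hS _ _ h'), Finset.mem_map.2 ⟨q.2.toNat, ?_, ?_⟩⟩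
    all_goals
      have h1 : 0 ≤ q.2 := not_lt.1 fun h' => hq0 (hneg _ _ h')
      have h2 := hb q hq
    · rw [Finset.mem_range]; omega
    · simpa using h1
  rw [Finsupp.sum_of_support_subset _ hsub _ (by simp), Finset.sum_product]
  refine Finset.sum_congr rfl fun n _ => ?_
  rw [Finset.sum_map]
  let t : Finset (ℕ × ℕ) := ((Finset.range b).filter fun j : ℕ => 0 ≤ i + (j : ℤ)).image
    fun j : ℕ => (j, (i + (j : ℤ)).toNat)
  have ht := finsum_mem_eq_sum_of_inter_support_eq (fun q : ℕ × ℕ => h (n, q.1) * F n q.2)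
    (s := {q : ℕ × ℕ | (q.2 : ℤ) - (q.1 : ℤ) = i}) (t := t) (by
      ext ⟨x, y⟩
      simp only [Set.mem_inter_iff, Set.mem_ofPred_eq, Function.mem_support, and_congr_left_iff]
      intro hxy
      have hx : ((x : ℕ) : ℤ) < b := hb (n, x) (Finsupp.mem_support_iff.2
        (left_ne_zero_of_mul hxy))
      simp only [t, Finset.coe_image, Set.mem_image, Finset.mem_coe, Finset.mem_filter,
        Finset.mem_range, Prod.mk.injEq]
      constructor
      · intro hi
        exact ⟨x, ⟨by omega, by omega⟩, rfl, by omega⟩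
      · rintro ⟨j, ⟨-, h2⟩, rfl, h4⟩
        omega)
  refine Eq.trans ?_ ht.symm
  rw [Finset.sum_image (fun x _ y _ hxy => congrArg Prod.fst hxy), Finset.sum_filter]
  refine Finset.sum_congr rfl fun j _ => ?_
  simp only [Nat.castEmbedding_apply, mul_ite, mul_zero]

variable {k : Type t} [Field k] {C : Type u} [Category.{v} C] [Abelian C] [Linear k C]
  [HasExt.{w} C] {Λ : Type s} [PartialOrder Λ] {H : HighestWeightCategory k C Λ} {T : Λ → C}

namespace HighestWeightCategory

theorem MinimalCoresolution.eq_zero {I : Set Λ} {X : C} {c : ℕ → Λ → ℕ}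
    (hX : H.MinimalCoresolution T I X c) {l : Λ} (hl : l ∉ I) (n : ℕ) : c n l = 0 := by
  induction hX generalizing n with
  | zero h => rfl
  | step hS h₂ h₃ hmin hm hI hc ih =>
    cases n with
    | zero => exact by_contra fun h => hl (hI l h)
    | succ n => exact ih n

theorem IsIndecomposableTilting.exists_standard_coresolution
    (hT : ∀ l, H.IsIndecomposableTilting l (T l)) (l : Λ) :
    ∃ c, H.MinimalCoresolution T (Set.Iic l) (H.Δ l) c :=
  H.exists_minimalCoresolution hT (.of_mem l)
    ((H.supp_standard l).trans (Set.singleton_subset_iff.2 (Set.mem_Iic.2 le_rfl)))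

end HighestWeightCategory

end MultiplicityFormula

end MinTilt

theorem mainTheorem5 {k : Type t} [Field k] {C : Type u} [Category.{v} C] [Abelian C]
    [Linear k C] [HasExt.{w} C] [HasDerivedCategory.{w'} C] {Λ : Type s} [PartialOrder Λ]
    (H : MinTilt.HighestWeightCategory k C Λ) :
    (∀ l : Λ, ∃ M : C, H.IsIndecomposableTilting l M) ∧
    ∀ T : Λ → C, (∀ l, H.IsIndecomposableTilting l (T l)) → ∀ l : Λ,
      -- finiteness of the numbers and of the sums in the formula below
      (∀ m, m ≤ l → (∀ j, Module.Finite k (Ext (H.L l) (H.N m) j)) ∧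
        ∃ n, ∀ j, n ≤ j → Subsingleton (Ext (H.L l) (H.N m) j)) ∧
      (∀ (Γ : LowerSet Λ) [Finite Γ], l ∈ Γ → ∀ m n, m ≤ l → n ≤ l →
        ∀ j, Module.Finite k (Ext (H.dualSimple T Γ m) (H.dualCostandard T Γ n) j)) ∧
      ∃ K : CochainComplex C ℤ, H.IsTiltingComplex K ∧
        MinTilt.IsoInDerived K (H.L l) ∧
        (∀ (i : ℤ) (m : Λ), ¬ m ≤ l → MinTilt.SummandMultiplicity (K.X i) (T m) 0) ∧
        (∀ (i : ℤ) (m : Λ), m ≤ l → ∀ (Γ : LowerSet Λ) [Finite Γ], l ∈ Γ →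
          MinTilt.SummandMultiplicity (K.X i) (T m)
            (∑ n ∈ (H.lowerFinite l).toFinset,
              ∑ᶠ (q : ℕ × ℕ) (_ : (q.2 : ℤ) - (q.1 : ℤ) = i),
                Module.finrank k (Ext (H.L l) (H.N n) q.1) *
                Module.finrank k (Ext (H.dualSimple T Γ m) (H.dualCostandard T Γ n) q.2))) ∧
        (∃ M : CochainComplex C ℤ, H.IsMinimalTiltingComplex (H.L l) M) ∧
        ∀ M : CochainComplex C ℤ, H.IsMinimalTiltingComplex (H.L l) M → H.IsSummand M K := by
  refine ⟨H.exists_isIndecomposableTilting, fun T hT l => ?_⟩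
  choose c hc using
    MinTilt.HighestWeightCategory.IsIndecomposableTilting.exists_standard_coresolution hT
  -- The coresolutions are chosen without reference to Γ; every Γ containing l sees their
  -- multiplicities as Ext dimensions, so one complex serves all Γ.
  have hExt : ∀ (Γ : LowerSet Λ) [Finite Γ], l ∈ Γ → ∀ m n, m ≤ l → n ≤ l → ∀ j,
      Module.Finite k (Ext (H.dualSimple T Γ m) (H.dualCostandard T Γ n) j) ∧
      Module.finrank k (Ext (H.dualSimple T Γ m) (H.dualCostandard T Γ n) j) = c n j m := by
    intro Γ _ hl m n hm hn j
    exact (hc n).finrank_ext hT ⟨m, Γ.lower hm hl⟩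
      (fun x hx => Γ.lower (le_trans hx hn) hl) j
  obtain ⟨h, h1, h2, h3, K, hK, hKm, hKL⟩ :=
    H.exists_hasTilt_L (fun n => (hc n).hasTilt) l
  have hmul : ∀ (i : ℤ) (m : Λ), MinTilt.SummandMultiplicity (K.X i) (T m)
      (h.sum fun q a => a * if 0 ≤ i + q.2 then c q.1 (i + q.2).toNat m else 0) := by
    intro i m
    convert (hKm i).summandMultiplicity (fun n => (hT n).indecomposable)
      (fun n n' ⟨e⟩ => H.eq_of_iso_indecomposableTilting (hT n) (hT n') e) m using 1
    simp only [Finsupp.sum, Finset.sum_apply]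
    refine Finset.sum_congr rfl fun q _ => ?_
    simp only [MinTilt.HighestWeightCategory.extendZero, Pi.smul_apply, smul_eq_mul]
    split_ifs <;> rfl
  refine ⟨fun m _ => ⟨H.finite_ext_L_costandard l m, H.exists_ext_L_costandard_subsingleton l m⟩,
    fun Γ _ hl m n hm hn j => (hExt Γ hl m n hm hn j).1, K, hK, hKL, fun i m hm => ?_,
    fun i m hm Γ _ hl => ?_, hK.exists_minimal hKL, fun M hM => hM.isSummand hK hKL⟩
  · convert hmul i m using 1
    -- Only Δ_n with n ≤ l are used, and their coresolutions involve only weights ≤ n.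
    refine (Finset.sum_eq_zero fun q hq => ?_).symm
    have hq : q.1 ≤ l := by_contra fun hq' =>
      Finsupp.mem_support_iff.1 hq (h3 q.1 q.2 hq')
    have h0 := fun n => (hc q.1).eq_zero (l := m) (fun hmq => hm (le_trans hmq hq)) n
    simp [h0]
  · convert hmul i m using 1
    rw [MinTilt.finsupp_sum_eq_sum_finsum h (H.lowerFinite l).toFinset h2
      (fun n j hn => h3 n j (by simpa using hn)) i fun n j => c n j m]
    refine Finset.sum_congr rfl fun n hn => finsum_congr fun q => finsum_congr fun _ => ?_
    rw [h1, (hExt Γ hl m n hm (by simpa using hn) q.2).2]
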